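/- **Setting.** Let $M$ be a smooth finite-dimensional manifold and let $(G,H,t,m)$ be a Lie crossed module: $G,H$ are (finite-dimensional real) Lie groups with Lie algebras $\mathfrak g,\mathfrak h$, $t:H\to G$ is a smooth homomorphism and $m:G\times H\to H$ is a smooth action of $G$ on $H$ by automorphisms, with $t(m(a)(X))=a\,t(X)\,a^{-1}$ and $m(t(X))(Y)=XYX^{-1}$. Write $\dot t=dt(1):\mathfrak h\to\mathfrak g$, $\dot m(a)=d(m(a))(1):\mathfrak h\to\mathfrak h$, and $\widehat m:\mathfrak g\to\mathrm{End}(\mathfrak h)$ for the differential at $1$ of $a\mapsto\dot m(a)$; the same symbols are used, combined with the wedge product, for forms. A *connection doublet* is a pair $(\theta,\Upsilon)$ of smooth forms $\theta\in\Omega^1(M,\mathfrak g)$, $\Upsilon\in\Omega^2(M,\mathfrak h)$ with $d\theta+\tfrac12[\theta,\theta]-\dot t(\Upsilon)=0$; it is *flat* if moreover $d\Upsilon+\widehat m(\theta,\Upsilon)=0$. A *1-gauge transformation* is a pair $(g,J)$ of a smooth map $g:M\to G$ and a smooth form $J\in\Omega^1(M,\mathfrak h)$. The gauge-transformed doublet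 is $$\theta'={}^{g,J}\theta=\mathrm{Ad}\,g(\theta)-dg\,g^{-1}-\dot t(J),\qquad \Upsilon'={}^{g,J}\Upsilon=\dot m(g)(\Upsilon)-dJ-\tfrac12[J,J]-\widehat m(\theta',J).$$ **Curves and surfaces.** A curve $\gamma:p_0\to p_1$ is a smooth map $\gamma:\mathbb R\to M$ with $\gamma(x)=p_0$ for $x<\epsilon$ and $\gamma(x)=p_1$ for $x>1-\epsilon$, for some $0<\epsilon<1/2$. A surface $\Sigma:\gamma_0\Rightarrow\gamma_1$ between curves $\gamma_0,\gamma_1:p_0\to p_1$ is a smooth map $\Sigma:\mathbb R^2\to M$ with $\Sigma(x,y)=p_0$ for $x<\epsilon$, $=p_1$ for $x>1-\epsilon$, $=\gamma_0(x)$ for $y<\epsilon$, $=\gamma_1(x)$ for $y>1-\epsilon$, for some $0<\epsilon<1/2$. The unit curve is $\iota_p(x)=p$, the inverse is $\gamma^{-1_\circ}(x)=\gamma(1-x)$, and $(\gamma_2\circ\gamma_1)(x)$ is $\gamma_1(2x)$ for $x\le 1/2$ and $\gamma_2(2x-1)$ for $x\ge1/2$. The unit surface is $I_\gamma(x,y)=\gamma(x)$;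 vertical composition $\Sigma_2\bullet\Sigma_1$ and horizontal composition $\Sigma_2\circ\Sigma_1$ are the analogous concatenations in $y$ and in $x$. A *thin homotopy* of curves $\gamma_0,\gamma_1:p_0\to p_1$ is a smooth $h:\mathbb R^2\to M$ with $h(x,y)=p_0$ for $x<\epsilon$, $=p_1$ for $x>1-\epsilon$, $=\gamma_0(x)$ for $y<\epsilon$, $=\gamma_1(x)$ for $y>1-\epsilon$ (some $0<\epsilon<1/2$) and $\mathrm{rank}\,dh\le1$. A *thin homotopy* of surfaces $\Sigma_0,\Sigma_1$ (with curves $p_0\to p_1$) is a smooth $h:\mathbb R^3\to M$ with, for some $\epsilon>0$, $h(x,y,z)=p_0$ for $x<\epsilon$, $=p_1$ for $x>1-\epsilon$, $=h(x,0,z)$ for $y<\epsilon$, $=h(x,1,z)$ for $y>1-\epsilon$, $=\Sigma_0(x,y)$ for $z<\epsilon$, $=\Sigma_1(x,y)$ for $z>1-\epsilon$, such that the maps $(x,z)\mapsto h(x,0,z)$ and $(x,z)\mapsto h(x,1,z)$ have rank $\le1$ everywhere and $\mathrm{rank}\,dh\le2$; it is a *homotopy* of surfaces if the last condition is dropped.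 The *path 2-groupoid* $(M,P_1M,P_2M)$ has points, thin homotopy classes of curves and thin homotopy classes of surfaces as cells; the *fundamental 2-groupoid* $(M,P_1M,P_2^0M)$ has homotopy classes of surfaces as 2-cells instead. The operations are induced by those above. The delooping 2-groupoid $B_0(G,H)$ has one object, the elements of $G$ as 1-cells (composed by multiplication), and as 2-cells $a\Rightarrow b$ the $X\in H$ with $b=t(X)a$; the vertical composite of $X:a\Rightarrow b$ and $Y:b\Rightarrow c$ is $YX$, and the horizontal composite $Y\circ X:ca\Rightarrow db$ of $X:a\Rightarrow b$ and $Y:c\Rightarrow d$ is $Y\,m(c)(X)$. **Transports.** For a curve $\gamma$ and $x_0\in\mathbb R$, let $f(\cdot,x_0):\mathbb R\to G$ solve $\partial_xf\,f^{-1}=-(\gamma^*\theta)_x$, $f(x_0,x_0)=1$, and put $F_\theta(\gamma)=f(1,0)$. For a surface $\Sigma$, put $a=\Sigma^*\theta$, $B=\Sigma^*\Upsilon$; for $x_0,y_0\in\mathbb R$ let $v:\mathbb R\to G$ solve $v'v^{-1}=-a_y(x_0,\cdot)$, $v(y_0)=1$, for each $y$ let $u_y:\mathbb R\to G$ solve $u_y'u_y^{-1}=-a_x(\cdot,y)$,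 $u_y(x_0)=1$, and let $W_{x_0,y_0}:\mathbb R^2\to H$ be the smooth solution of $$\partial_x\big(\partial_yW\,W^{-1}\big)(x,y)=-\dot m\big(v(y)^{-1}u_y(x)^{-1}\big)(B_{xy}(x,y)),\qquad W(x_0,y)=W(x,y_0)=1 .$$ Put $F_{\theta,\Upsilon}(\Sigma)=W_{1,0}(0,1)$ (i.e. $x_0=1$, $y_0=0$, evaluated at $x=0$, $y=1$). Finally, for a curve $\gamma$ let $\Lambda_{x_0}:\mathbb R\to H$ solve $$\Lambda_{x_0}(x)^{-1}\Lambda_{x_0}'(x)=-\dot m\big(f(x,x_0)^{-1}g(\gamma(x))^{-1}\big)\big((\gamma^*J)_x(x)\big),\qquad\Lambda_{x_0}(x_0)=1,$$ and put $G_{g,J;\theta}(\gamma)=\Lambda_1(0)\in H$. **Statement.** For every connection doublet $(\theta,\Upsilon)$ and every 1-gauge transformation $(g,J)$: 1. All the differential equations above, for any smooth coefficient and any base points $x_0$, $y_0$, have unique smooth solutions, so that $F_\theta$, $F_{\theta,\Upsilon}$ and $G:=G_{g,J;\theta}$ are well defined. 2. $(\theta',\Upsilon')$ is a connection doublet, and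 it is flat if $(\theta,\Upsilon)$ is flat. 3. $G(\iota_p)=1$, $G(\gamma^{-1_\circ})=m(F_\theta(\gamma)^{-1})(G(\gamma)^{-1})$, $G(\gamma_2\circ\gamma_1)=G(\gamma_2)\,m(F_\theta(\gamma_2))(G(\gamma_1))$, and $G(\gamma_0)=G(\gamma_1)$ whenever $\gamma_0,\gamma_1$ are thin homotopic. 4. $F_\theta,F_{\theta,\Upsilon}$ induce a strict 2-functor $\bar F_{\theta,\Upsilon}:(M,P_1M,P_2M)\to B_0(G,H)$, $F_{\theta'},F_{\theta',\Upsilon'}$ induce a strict 2-functor $\bar F_{\theta',\Upsilon'}:(M,P_1M,P_2M)\to B_0(G,H)$, and there is a pseudonatural transformation $\bar F_{\theta,\Upsilon}\Rightarrow\bar F_{\theta',\Upsilon'}$ whose 1-cell at a point $p$ is $g(p)$ and whose 2-cell at a curve $\gamma:p_0\to p_1$ is $$m(g(p_1))(G(\gamma)):\ g(p_1)F_\theta(\gamma)\Rightarrow F_{\theta'}(\gamma)g(p_0).$$ That is, these are 2-cells of $B_0(G,H)$ depending only on the thin homotopy class of $\gamma$; the 2-cell of $\iota_p$ is the identity; the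 2-cell of $\gamma_2\circ\gamma_1$ is the pasting of those of $\gamma_2$ and $\gamma_1$; and they are natural with respect to the 2-cells $\Sigma:\gamma_0\Rightarrow\gamma_1$: $$F_{\theta',\Upsilon'}(\Sigma)\,m(g(p_1))(G(\gamma_0))=m(g(p_1))\big(G(\gamma_1)\,F_{\theta,\Upsilon}(\Sigma)\big).$$ 5. If $(\theta,\Upsilon)$ is flat, the same holds with the fundamental 2-groupoid $(M,P_1M,P^0_2M)$ in place of the path 2-groupoid. -/

import Mathlib

open scoped Manifold ContDiff Topology

noncomputable section

namespace HigherTransport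

/-! ### Calculus on manifolds

All manifolds are finite dimensional, smooth and without boundary, modelled on a normed space.
By Mathlib's definition the tangent space at every point of a manifold modelled on `V` is `V` itself
(through the preferred chart at the point); in particular the Lie algebra `T_1 K` of a Lie group `K`
modelled on `𝔨` is `𝔨`. -/

section Calculus

variable (V W : Type*) {X Y : Type*} [NormedAddCommGroup V] [NormedSpace ℝ V]
  [NormedAddCommGroup W] [NormedSpace ℝ W]
  [TopologicalSpace X] [ChartedSpace V X] [TopologicalSpace Y] [ChartedSpace W Y]

/-- The differential `df(x) : T_x X → T_{f x} Y`. -/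
def tang (f : X → Y) (x : X) : V →L[ℝ] W := mfderiv 𝓘(ℝ, V) 𝓘(ℝ, W) f x

/-- Smooth maps between manifolds. -/
abbrev Smooth (f : X → Y) : Prop := ContMDiff 𝓘(ℝ, V) 𝓘(ℝ, W) ∞ f

/-- The rank of the differential `df(x)`. -/
def rk (f : X → Y) (x : X) : ℕ :=
  Module.finrank ℝ (LinearMap.range (tang V W f x).toLinearMap)

end Calculus

section Forms

variable {E M F : Type*} [NormedAddCommGroup E] [NormedSpace ℝ E]
  [TopologicalSpace M] [ChartedSpace E M] [NormedAddCommGroup F] [NormedSpace ℝ F] {n : ℕ}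

/-- `F`-valued differential `n`-forms on `M` (no regularity imposed): an alternating `n`-linear
map on each tangent space. -/
abbrev DForm (E M F : Type*) [NormedAddCommGroup E] [NormedSpace ℝ E] [NormedAddCommGroup F]
    [NormedSpace ℝ F] (n : ℕ) : Type _ := M → E [⋀^Fin n]→L[ℝ] F

/-- The form `α` read in the chart around `c`, i.e. its pull-back by the inverse chart. -/
def DForm.rep (α : DForm E M F n) (c : M) (y : E) : E [⋀^Fin n]→L[ℝ] F :=
  (α ((extChartAt 𝓘(ℝ, E) c).symm y)).compContinuousLinearMap
    (tang E E (extChartAt 𝓘(ℝ, E) c).symm y)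

/-- A form is smooth if it is smooth in all charts. -/
def DForm.IsSmooth (α : DForm E M F n) : Prop :=
  ∀ c : M, ContDiffOn ℝ ∞ (α.rep c) (extChartAt 𝓘(ℝ, E) c).target

/-- The exterior derivative, computed in a chart around the point. -/
def DForm.d (α : DForm E M F n) : DForm E M F (n + 1) := fun p =>
  (extDeriv (α.rep p) (extChartAt 𝓘(ℝ, E) p p)).compContinuousLinearMap
    (tang E E (extChartAt 𝓘(ℝ, E) p) p)

variable {A B C : Type*} [NormedAddCommGroup A] [NormedSpace ℝ A]
  [NormedAddCommGroup B] [NormedSpace ℝ B] [NormedAddCommGroup C] [NormedSpace ℝ C]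

/-- The wedge product of a `1`-form with an `n`-form (at one point) with respect to a bilinear
map `b`. -/
def wedge (b : A →L[ℝ] B →L[ℝ] C) (α : E [⋀^Fin 1]→L[ℝ] A) (β : E [⋀^Fin n]→L[ℝ] B) :
    E [⋀^Fin (n + 1)]→L[ℝ] C :=
  ContinuousAlternatingMap.alternatizeUncurryFin
    ((ContinuousLinearMap.compContinuousAlternatingMapCLM ℝ E B C (Fin n)).flip β ∘L b ∘L
      (ContinuousAlternatingMap.ofSubsingleton ℝ E A (0 : Fin 1)).symm α)

theorem wedge_apply (b : A →L[ℝ] B →L[ℝ] C) (α : E [⋀^Fin 1]→L[ℝ] A)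
    (β : E [⋀^Fin n]→L[ℝ] B) (v : Fin (n + 1) → E) :
    wedge b α β v =
      ∑ i : Fin (n + 1), (-1 : ℤ) ^ (i : ℕ) • b (α ![v i]) (β (i.removeNth v)) := by
  have e : ∀ x : E, (fun _ : Fin 1 => x) = ![x] := fun x => by ext i; simp
  simp [wedge, ContinuousAlternatingMap.alternatizeUncurryFin_apply, e]

end Forms

/-! ### Lie groups and Lie crossed modules -/

section LieGroups

variable {𝔨 : Type*} [NormedAddCommGroup 𝔨] [NormedSpace ℝ 𝔨]
  {K : Type*} [Group K] [TopologicalSpace K] [ChartedSpace 𝔨 K]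

theorem lieGroup_minSmoothness [LieGroup 𝓘(ℝ, 𝔨) ∞ K] :
    LieGroup 𝓘(ℝ, 𝔨) (minSmoothness ℝ 3) K := by
  rw [minSmoothness_of_isRCLikeNormedField]; infer_instance

/-- Mathlib's Lie bracket on the Lie algebra `𝔨 = T_1 K`. -/
def lieBr (K : Type*) [Group K] [TopologicalSpace K] [ChartedSpace 𝔨 K] (x y : 𝔨) : 𝔨 :=
  letI x' : GroupLieAlgebra 𝓘(ℝ, 𝔨) K := x
  letI y' : GroupLieAlgebra 𝓘(ℝ, 𝔨) K := y
  (⁅x', y'⁆ : GroupLieAlgebra 𝓘(ℝ, 𝔨) K)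

/-- The Lie bracket as a continuous bilinear map. -/
def ad (K : Type*) [Group K] [TopologicalSpace K] [ChartedSpace 𝔨 K] [FiniteDimensional ℝ 𝔨]
    [LieGroup 𝓘(ℝ, 𝔨) ∞ K] : 𝔨 →L[ℝ] 𝔨 →L[ℝ] 𝔨 :=
  haveI := lieGroup_minSmoothness (𝔨 := 𝔨) (K := K)
  haveI : CompleteSpace 𝔨 := FiniteDimensional.complete ℝ 𝔨
  LinearMap.toContinuousLinearMap (LinearMap.toContinuousLinearMap.toLinearMap ∘ₗ
    LinearMap.mk₂ ℝ (lieBr K)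
      (add_lie (L := GroupLieAlgebra 𝓘(ℝ, 𝔨) K) (M := GroupLieAlgebra 𝓘(ℝ, 𝔨) K))
      (smul_lie (R := ℝ) (L := GroupLieAlgebra 𝓘(ℝ, 𝔨) K) (M := GroupLieAlgebra 𝓘(ℝ, 𝔨) K))
      (lie_add (L := GroupLieAlgebra 𝓘(ℝ, 𝔨) K) (M := GroupLieAlgebra 𝓘(ℝ, 𝔨) K))
      (lie_smul (R := ℝ) (L := GroupLieAlgebra 𝓘(ℝ, 𝔨) K) (M := GroupLieAlgebra 𝓘(ℝ, 𝔨) K)))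

theorem ad_apply [FiniteDimensional ℝ 𝔨] [LieGroup 𝓘(ℝ, 𝔨) ∞ K] (x y : 𝔨) :
    ad K x y = lieBr K x y := rfl

/-- The adjoint action `Ad a : 𝔨 → 𝔨`. -/
def Ad (a : K) : 𝔨 →L[ℝ] 𝔨 := tang 𝔨 𝔨 (fun b : K => a * b * a⁻¹) 1

/-- `u'(x) u(x)⁻¹ ∈ 𝔨` for a curve `u` in `K`. -/
def rightLogDeriv (u : ℝ → K) (x : ℝ) : 𝔨 := tang ℝ 𝔨 (fun s => u s * (u x)⁻¹) x (1 : ℝ)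

/-- `u(x)⁻¹ u'(x) ∈ 𝔨` for a curve `u` in `K`. -/
def leftLogDeriv (u : ℝ → K) (x : ℝ) : 𝔨 := tang ℝ 𝔨 (fun s => (u x)⁻¹ * u s) x (1 : ℝ)

/-- The `𝔨`-valued `1`-form `dg g⁻¹` of a map `g : M → K`. -/
def maurerCartan {E M : Type*} [NormedAddCommGroup E] [NormedSpace ℝ E] [TopologicalSpace M]
    [ChartedSpace E M] (g : M → K) : DForm E M 𝔨 1 := fun p =>
  ContinuousAlternatingMap.ofSubsingleton ℝ E 𝔨 0 (tang E 𝔨 (fun q => g q * (g p)⁻¹) p)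

end LieGroups

/-- A Lie crossed module `(G, H, t, m)`. -/
structure LieCrossedModule (𝔤 𝔥 G H : Type*)
    [NormedAddCommGroup 𝔤] [NormedSpace ℝ 𝔤] [NormedAddCommGroup 𝔥] [NormedSpace ℝ 𝔥]
    [Group G] [TopologicalSpace G] [ChartedSpace 𝔤 G]
    [Group H] [TopologicalSpace H] [ChartedSpace 𝔥 H] where
  /-- the target map -/
  t : H →* G
  /-- the action of `G` on `H` by automorphisms -/
  m : G →* MulAut H
  smooth_t : Smooth 𝔥 𝔤 (fun X : H => t X)
  smooth_m : ContMDiff (𝓘(ℝ, 𝔤).prod 𝓘(ℝ, 𝔥)) 𝓘(ℝ, 𝔥) ∞ (fun z : G × H => m z.1 z.2)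
  equivariant : ∀ (a : G) (X : H), t (m a X) = a * t X * a⁻¹
  peiffer : ∀ X Y : H, m (t X) Y = X * Y * X⁻¹

section Main

variable {E : Type*} [NormedAddCommGroup E] [NormedSpace ℝ E]
  {M : Type*} [TopologicalSpace M] [ChartedSpace E M]
  {𝔤 𝔥 G H : Type*}
  [NormedAddCommGroup 𝔤] [NormedSpace ℝ 𝔤] [NormedAddCommGroup 𝔥] [NormedSpace ℝ 𝔥]
  [Group G] [TopologicalSpace G] [ChartedSpace 𝔤 G]
  [Group H] [TopologicalSpace H] [ChartedSpace 𝔥 H]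

namespace LieCrossedModule

variable (C : LieCrossedModule 𝔤 𝔥 G H)

/-- `ṫ : 𝔥 → 𝔤`, the differential of `t` at the identity. -/
def tdot : 𝔥 →L[ℝ] 𝔤 := tang 𝔥 𝔤 (fun X : H => C.t X) 1

/-- `ṁ(a) : 𝔥 → 𝔥`, the differential of `m(a)` at the identity. -/
def mdot (a : G) : 𝔥 →L[ℝ] 𝔥 := tang 𝔥 𝔥 (fun X : H => C.m a X) 1

/-- `m̂ : 𝔤 → End 𝔥`, the differential of `ṁ` at the identity. -/
def mhat : 𝔤 →L[ℝ] 𝔥 →L[ℝ] 𝔥 := tang 𝔤 (𝔥 →L[ℝ] 𝔥) (fun a : G => C.mdot a) 1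

/-! #### The delooping `2`-groupoid `B₀(G, H)`

It has one object, the elements of `G` as `1`-cells (composed by multiplication) and the following
`2`-cells `a ⇒ b`. -/

/-- A `2`-cell `a ⇒ b` of `B₀(G, H)`: an element `X` of `H` with `b = t(X) a`. -/
def Cell (a b : G) : Type _ := {X : H // b = C.t X * a}

namespace Cell

variable {C} {a b c d : G}

/-- The identity `2`-cell. -/
def id (a : G) : C.Cell a a := ⟨1, by simp⟩

/-- Vertical composition `Y • X` of `X : a ⇒ b` and `Y : b ⇒ c`. -/
def vcomp (Y : C.Cell b c) (X : C.Cell a b) : C.Cell a c :=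
  ⟨Y.1 * X.1, by rw [map_mul, mul_assoc, ← X.2, ← Y.2]⟩

/-- Horizontal composition `Y ∘ X` of `X : a ⇒ b` and `Y : c ⇒ d`. -/
def hcomp (Y : C.Cell c d) (X : C.Cell a b) : C.Cell (c * a) (d * b) :=
  ⟨Y.1 * C.m c X.1, by
    rw [map_mul, C.equivariant]
    conv_lhs => rw [X.2, Y.2]
    group⟩

end Cell

end LieCrossedModule

/-! ### Connection doublets and gauge transformations -/

section Doublets

variable [FiniteDimensional ℝ 𝔤] [FiniteDimensional ℝ 𝔥]
  [LieGroup 𝓘(ℝ, 𝔤) ∞ G] [LieGroup 𝓘(ℝ, 𝔥) ∞ H]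
  (C : LieCrossedModule 𝔤 𝔥 G H)

/-- `(θ, Υ)` is a connection doublet: smooth forms with `dθ + ½[θ,θ] - ṫ(Υ) = 0`. -/
structure IsConnectionDoublet (θ : DForm E M 𝔤 1) (Υ : DForm E M 𝔥 2) : Prop where
  smooth_θ : θ.IsSmooth
  smooth_Υ : Υ.IsSmooth
  fake_flat : ∀ p, θ.d p + (1 / 2 : ℝ) • wedge (ad G) (θ p) (θ p)
    - C.tdot.compContinuousAlternatingMap (Υ p) = 0

/-- The doublet `(θ, Υ)` is flat: `dΥ + m̂(θ, Υ) = 0`. -/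
def IsFlat (θ : DForm E M 𝔤 1) (Υ : DForm E M 𝔥 2) : Prop :=
  ∀ p, Υ.d p + wedge C.mhat (θ p) (Υ p) = 0

/-- `Ad g(θ) - dg g⁻¹ - ṫ(J)`. -/
def gaugeθ (g : M → G) (J : DForm E M 𝔥 1) (θ : DForm E M 𝔤 1) : DForm E M 𝔤 1 := fun p =>
  (Ad (g p)).compContinuousAlternatingMap (θ p) - maurerCartan g p
    - C.tdot.compContinuousAlternatingMap (J p)

/-- `ṁ(g)(Υ) - dJ - ½[J,J] - m̂(Ad g(θ) - dg g⁻¹ - ṫ(J), J)`. -/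
def gaugeΥ (g : M → G) (J : DForm E M 𝔥 1) (θ : DForm E M 𝔤 1) (Υ : DForm E M 𝔥 2) :
    DForm E M 𝔥 2 := fun p =>
  (C.mdot (g p)).compContinuousAlternatingMap (Υ p) - J.d p
    - (1 / 2 : ℝ) • wedge (ad H) (J p) (J p) - wedge C.mhat (gaugeθ C g J θ p) (J p)

end Doublets

/-! ### Curves, surfaces and their homotopies -/

/-- `f₁` where `ℓ ≤ 1/2` and `f₂` where `ℓ > 1/2`. -/
def glue {V M : Type*} (ℓ : V → ℝ) (f₁ f₂ : V → M) (v : V) : M :=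
  if ℓ v ≤ 1 / 2 then f₁ v else f₂ v

theorem glue_eventuallyEq {V M : Type*} [TopologicalSpace V] {ℓ : V → ℝ} (hℓ : Continuous ℓ)
    {f₁ f₂ : V → M} {δ : ℝ} (hδ : 0 < δ)
    (h : ∀ v, |ℓ v - 1 / 2| < δ → f₁ v = f₂ v) (v : V) :
    glue ℓ f₁ f₂ =ᶠ[𝓝 v] f₁ ∨ glue ℓ f₁ f₂ =ᶠ[𝓝 v] f₂ := by
  by_cases hv : ℓ v < 1 / 2 + δ
  · left
    filter_upwards [(isOpen_lt hℓ continuous_const).mem_nhds hv] with w hw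
    have hw' : ℓ w < 1 / 2 + δ := hw
    by_cases h2 : ℓ w ≤ 1 / 2
    · rw [glue, if_pos h2]
    · rw [glue, if_neg h2, h w]
      rw [abs_lt]; constructor <;> linarith
  · right
    have hv' : (1 / 2 : ℝ) < ℓ v := by linarith
    filter_upwards [(isOpen_lt continuous_const hℓ).mem_nhds hv'] with w hw
    have hw' : 1 / 2 < ℓ w := hw
    rw [glue, if_neg (not_le.2 hw')]

section Glue

variable {V : Type*} [NormedAddCommGroup V] [NormedSpace ℝ V]

theorem smooth_glue {ℓ : V → ℝ} (hℓ : Continuous ℓ) {f₁ f₂ : V → M} {δ : ℝ} (hδ : 0 < δ)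
    (h : ∀ v, |ℓ v - 1 / 2| < δ → f₁ v = f₂ v) (h₁ : Smooth V E f₁) (h₂ : Smooth V E f₂) :
    Smooth V E (glue ℓ f₁ f₂) := by
  intro v
  rcases glue_eventuallyEq hℓ hδ h v with e | e
  · exact (h₁ v).congr_of_eventuallyEq e
  · exact (h₂ v).congr_of_eventuallyEq e

theorem rk_glue {ℓ : V → ℝ} (hℓ : Continuous ℓ) {f₁ f₂ : V → M} {δ : ℝ} (hδ : 0 < δ)
    (h : ∀ v, |ℓ v - 1 / 2| < δ → f₁ v = f₂ v) {k : ℕ} (h₁ : ∀ v, rk V E f₁ v ≤ k)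
    (h₂ : ∀ v, rk V E f₂ v ≤ k) (v : V) : rk V E (glue ℓ f₁ f₂) v ≤ k := by
  rcases glue_eventuallyEq hℓ hδ h v with e | e
  · have := h₁ v
    rwa [rk, tang, ← e.mfderiv_eq] at this
  · have := h₂ v
    rwa [rk, tang, ← e.mfderiv_eq] at this

theorem rk_comp_le [FiniteDimensional ℝ E] {U : Type*} [NormedAddCommGroup U] [NormedSpace ℝ U]
    {h : V → M} (hh : Smooth V E h) {A : U → V} (hA : ContDiff ℝ ∞ A) (u : U) :
    rk U E (fun u => h (A u)) u ≤ rk V E h (A u) := by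
  have hc : tang U E (fun u => h (A u)) u = (tang V E h (A u)).comp (tang U V A u) :=
    mfderiv_comp (I' := 𝓘(ℝ, V)) u (hh.mdifferentiableAt (by simp))
      (hA.contMDiff.mdifferentiableAt (by simp))
  rw [rk, hc]
  exact Submodule.finrank_mono (LinearMap.range_comp_le_range _ _)

theorem rk_le_finrank [FiniteDimensional ℝ V] (h : V → M) (v : V) :
    rk V E h v ≤ Module.finrank ℝ V :=
  LinearMap.finrank_range_le _

end Glue

/-- Smooth curves `γ : p → q` with sitting instants. -/
structure Curve (E : Type*) [NormedAddCommGroup E] [NormedSpace ℝ E]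
    {M : Type*} [TopologicalSpace M] [ChartedSpace E M] (p q : M) where
  /-- the underlying map -/
  toFun : ℝ → M
  smooth : Smooth ℝ E toFun
  sitting : ∃ ε : ℝ, 0 < ε ∧ ε < 1 / 2 ∧ (∀ x, x < ε → toFun x = p) ∧
    ∀ x, 1 - ε < x → toFun x = q

namespace Curve

variable {p q r : M}

/-- The unit curve `ι_p`. -/
def unit (E : Type*) [NormedAddCommGroup E] [NormedSpace ℝ E]
    {M : Type*} [TopologicalSpace M] [ChartedSpace E M] (p : M) : Curve E p p where
  toFun _ := p
  smooth := contMDiff_const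
  sitting := ⟨1 / 4, by norm_num, by norm_num, fun _ _ => rfl, fun _ _ => rfl⟩

/-- The inverse curve. -/
def inv (γ : Curve E p q) : Curve E q p where
  toFun x := γ.toFun (1 - x)
  smooth := γ.smooth.comp (contDiff_const.sub contDiff_id).contMDiff
  sitting := by
    obtain ⟨ε, h0, h1, h2, h3⟩ := γ.sitting
    exact ⟨ε, h0, h1, fun x hx => h3 _ (by linarith), fun x hx => h2 _ (by linarith)⟩

/-- The composition `γ₂ ∘ γ₁`. -/
def comp (γ₂ : Curve E q r) (γ₁ : Curve E p q) : Curve E p r where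
  toFun := glue (fun x => x) (fun x => γ₁.toFun (2 * x)) (fun x => γ₂.toFun (2 * x - 1))
  smooth := by
    obtain ⟨ε, h0, h1, h2, h3⟩ := γ₁.sitting
    obtain ⟨ε', h0', h1', h2', h3'⟩ := γ₂.sitting
    refine smooth_glue continuous_id (δ := min ε ε' / 2) (by positivity) ?_ ?_ ?_
    · intro x hx
      have := min_le_left ε ε'
      have := min_le_right ε ε'
      rw [abs_lt] at hx
      simp only [id] at hx
      rw [h3 _ (by linarith), h2' _ (by linarith)]
    · exact γ₁.smooth.comp (contDiff_const.mul contDiff_id).contMDiff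
    · exact γ₂.smooth.comp ((contDiff_const.mul contDiff_id).sub contDiff_const).contMDiff
  sitting := by
    obtain ⟨ε, h0, h1, h2, h3⟩ := γ₁.sitting
    obtain ⟨ε', h0', h1', h2', h3'⟩ := γ₂.sitting
    have a1 := min_le_left ε ε'
    have a2 := min_le_right ε ε'
    refine ⟨min ε ε' / 2, by positivity, by linarith, ?_, ?_⟩
    · intro x hx
      rw [glue, if_pos (by linarith)]
      exact h2 _ (by linarith)
    · intro x hx
      rw [glue, if_neg (by linarith)]
      exact h3' _ (by linarith)

/-- Thin homotopy equivalence of curves. -/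
def ThinHomotopic (γ₀ γ₁ : Curve E p q) : Prop :=
  ∃ h : ℝ × ℝ → M, Smooth (ℝ × ℝ) E h ∧
    (∃ ε : ℝ, 0 < ε ∧ ε < 1 / 2 ∧
      (∀ x y, x < ε → h (x, y) = p) ∧ (∀ x y, 1 - ε < x → h (x, y) = q) ∧
      (∀ x y, y < ε → h (x, y) = γ₀.toFun x) ∧ (∀ x y, 1 - ε < y → h (x, y) = γ₁.toFun x)) ∧
    ∀ z, rk (ℝ × ℝ) E h z ≤ 1

end Curve

/-- Smooth surfaces `Σ : γ₀ ⇒ γ₁` with sitting instants. -/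
structure Surface {p q : M} (γ₀ γ₁ : Curve E p q) where
  /-- the underlying map -/
  toFun : ℝ × ℝ → M
  smooth : Smooth (ℝ × ℝ) E toFun
  sitting : ∃ ε : ℝ, 0 < ε ∧ ε < 1 / 2 ∧
    (∀ x y, x < ε → toFun (x, y) = p) ∧ (∀ x y, 1 - ε < x → toFun (x, y) = q) ∧
    (∀ x y, y < ε → toFun (x, y) = γ₀.toFun x) ∧ (∀ x y, 1 - ε < y → toFun (x, y) = γ₁.toFun x)

/-- The two kinds of `2`-groupoids of `M`: the path `2`-groupoid `(M, P₁M, P₂M)` and the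
fundamental `2`-groupoid `(M, P₁M, P⁰₂M)`. -/
inductive Kind
  | path
  | fundamental

namespace Surface

variable {p q r : M}

/-- The unit surface `I_γ`. -/
def unit (γ : Curve E p q) : Surface γ γ where
  toFun z := γ.toFun z.1
  smooth := γ.smooth.comp contDiff_fst.contMDiff
  sitting := by
    obtain ⟨ε, h0, h1, h2, h3⟩ := γ.sitting
    exact ⟨ε, h0, h1, fun x _ hx => h2 x hx, fun x _ hx => h3 x hx, fun _ _ _ => rfl,
      fun _ _ _ => rfl⟩

/-- Vertical composition `S₂ • S₁`. -/
def vcomp {γ₀ γ₁ γ₂ : Curve E p q} (S₂ : Surface γ₁ γ₂) (S₁ : Surface γ₀ γ₁) :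
    Surface γ₀ γ₂ where
  toFun := glue (fun z => z.2) (fun z => S₁.toFun (z.1, 2 * z.2))
    (fun z => S₂.toFun (z.1, 2 * z.2 - 1))
  smooth := by
    obtain ⟨ε, h0, -, -, -, -, h5⟩ := S₁.sitting
    obtain ⟨ε', h0', -, -, -, h4', -⟩ := S₂.sitting
    refine smooth_glue continuous_snd (δ := min ε ε' / 2) (by positivity) ?_ ?_ ?_
    · rintro ⟨x, y⟩ hy
      have := min_le_left ε ε'
      have := min_le_right ε ε'
      rw [abs_lt] at hy
      simp only at hy ⊢
      rw [h5 _ _ (by linarith), h4' _ _ (by linarith)]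
    · exact S₁.smooth.comp (contDiff_fst.prodMk (contDiff_const.mul contDiff_snd)).contMDiff
    · exact S₂.smooth.comp
        (contDiff_fst.prodMk ((contDiff_const.mul contDiff_snd).sub contDiff_const)).contMDiff
  sitting := by
    obtain ⟨ε, h0, h1, h2, h3, h4, h5⟩ := S₁.sitting
    obtain ⟨ε', h0', h1', h2', h3', h4', h5'⟩ := S₂.sitting
    have a1 := min_le_left ε ε'
    have a2 := min_le_right ε ε'
    have a3 : 0 < min ε ε' := lt_min h0 h0'
    refine ⟨min ε ε' / 2, by positivity, by linarith, ?_, ?_, ?_, ?_⟩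
    · intro x y hx
      rw [glue]
      split_ifs
      · exact h2 _ _ (by linarith)
      · exact h2' _ _ (by linarith)
    · intro x y hx
      rw [glue]
      split_ifs
      · exact h3 _ _ (by linarith)
      · exact h3' _ _ (by linarith)
    · intro x y hy
      rw [glue, if_pos (by simp only; linarith)]
      exact h4 _ _ (by simp only; linarith)
    · intro x y hy
      rw [glue, if_neg (by simp only; linarith)]
      exact h5' _ _ (by simp only; linarith)

/-- Horizontal composition `S₂ ∘ S₁`. -/
def hcomp {γ₂ γ₃ : Curve E q r} {γ₀ γ₁ : Curve E p q} (S₂ : Surface γ₂ γ₃) (S₁ : Surface γ₀ γ₁) :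
    Surface (γ₂.comp γ₀) (γ₃.comp γ₁) where
  toFun := glue (fun z => z.1) (fun z => S₁.toFun (2 * z.1, z.2))
    (fun z => S₂.toFun (2 * z.1 - 1, z.2))
  smooth := by
    obtain ⟨ε, h0, -, -, h3, -, -⟩ := S₁.sitting
    obtain ⟨ε', h0', -, h2', -, -, -⟩ := S₂.sitting
    refine smooth_glue continuous_fst (δ := min ε ε' / 2) (by positivity) ?_ ?_ ?_
    · rintro ⟨x, y⟩ hx
      have := min_le_left ε ε'
      have := min_le_right ε ε'
      rw [abs_lt] at hx
      simp only at hx ⊢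
      rw [h3 _ _ (by linarith), h2' _ _ (by linarith)]
    · exact S₁.smooth.comp ((contDiff_const.mul contDiff_fst).prodMk contDiff_snd).contMDiff
    · exact S₂.smooth.comp
        (((contDiff_const.mul contDiff_fst).sub contDiff_const).prodMk contDiff_snd).contMDiff
  sitting := by
    obtain ⟨ε, h0, h1, h2, h3, h4, h5⟩ := S₁.sitting
    obtain ⟨ε', h0', h1', h2', h3', h4', h5'⟩ := S₂.sitting
    have a1 := min_le_left ε ε'
    have a2 := min_le_right ε ε'
    have a3 : 0 < min ε ε' := lt_min h0 h0'
    refine ⟨min ε ε' / 2, by positivity, by linarith, ?_, ?_, ?_, ?_⟩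
    · intro x y hx
      rw [glue, if_pos (by simp only; linarith)]
      exact h2 _ _ (by simp only; linarith)
    · intro x y hx
      rw [glue, if_neg (by simp only; linarith)]
      exact h3' _ _ (by simp only; linarith)
    · intro x y hy
      simp only [glue, Curve.comp]
      split_ifs
      · exact h4 _ _ (by linarith)
      · exact h4' _ _ (by linarith)
    · intro x y hy
      simp only [glue, Curve.comp]
      split_ifs
      · exact h5 _ _ (by linarith)
      · exact h5' _ _ (by linarith)

/-- Thin homotopy equivalence (for `k = path`), respectively homotopy equivalence (for
`k = fundamental`), of surfaces with common end points. In both cases the source and target curves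
move by thin homotopies; in the second case the rank of the whole homotopy is not restricted. -/
def Homotopic (k : Kind) {γ₀ γ₁ γ₂ γ₃ : Curve E p q} (S₀ : Surface γ₀ γ₁) (S₁ : Surface γ₂ γ₃) :
    Prop :=
  ∃ h : ℝ × ℝ × ℝ → M, Smooth (ℝ × ℝ × ℝ) E h ∧
    (∃ ε : ℝ, 0 < ε ∧
      (∀ x y z, x < ε → h (x, y, z) = p) ∧ (∀ x y z, 1 - ε < x → h (x, y, z) = q) ∧
      (∀ x y z, y < ε → h (x, y, z) = h (x, 0, z)) ∧
      (∀ x y z, 1 - ε < y → h (x, y, z) = h (x, 1, z)) ∧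
      (∀ x y z, z < ε → h (x, y, z) = S₀.toFun (x, y)) ∧
      (∀ x y z, 1 - ε < z → h (x, y, z) = S₁.toFun (x, y))) ∧
    (∀ w : ℝ × ℝ, rk (ℝ × ℝ) E (fun v : ℝ × ℝ => h (v.1, 0, v.2)) w ≤ 1) ∧
    (∀ w : ℝ × ℝ, rk (ℝ × ℝ) E (fun v : ℝ × ℝ => h (v.1, 1, v.2)) w ≤ 1) ∧
    (k = Kind.path → ∀ w, rk (ℝ × ℝ × ℝ) E h w ≤ 2)

end Surface

/-! ### The path and the fundamental `2`-groupoid -/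

/-- `1`-cells `p → q` of the path and fundamental `2`-groupoids: thin homotopy classes of curves. -/
def P1 (E : Type*) [NormedAddCommGroup E] [NormedSpace ℝ E]
    {M : Type*} [TopologicalSpace M] [ChartedSpace E M] (p q : M) : Type _ :=
  Quot (Curve.ThinHomotopic (E := E) (p := p) (q := q))

/-- `2`-cells between `1`-cells `p → q`: (thin) homotopy classes of surfaces. -/
def P2 (E : Type*) [NormedAddCommGroup E] [NormedSpace ℝ E]
    {M : Type*} [TopologicalSpace M] [ChartedSpace E M] (k : Kind) (p q : M) : Type _ :=
  Quot (fun S₀ S₁ : (Σ γ : Curve E p q × Curve E p q, Surface γ.1 γ.2) => S₀.2.Homotopic k S₁.2)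

theorem Curve.ThinHomotopic.refl {p q : M} (γ : Curve E p q) [FiniteDimensional ℝ E] :
    γ.ThinHomotopic γ := by
  obtain ⟨ε, h0, h1, h2, h3⟩ := γ.sitting
  refine ⟨fun z => γ.toFun z.1, γ.smooth.comp contDiff_fst.contMDiff,
    ⟨ε, h0, h1, fun x _ hx => h2 x hx, fun x _ hx => h3 x hx, fun _ _ _ => rfl,
      fun _ _ _ => rfl⟩, fun z => ?_⟩
  exact (rk_comp_le γ.smooth contDiff_fst z).trans ((rk_le_finrank _ _).trans (by simp))

theorem Curve.ThinHomotopic.comp {p q r : M} [FiniteDimensional ℝ E] {δ₀ δ₁ : Curve E q r}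
    {γ₀ γ₁ : Curve E p q} (hδ : δ₀.ThinHomotopic δ₁) (hγ : γ₀.ThinHomotopic γ₁) :
    (δ₀.comp γ₀).ThinHomotopic (δ₁.comp γ₁) := by
  obtain ⟨h', hs', ⟨ε', h0', h1', h2', h3', h4', h5'⟩, hr'⟩ := hδ
  obtain ⟨h, hs, ⟨ε, h0, h1, h2, h3, h4, h5⟩, hr⟩ := hγ
  have a1 := min_le_left ε ε'
  have a2 := min_le_right ε ε'
  have a3 : 0 < min ε ε' := lt_min h0 h0'
  have c1 : ContDiff ℝ ∞ (fun z : ℝ × ℝ => (2 * z.1, z.2)) :=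
    (contDiff_const.mul contDiff_fst).prodMk contDiff_snd
  have c2 : ContDiff ℝ ∞ (fun z : ℝ × ℝ => (2 * z.1 - 1, z.2)) :=
    ((contDiff_const.mul contDiff_fst).sub contDiff_const).prodMk contDiff_snd
  have key : ∀ v : ℝ × ℝ, |v.1 - 1 / 2| < min ε ε' / 2 →
      h (2 * v.1, v.2) = h' (2 * v.1 - 1, v.2) := by
    intro v hv
    rw [abs_lt] at hv
    rw [h3 _ _ (by linarith), h2' _ _ (by linarith)]
  refine ⟨glue (fun z => z.1) (fun z => h (2 * z.1, z.2)) (fun z => h' (2 * z.1 - 1, z.2)),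
    smooth_glue continuous_fst (half_pos a3) key (hs.comp c1.contMDiff) (hs'.comp c2.contMDiff),
    ⟨min ε ε' / 2, half_pos a3, by linarith, ?_, ?_, ?_, ?_⟩,
    rk_glue continuous_fst (half_pos a3) key
      (fun v => (rk_comp_le hs c1 v).trans (hr _)) (fun v => (rk_comp_le hs' c2 v).trans (hr' _))⟩
  · intro x y hx
    rw [glue, if_pos (by simp only; linarith)]
    exact h2 _ _ (by simp only; linarith)
  · intro x y hx
    rw [glue, if_neg (by simp only; linarith)]
    exact h3' _ _ (by simp only; linarith)
  · intro x y hy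
    simp only [glue, Curve.comp]
    split_ifs
    · exact h4 _ _ (by linarith)
    · exact h4' _ _ (by linarith)
  · intro x y hy
    simp only [glue, Curve.comp]
    split_ifs
    · exact h5 _ _ (by linarith)
    · exact h5' _ _ (by linarith)

theorem Surface.Homotopic.refl {p q : M} (k : Kind) {γ₀ γ₁ : Curve E p q} (S : Surface γ₀ γ₁)
    [FiniteDimensional ℝ E] : S.Homotopic k S := by
  obtain ⟨ε, h0, h1, h2, h3, h4, h5⟩ := S.sitting
  have c : ContDiff ℝ ∞ (fun z : ℝ × ℝ × ℝ => (z.1, z.2.1)) :=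
    contDiff_fst.prodMk (contDiff_fst.comp contDiff_snd)
  have hh : ∀ y : ℝ, (y < ε → ∀ x, S.toFun (x, y) = S.toFun (x, 0)) ∧
      (1 - ε < y → ∀ x, S.toFun (x, y) = S.toFun (x, 1)) := fun y =>
    ⟨fun hy x => by rw [h4 _ _ hy, h4 _ _ h0],
      fun hy x => by rw [h5 _ _ hy, h5 _ _ (by linarith)]⟩
  have hside : ∀ (y : ℝ) (w : ℝ × ℝ), rk (ℝ × ℝ) E (fun v : ℝ × ℝ => S.toFun (v.1, y)) w ≤ 1 := by
    intro y w
    have cy : ContDiff ℝ ∞ (fun x : ℝ => (x, y)) := contDiff_id.prodMk contDiff_const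
    refine (rk_comp_le (h := fun x : ℝ => S.toFun (x, y)) (S.smooth.comp cy.contMDiff)
      contDiff_fst w).trans ((rk_le_finrank _ _).trans (by simp))
  refine ⟨fun z => S.toFun (z.1, z.2.1), S.smooth.comp c.contMDiff,
    ⟨ε, h0, fun x y _ hx => h2 x y hx, fun x y _ hx => h3 x y hx,
      fun x y _ hy => (hh y).1 hy x, fun x y _ hy => (hh y).2 hy x, fun _ _ _ _ => rfl,
      fun _ _ _ _ => rfl⟩, hside 0, hside 1, fun _ w => ?_⟩
  exact (rk_comp_le S.smooth c w).trans ((rk_le_finrank _ _).trans (by simp))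

theorem Surface.Homotopic.hcomp {p q r : M} {k : Kind} [FiniteDimensional ℝ E]
    {δ₀ δ₁ δ₂ δ₃ : Curve E q r} {γ₀ γ₁ γ₂ γ₃ : Curve E p q}
    {T₀ : Surface δ₀ δ₁} {T₁ : Surface δ₂ δ₃} {S₀ : Surface γ₀ γ₁} {S₁ : Surface γ₂ γ₃}
    (hT : T₀.Homotopic k T₁) (hS : S₀.Homotopic k S₁) :
    (T₀.hcomp S₀).Homotopic k (T₁.hcomp S₁) := by
  obtain ⟨h', hs', ⟨ε', h0', h1', h2', h3', h4', h5', h6'⟩, hr0', hr1', hr'⟩ := hT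
  obtain ⟨h, hs, ⟨ε, h0, h1, h2, h3, h4, h5, h6⟩, hr0, hr1, hr⟩ := hS
  have a1 : min (min ε ε') (1 / 2) ≤ ε := (min_le_left _ _).trans (min_le_left _ _)
  have a2 : min (min ε ε') (1 / 2) ≤ ε' := (min_le_left _ _).trans (min_le_right _ _)
  have a4 : min (min ε ε') (1 / 2) ≤ 1 / 2 := min_le_right _ _
  have a3 : 0 < min (min ε ε') (1 / 2) := lt_min (lt_min h0 h0') (by norm_num)
  have c1 : ContDiff ℝ ∞ (fun z : ℝ × ℝ × ℝ => (2 * z.1, z.2)) :=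
    (contDiff_const.mul contDiff_fst).prodMk contDiff_snd
  have c2 : ContDiff ℝ ∞ (fun z : ℝ × ℝ × ℝ => (2 * z.1 - 1, z.2)) :=
    ((contDiff_const.mul contDiff_fst).sub contDiff_const).prodMk contDiff_snd
  have d1 : ContDiff ℝ ∞ (fun z : ℝ × ℝ => (2 * z.1, z.2)) :=
    (contDiff_const.mul contDiff_fst).prodMk contDiff_snd
  have d2 : ContDiff ℝ ∞ (fun z : ℝ × ℝ => (2 * z.1 - 1, z.2)) :=
    ((contDiff_const.mul contDiff_fst).sub contDiff_const).prodMk contDiff_snd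
  have key : ∀ v : ℝ × ℝ × ℝ, |v.1 - 1 / 2| < min (min ε ε') (1 / 2) / 2 →
      h (2 * v.1, v.2) = h' (2 * v.1 - 1, v.2) := by
    intro v hv
    rw [abs_lt] at hv
    obtain ⟨x, y, z⟩ := v
    simp only at hv ⊢
    rw [h2 _ _ _ (by linarith), h1' _ _ _ (by linarith)]
  have hside : ∀ y : ℝ, (∀ w : ℝ × ℝ, rk (ℝ × ℝ) E (fun v : ℝ × ℝ => h (v.1, y, v.2)) w ≤ 1) →
      (∀ w : ℝ × ℝ, rk (ℝ × ℝ) E (fun v : ℝ × ℝ => h' (v.1, y, v.2)) w ≤ 1) →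
      ∀ w : ℝ × ℝ, rk (ℝ × ℝ) E (fun v : ℝ × ℝ => glue (fun z : ℝ × ℝ × ℝ => z.1)
        (fun z => h (2 * z.1, z.2)) (fun z => h' (2 * z.1 - 1, z.2)) (v.1, y, v.2)) w ≤ 1 := by
    intro y e e' w
    have cy : ContDiff ℝ ∞ (fun v : ℝ × ℝ => (v.1, y, v.2)) :=
      contDiff_fst.prodMk (contDiff_const.prodMk contDiff_snd)
    exact rk_glue (ℓ := fun z : ℝ × ℝ => z.1) (f₁ := fun v : ℝ × ℝ => h (2 * v.1, y, v.2))
      (f₂ := fun v : ℝ × ℝ => h' (2 * v.1 - 1, y, v.2)) continuous_fst (half_pos a3)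
      (fun v hv => key (v.1, y, v.2) hv)
      (fun v => (rk_comp_le (h := fun v : ℝ × ℝ => h (v.1, y, v.2)) (hs.comp cy.contMDiff)
        d1 v).trans (e _))
      (fun v => (rk_comp_le (h := fun v : ℝ × ℝ => h' (v.1, y, v.2)) (hs'.comp cy.contMDiff)
        d2 v).trans (e' _)) w
  refine ⟨glue (fun z => z.1) (fun z => h (2 * z.1, z.2)) (fun z => h' (2 * z.1 - 1, z.2)),
    smooth_glue continuous_fst (half_pos a3) key (hs.comp c1.contMDiff) (hs'.comp c2.contMDiff),
    ⟨min (min ε ε') (1 / 2) / 2, half_pos a3, ?_, ?_, ?_, ?_, ?_, ?_⟩,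
    hside 0 hr0 hr0', hside 1 hr1 hr1', fun hk => rk_glue continuous_fst (half_pos a3) key
      (fun v => (rk_comp_le hs c1 v).trans (hr hk _))
      (fun v => (rk_comp_le hs' c2 v).trans (hr' hk _))⟩
  · intro x y z hx
    rw [glue, if_pos (by simp only; linarith)]
    exact h1 _ _ _ (by linarith)
  · intro x y z hx
    rw [glue, if_neg (by simp only; linarith)]
    exact h2' _ _ _ (by linarith)
  · intro x y z hy
    simp only [glue]
    split_ifs
    · exact h3 _ _ _ (by linarith)
    · exact h3' _ _ _ (by linarith)
  · intro x y z hy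
    simp only [glue]
    split_ifs
    · exact h4 _ _ _ (by linarith)
    · exact h4' _ _ _ (by linarith)
  · intro x y z hz
    simp only [glue, Surface.hcomp]
    split_ifs
    · exact h5 _ _ _ (by linarith)
    · exact h5' _ _ _ (by linarith)
  · intro x y z hz
    simp only [glue, Surface.hcomp]
    split_ifs
    · exact h6 _ _ _ (by linarith)
    · exact h6' _ _ _ (by linarith)

theorem Surface.Homotopic.side {p q : M} {k : Kind} {γ₀ γ₁ γ₂ γ₃ : Curve E p q}
    {S₀ : Surface γ₀ γ₁} {S₁ : Surface γ₂ γ₃} (h : S₀.Homotopic k S₁) :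
    γ₀.ThinHomotopic γ₂ ∧ γ₁.ThinHomotopic γ₃ := by
  obtain ⟨e, e0, -, -, -, e4, e5⟩ := S₀.sitting
  obtain ⟨e', e0', -, -, -, e4', e5'⟩ := S₁.sitting
  obtain ⟨h, hs, ⟨ε, h0, h1, h2, -, -, h5, h6⟩, hr0, hr1, -⟩ := h
  have a1 := min_le_left ε (1 / 4)
  have a2 := min_le_right ε (1 / 4)
  have a3 : 0 < min ε (1 / 4) := lt_min h0 (by norm_num)
  have c : ∀ y : ℝ, ContDiff ℝ ∞ (fun v : ℝ × ℝ => (v.1, y, v.2)) := fun y =>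
    contDiff_fst.prodMk (contDiff_const.prodMk contDiff_snd)
  exact ⟨⟨fun v => h (v.1, 0, v.2), hs.comp (c 0).contMDiff,
    ⟨min ε (1 / 4), a3, by linarith, fun x z hx => h1 x 0 z (by linarith),
      fun x z hx => h2 x 0 z (by linarith),
      fun x z hz => (h5 x 0 z (by linarith)).trans (e4 x 0 e0),
      fun x z hz => (h6 x 0 z (by linarith)).trans (e4' x 0 e0')⟩, hr0⟩,
    ⟨fun v => h (v.1, 1, v.2), hs.comp (c 1).contMDiff,
    ⟨min ε (1 / 4), a3, by linarith, fun x z hx => h1 x 1 z (by linarith),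
      fun x z hx => h2 x 1 z (by linarith),
      fun x z hz => (h5 x 1 z (by linarith)).trans (e5 x 1 (by linarith)),
      fun x z hz => (h6 x 1 z (by linarith)).trans (e5' x 1 (by linarith))⟩, hr1⟩⟩

theorem Curve.ThinHomotopic.unit [FiniteDimensional ℝ E] {p q : M} {γ₀ γ₁ : Curve E p q}
    (h : γ₀.ThinHomotopic γ₁) (k : Kind) :
    (Surface.unit γ₀).Homotopic k (Surface.unit γ₁) := by
  obtain ⟨h, hs, ⟨ε, h0, h1, h2, h3, h4, h5⟩, hr⟩ := h
  have c : ContDiff ℝ ∞ (fun z : ℝ × ℝ × ℝ => (z.1, z.2.2)) :=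
    contDiff_fst.prodMk (contDiff_snd.comp contDiff_snd)
  exact ⟨fun z => h (z.1, z.2.2), hs.comp c.contMDiff,
    ⟨ε, h0, fun x _ z hx => h2 x z hx, fun x _ z hx => h3 x z hx, fun _ _ _ _ => rfl,
      fun _ _ _ _ => rfl, fun x _ z hz => h4 x z hz, fun x _ z hz => h5 x z hz⟩,
    hr, hr, fun _ w => (rk_comp_le hs c w).trans ((hr _).trans (by norm_num))⟩

/-! #### The operations of the `2`-groupoids

Cells are composed by composing representatives. The vertical composite of two `2`-cells is always
formed on composable representatives, by `Surface.vcomp`. -/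

namespace P1

variable {p q r : M}

/-- The class of a curve. -/
def mk (γ : Curve E p q) : P1 E p q := Quot.mk _ γ

/-- The identity `1`-cell. -/
def id (E : Type*) [NormedAddCommGroup E] [NormedSpace ℝ E]
    {M : Type*} [TopologicalSpace M] [ChartedSpace E M] (p : M) : P1 E p p :=
  mk (Curve.unit E p)

/-- Composition of `1`-cells. -/
def comp [FiniteDimensional ℝ E] (b : P1 E q r) (a : P1 E p q) : P1 E p r :=
  Quot.map₂ Curve.comp (fun δ _ _ hγ => (Curve.ThinHomotopic.refl δ).comp hγ)
    (fun _ _ γ hδ => hδ.comp (Curve.ThinHomotopic.refl γ)) b a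

end P1

namespace P2

variable {p q r : M} {k : Kind}

/-- The class of a surface. -/
def mk (k : Kind) {γ₀ γ₁ : Curve E p q} (S : Surface γ₀ γ₁) : P2 E k p q :=
  Quot.mk _ ⟨(γ₀, γ₁), S⟩

/-- The source of a `2`-cell. -/
def src (S : P2 E k p q) : P1 E p q :=
  Quot.lift (fun S : (Σ γ : Curve E p q × Curve E p q, Surface γ.1 γ.2) => P1.mk S.1.1)
    (fun _ _ h => Quot.sound h.side.1) S

/-- The target of a `2`-cell. -/
def tgt (S : P2 E k p q) : P1 E p q :=
  Quot.lift (fun S : (Σ γ : Curve E p q × Curve E p q, Surface γ.1 γ.2) => P1.mk S.1.2)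
    (fun _ _ h => Quot.sound h.side.2) S

/-- The identity `2`-cell of a `1`-cell. -/
def unit [FiniteDimensional ℝ E] (k : Kind) (a : P1 E p q) : P2 E k p q :=
  Quot.lift (fun γ : Curve E p q => mk k (Surface.unit γ)) (fun _ _ h => Quot.sound (h.unit k)) a

/-- Horizontal composition of `2`-cells. -/
def hcomp [FiniteDimensional ℝ E] (T : P2 E k q r) (S : P2 E k p q) : P2 E k p r :=
  Quot.map₂ (fun T S => ⟨(T.1.1.comp S.1.1, T.1.2.comp S.1.2), T.2.hcomp S.2⟩)
    (fun T _ _ hS => (Surface.Homotopic.refl k T.2).hcomp hS)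
    (fun _ _ S hT => hT.hcomp (Surface.Homotopic.refl k S.2)) T S

end P2

/-! ### Parallel transport -/

section Transport

/-- `u : ℝ → K` is the (smooth) solution of `u'(x) u(x)⁻¹ = -a(x)` with `u(x₀) = 1`. -/
def IsParallelSolution {𝔨 : Type*} [NormedAddCommGroup 𝔨] [NormedSpace ℝ 𝔨]
    {K : Type*} [Group K] [TopologicalSpace K] [ChartedSpace 𝔨 K]
    (a : ℝ → 𝔨) (x₀ : ℝ) (u : ℝ → K) : Prop :=
  Smooth ℝ 𝔨 u ∧ u x₀ = 1 ∧ ∀ x, rightLogDeriv u x = -a x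

/-- The solution of `u'(x) u(x)⁻¹ = -a(x)` with `u(x₀) = 1`. -/
def parSol {𝔨 : Type*} [NormedAddCommGroup 𝔨] [NormedSpace ℝ 𝔨]
    (K : Type*) [Group K] [TopologicalSpace K] [ChartedSpace 𝔨 K] (a : ℝ → 𝔨) (x₀ : ℝ) : ℝ → K :=
  Classical.epsilon (IsParallelSolution a x₀)

/-- The coefficient `(γ*α)_x` of the pull-back of a `1`-form along a curve. -/
def Curve.pull {F : Type*} [NormedAddCommGroup F] [NormedSpace ℝ F] {p q : M}
    (γ : Curve E p q) (α : DForm E M F 1) (x : ℝ) : F :=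
  α (γ.toFun x) ![tang ℝ E γ.toFun x 1]

namespace Surface

variable {F : Type*} [NormedAddCommGroup F] [NormedSpace ℝ F] {p q : M} {γ₀ γ₁ : Curve E p q}

/-- `∂_x Σ(x, y)`. -/
def dx (S : Surface γ₀ γ₁) (x y : ℝ) : E := tang (ℝ × ℝ) E S.toFun (x, y) (1, 0)

/-- `∂_y Σ(x, y)`. -/
def dy (S : Surface γ₀ γ₁) (x y : ℝ) : E := tang (ℝ × ℝ) E S.toFun (x, y) (0, 1)

/-- The coefficient `(Σ*α)_x` of a `1`-form. -/
def pullx (S : Surface γ₀ γ₁) (α : DForm E M F 1) (x y : ℝ) : F := α (S.toFun (x, y)) ![S.dx x y]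

/-- The coefficient `(Σ*α)_y` of a `1`-form. -/
def pully (S : Surface γ₀ γ₁) (α : DForm E M F 1) (x y : ℝ) : F := α (S.toFun (x, y)) ![S.dy x y]

/-- The coefficient `(Σ*β)_{xy}` of a `2`-form. -/
def pullxy (S : Surface γ₀ γ₁) (β : DForm E M F 2) (x y : ℝ) : F :=
  β (S.toFun (x, y)) ![S.dx x y, S.dy x y]

end Surface

variable (C : LieCrossedModule 𝔤 𝔥 G H)

/-- With `a = Σ*θ`, `B = Σ*Υ`, let `v` solve `v'(y) v(y)⁻¹ = -a_y(x₀, y)`, `v(y₀) = 1`, and, for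
each `y`, let `u_y` solve `u_y'(x) u_y(x)⁻¹ = -a_x(x, y)`, `u_y(x₀) = 1`. Then `W : ℝ² → H` is the
solution of `∂_x (∂_y W W⁻¹) = -ṁ(v(y)⁻¹ u_y(x)⁻¹)(B_{xy})` with `W(x₀, y) = W(x, y₀) = 1`. -/
def IsSurfaceSolution (θ : DForm E M 𝔤 1) (Υ : DForm E M 𝔥 2) {p q : M} {γ₀ γ₁ : Curve E p q}
    (S : Surface γ₀ γ₁) (x₀ y₀ : ℝ) (W : ℝ × ℝ → H) : Prop :=
  Smooth (ℝ × ℝ) 𝔥 W ∧ (∀ y, W (x₀, y) = 1) ∧ (∀ x, W (x, y₀) = 1) ∧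
    ∀ x y, deriv (fun ξ => rightLogDeriv (𝔨 := 𝔥) (fun η => W (ξ, η)) y) x =
      -C.mdot ((parSol G (fun η => S.pully θ x₀ η) y₀ y)⁻¹ *
        (parSol G (fun ξ => S.pullx θ ξ y) x₀ x)⁻¹) (S.pullxy Υ x y)

/-- With `f` the solution of `f'(x) f(x)⁻¹ = -(γ*θ)_x(x)`, `f(x₀) = 1`, and `κ = g ∘ γ`, the map
`Λ : ℝ → H` is the solution of `Λ(x)⁻¹ Λ'(x) = -ṁ(f(x)⁻¹ κ(x)⁻¹)((γ*J)_x(x))` with `Λ(x₀) = 1`. -/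
def IsGaugeSolution (θ : DForm E M 𝔤 1) (g : M → G) (J : DForm E M 𝔥 1) {p q : M}
    (γ : Curve E p q) (x₀ : ℝ) (Λ : ℝ → H) : Prop :=
  Smooth ℝ 𝔥 Λ ∧ Λ x₀ = 1 ∧
    ∀ x, leftLogDeriv Λ x =
      -C.mdot ((parSol G (γ.pull θ) x₀ x)⁻¹ * (g (γ.toFun x))⁻¹) (γ.pull J x)

/-- The parallel transport `F_θ(γ) ∈ G` along a curve. -/
def transport₁ (G : Type*) [Group G] [TopologicalSpace G] [ChartedSpace 𝔤 G]
    (θ : DForm E M 𝔤 1) {p q : M} (γ : Curve E p q) : G :=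
  parSol G (γ.pull θ) 0 1

/-- The parallel transport `F_{θ,Υ}(Σ) ∈ H` along a surface. -/
def transport₂ (θ : DForm E M 𝔤 1) (Υ : DForm E M 𝔥 2) {p q : M} {γ₀ γ₁ : Curve E p q}
    (S : Surface γ₀ γ₁) : H :=
  Classical.epsilon (IsSurfaceSolution C θ Υ S 1 0) (0, 1)

/-- The gauge transformation `G_{g,J;θ}(γ) ∈ H` along a curve. -/
def gaugeHol (θ : DForm E M 𝔤 1) (g : M → G) (J : DForm E M 𝔥 1) {p q : M}
    (γ : Curve E p q) : H :=
  Classical.epsilon (IsGaugeSolution C θ g J γ 1) 0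

end Transport

/-! ### `2`-functors into `B₀(G, H)` and their pseudonatural transformations -/

/-- Strict `2`-functors from the path (`k = path`), respectively fundamental (`k = fundamental`),
`2`-groupoid of `M` to the delooping `2`-groupoid `B₀(G, H)`. -/
structure TwoFunctor (E M : Type*) [NormedAddCommGroup E] [NormedSpace ℝ E]
    [FiniteDimensional ℝ E] [TopologicalSpace M] [ChartedSpace E M] (k : Kind)
    (C : LieCrossedModule 𝔤 𝔥 G H) where
  /-- the map of `1`-cells -/
  map₁ : ∀ {p q : M}, P1 E p q → G
  /-- the map of `2`-cells -/
  map₂ : ∀ {p q : M} (S : P2 E k p q), C.Cell (map₁ S.src) (map₁ S.tgt)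
  map₁_id : ∀ p : M, map₁ (P1.id E p) = 1
  map₁_comp : ∀ {p q r : M} (b : P1 E q r) (a : P1 E p q), map₁ (b.comp a) = map₁ b * map₁ a
  map₂_unit : ∀ {p q : M} (a : P1 E p q),
    (map₂ (P2.unit k a)).1 = (LieCrossedModule.Cell.id (C := C) (map₁ a)).1
  map₂_vcomp : ∀ {p q : M} {γ₀ γ₁ γ₂ : Curve E p q} (S₂ : Surface γ₁ γ₂) (S₁ : Surface γ₀ γ₁),
    map₂ (P2.mk k (S₂.vcomp S₁)) = (map₂ (P2.mk k S₂)).vcomp (map₂ (P2.mk k S₁))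
  map₂_hcomp : ∀ {p q r : M} (T : P2 E k q r) (S : P2 E k p q),
    (map₂ (T.hcomp S)).1 = ((map₂ T).hcomp (map₂ S)).1

/-- `F` is the parallel transport `2`-functor of `(θ, Υ)`. -/
def TwoFunctor.IsParallelTransport [FiniteDimensional ℝ E] {k : Kind}
    {C : LieCrossedModule 𝔤 𝔥 G H} (F : TwoFunctor E M k C) (θ : DForm E M 𝔤 1)
    (Υ : DForm E M 𝔥 2) : Prop :=
  (∀ (p q : M) (γ : Curve E p q), F.map₁ (P1.mk γ) = transport₁ G θ γ) ∧
    ∀ (p q : M) (γ₀ γ₁ : Curve E p q) (S : Surface γ₀ γ₁),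
      (F.map₂ (P2.mk k S)).1 = transport₂ C θ Υ S

/-- Pseudonatural transformations `F ⇒ F'` of `2`-functors into `B₀(G, H)`. -/
structure PseudoNat [FiniteDimensional ℝ E] {k : Kind} {C : LieCrossedModule 𝔤 𝔥 G H}
    (F F' : TwoFunctor E M k C) where
  /-- the component `1`-cells -/
  app : M → G
  /-- the component `2`-cells -/
  cell : ∀ {p q : M} (a : P1 E p q), C.Cell (app q * F.map₁ a) (F'.map₁ a * app p)
  naturality_id : ∀ p : M,
    (cell (P1.id E p)).1 = (LieCrossedModule.Cell.id (C := C) (app p)).1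
  naturality_comp : ∀ {p q r : M} (b : P1 E q r) (a : P1 E p q),
    (cell (b.comp a)).1 =
      ((LieCrossedModule.Cell.id (C := C) (F'.map₁ b)).hcomp (cell a)).1 *
        ((cell b).hcomp (LieCrossedModule.Cell.id (C := C) (F.map₁ a))).1
  naturality₂ : ∀ {p q : M} (S : P2 E k p q),
    ((F'.map₂ S).hcomp (LieCrossedModule.Cell.id (C := C) (app p))).vcomp (cell S.src) =
      (cell S.tgt).vcomp ((LieCrossedModule.Cell.id (C := C) (app q)).hcomp (F.map₂ S))

end Main
end HigherTransport
end

open HigherTransport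

/-! Everything is pulled back to `ℝ × S`, where `x ∈ ℝ` runs along the curves and `S` collects the
remaining variables: `S = ℝ` for a surface, `S = ℝ²` for a homotopy of surfaces. There a doublet has
components `a`, `B`. The parallel transport `u` based at `x = 1` gives a gauge `u⁻¹` in which `a_x`
vanishes. In this radial gauge the equation `da + ½[a,a] = ṫ(B)` reduces to an equation for `∂ₓ`,
and integrating it from `x = 1` shows that the other components of `a` are `-ṫ(β_w)`, where `β_w` is
the primitive of `-ṁ(u⁻¹)(B_{xw})` vanishing at `x = 1` (`IsFrame.rotate_dirS`). The equation for
`W` can be integrated once in `x`, so the surface transport is `w(1)`, where `w' w⁻¹ = β(0, ·)` and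
`w(0) = 1` (`transport₂_eq`). Hence the whole theory is a study of `u` and `β` on the line `x = 0`.

The identity `t(w) = u(0,y)⁻¹ u(0,0)` makes the surface transport a `2`-cell. A surface of rank at
most one has `B = 0`, so its transport is `1`; applied to thin homotopies of curves this gives
invariance of the curve transport. Compositions follow from uniqueness of solutions and
reparametrization, with the Peiffer identity `Ad X = ṁ(t X)` producing the twist in the horizontal
case.

For a homotopy of surfaces, the vanishing of `dB + m̂(a,B)` says in radial gauge that `∂_y β_z - ∂_z
β_y = [β_y, β_z]` on `x = 0` (`IsFrame.curl_β`): a flat `H`-connection on the `(y,z)`-plane, trivial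
in the direction `z` on the two sides `y = 0` and `y = 1`. Its holonomy along `y` therefore does not
depend on `z` (`flat_holonomy_eq`). The `2`-curvature vanishes either because a `3`-form dies on a
map of rank at most two, or because the doublet is flat, so thin and general homotopies have the
same proof.

A gauge transformation is a rotation by `κ = g ∘ Σ` followed by a shift by `J`. The radial gauges of
the two doublets are related by `κ` and the solution `Λ` of the gauge equation: `u' = κ u t(Λ)⁻¹
c⁻¹` with `c = g(p₁)`, and `ṁ(c⁻¹)β'` is `Ad(Λ)β + dΛ Λ⁻¹` up to a term in `J` (`IsFrame.gauge_u`,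
`IsFrame.gauge_β`). At `x = 0` that term vanishes, because surfaces are constant there, so `w'` is
`m(c)(Λ w Λ(0,0)⁻¹)`: this is naturality. Thin invariance of `gaugeHol` is the special case in which
both surface transports are `1`.

The analytic input is global solvability of `u' u⁻¹ = b` on a Lie group with smooth dependence on
parameters (`exists_smooth_solution`), and the algebraic input is the Maurer-Cartan equation
together with the infinitesimal identities of a crossed module. -/

noncomputable section
set_option linter.unusedSectionVars false
open scoped Manifold ContDiff Topology
namespace HigherTransport

/-! ### Superposition operators and differential equations depending on parameters -/

section Superposition

variable {I : Type*} [TopologicalSpace I] [CompactSpace I]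

/-- The superposition operator `y ↦ g ∘ y` on continuous functions. -/
def superpos (I : Type*) [TopologicalSpace I] {X W : Type*} [TopologicalSpace X]
    [TopologicalSpace W] (g : C(X, W)) (y : C(I, X)) : C(I, W) := g.comp y

/-- Pointwise application of a continuous family of continuous linear maps. -/
def pointwiseApply (I : Type*) [TopologicalSpace I] [CompactSpace I] (X W : Type*)
    [NormedAddCommGroup X] [NormedSpace ℝ X] [NormedAddCommGroup W] [NormedSpace ℝ W] :
    C(I, X →L[ℝ] W) →L[ℝ] C(I, X) →L[ℝ] C(I, W) :=
  LinearMap.mkContinuous₂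
    (LinearMap.mk₂ ℝ (fun (A : C(I, X →L[ℝ] W)) (h : C(I, X)) =>
      (⟨fun t => A t (h t), by fun_prop⟩ : C(I, W)))
      (fun _ _ _ => by ext; simp) (fun _ _ _ => by ext; simp)
      (fun _ _ _ => by ext; simp) (fun _ _ _ => by ext; simp)) 1
    (fun A h => by
      rw [ContinuousMap.norm_le _ (by positivity)]
      intro t
      simp only [LinearMap.mk₂_apply, ContinuousMap.coe_mk, one_mul]
      exact (A t).le_of_opNorm_le_of_le (A.norm_coe_le_norm t) (h.norm_coe_le_norm t))

@[simp] theorem pointwiseApply_apply {X W : Type*}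
    [NormedAddCommGroup X] [NormedSpace ℝ X] [NormedAddCommGroup W] [NormedSpace ℝ W]
    (A : C(I, X →L[ℝ] W)) (h : C(I, X)) (t : I) : pointwiseApply I X W A h t = A t (h t) := rfl

/-- The mean value inequality is applied pointwise in `t`. The estimate is uniform in `t` because `y
↦ g' ∘ y` is continuous for the supremum norm, `I` being compact. -/
theorem hasFDerivAt_superpos {X W : Type*} [NormedAddCommGroup X] [NormedSpace ℝ X]
    [NormedAddCommGroup W] [NormedSpace ℝ W] (g : C(X, W)) (g' : C(X, X →L[ℝ] W))
    (hg : ∀ x, HasFDerivAt g (g' x) x) (y : C(I, X)) :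
    HasFDerivAt (superpos I g) (pointwiseApply I X W (superpos I g' y)) y := by
  have hc : Continuous (superpos I g' : C(I, X) → _) := ContinuousMap.continuous_postcomp g'
  rw [hasFDerivAt_iff_isLittleO_nhds_zero, Asymptotics.isLittleO_iff]
  intro ε hε
  obtain ⟨δ, hδ, H⟩ := (Metric.continuousAt_iff (f := superpos I g') (a := y)).1 hc.continuousAt ε hε
  filter_upwards [Metric.ball_mem_nhds (0 : C(I, X)) hδ] with h hh
  rw [ContinuousMap.norm_le _ (by positivity)]
  intro t
  -- The modulus of continuity at the function `y` is tested on translates of `y` by constants,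
  -- which yields one `δ` valid for every `t`.
  have key : ∀ z ∈ Metric.ball (y t) δ, ‖g' z - g' (y t)‖ ≤ ε := by
    intro z hz
    have h1 : dist (y + ContinuousMap.const I (z - y t)) y < δ := by
      rw [dist_eq_norm, add_sub_cancel_left]
      exact lt_of_le_of_lt ((ContinuousMap.norm_le _ (norm_nonneg _)).2 fun s => le_rfl)
        (mem_ball_iff_norm.1 hz)
    have h2 := (ContinuousMap.dist_apply_le_dist t).trans_lt (H h1)
    rw [dist_eq_norm] at h2
    have h3 : g' (y t + (z - y t)) = g' z := by congr 1; abel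
    simpa [superpos, h3] using h2.le
  have hht : ‖h t‖ < δ := (h.norm_coe_le_norm t).trans_lt (by simpa using hh)
  have := (convex_ball (y t) δ).norm_image_sub_le_of_norm_hasFDerivWithin_le'
    (f := g) (φ := g' (y t)) (fun z _ => (hg z).hasFDerivWithinAt) key
    (Metric.mem_ball_self hδ) (y := y t + h t) (by simpa using hht)
  simp only [superpos, add_sub_cancel_left] at this ⊢
  refine this.trans ?_
  gcongr
  exact h.norm_coe_le_norm t

universe u v

/-- Induction on `n`: the derivative of the superposition operator of `g` is the superposition
operator of `fderiv ℝ g` followed by a continuous linear map. The target `W` varies in the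
induction, so `X →L[ℝ] W` has to stay in the universe of `W`; hence the common universe. -/
theorem contDiff_superpos_nat {X : Type u} [NormedAddCommGroup X] [NormedSpace ℝ X] (n : ℕ) :
    ∀ {W : Type u} [NormedAddCommGroup W] [NormedSpace ℝ W] (g : C(X, W)), ContDiff ℝ ∞ g →
      ContDiff ℝ n (superpos I g) := by
  induction n with
  | zero =>
    intro W _ _ g _
    exact contDiff_zero.2 (ContinuousMap.continuous_postcomp g)
  | succ n ih =>
    intro W _ _ g hg
    have hg' : ContDiff ℝ ∞ (fderiv ℝ g) := hg.fderiv_right (by simp)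
    have h1 : ContDiff ℝ n (superpos I (⟨fderiv ℝ g, hg'.continuous⟩ : C(X, X →L[ℝ] W))) :=
      ih ⟨fderiv ℝ g, hg'.continuous⟩ hg'
    have h2 : ContDiff ℝ n (fun A => pointwiseApply I X W A) := ContinuousLinearMap.contDiff _
    refine contDiff_succ_iff_hasFDerivAt.2
      ⟨fun y => pointwiseApply I X W (superpos I ⟨fderiv ℝ g, hg'.continuous⟩ y),
        h2.comp h1, fun y => ?_⟩
    exact hasFDerivAt_superpos g ⟨fderiv ℝ g, hg'.continuous⟩
      (fun x => (hg.differentiable (by simp) x).hasFDerivAt) y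

theorem contDiff_superpos {X W : Type u} [NormedAddCommGroup X] [NormedSpace ℝ X]
    [NormedAddCommGroup W] [NormedSpace ℝ W] (g : C(X, W)) (hg : ContDiff ℝ ∞ g) :
    ContDiff ℝ ∞ (superpos I g) :=
  contDiff_infty.2 fun n => contDiff_superpos_nat n g hg

end Superposition

/-! ### The integral operator of a differential equation on `[-1, 1]` -/

section Volterra

variable {V : Type*} [NormedAddCommGroup V] [NormedSpace ℝ V]

/-- The interval `[-1, 1]`. -/
abbrev UnitTime : Type := Set.Icc (-1 : ℝ) 1

/-- Projection to the interval `[-1, 1]`. -/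
abbrev toUnitTime (x : ℝ) : UnitTime := Set.projIcc (-1 : ℝ) 1 (by norm_num) x

theorem continuous_comp_toUnitTime {V : Type*} [TopologicalSpace V] (w : C(UnitTime, V)) : Continuous fun x => w (toUnitTime x) :=
  w.continuous.comp continuous_projIcc

theorem contDiff_evalTime (τ : UnitTime) : ContDiff ℝ ∞ (fun w : C(UnitTime, V) => w τ) :=
  (LinearMap.mkContinuous ⟨⟨fun w => w τ, fun _ _ => rfl⟩, fun _ _ => rfl⟩ 1
    (fun w => by simpa using w.norm_coe_le_norm τ) : C(UnitTime, V) →L[ℝ] V).contDiff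

variable (V) in
/-- The operator `w ↦ ∫₀^τ w` on continuous functions on `[-1, 1]`. -/
def volterra [CompleteSpace V] : C(UnitTime, V) →L[ℝ] C(UnitTime, V) :=
  LinearMap.mkContinuous
    { toFun := fun w => ⟨fun τ => ∫ x in (0 : ℝ)..τ, w (toUnitTime x),
        (intervalIntegral.continuous_primitive
          (fun _ _ => (continuous_comp_toUnitTime w).intervalIntegrable _ _) 0).comp
            continuous_subtype_val⟩
      map_add' := fun w w' => by
        ext τ
        simpa using intervalIntegral.integral_add
          ((continuous_comp_toUnitTime w).intervalIntegrable _ _)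
          ((continuous_comp_toUnitTime w').intervalIntegrable _ _)
      map_smul' := fun c w => by
        ext τ
        simp } 1
    (fun w => by
      rw [ContinuousMap.norm_le _ (by positivity)]
      intro τ
      have h1 : |(τ : ℝ)| ≤ 1 := abs_le.2 τ.2
      refine (intervalIntegral.norm_integral_le_of_norm_le_const
        (C := ‖w‖) fun x _ => w.norm_coe_le_norm _).trans ?_
      rw [sub_zero, one_mul]
      exact mul_le_of_le_one_right (norm_nonneg _) h1)

theorem volterra_apply [CompleteSpace V] (w : C(UnitTime, V)) (τ : UnitTime) :
    volterra V w τ = ∫ x in (0 : ℝ)..τ, w (toUnitTime x) := rfl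

variable {S : Type*} [NormedAddCommGroup S] [NormedSpace ℝ S]

variable (S V) in
/-- The map sending `((δ, c, s), y)` to `τ ↦ (c + δ τ, s, y(τ))`. -/
def timeGraph : (ℝ × ℝ × S) × C(UnitTime, V) →L[ℝ] C(UnitTime, ℝ × S × V) :=
  LinearMap.mkContinuous
    { toFun := fun z => ⟨fun τ => (z.1.2.1 + z.1.1 * τ, z.1.2.2, z.2 τ), by fun_prop⟩
      map_add' := fun z z' => by
        ext τ <;> simp; ring
      map_smul' := fun c z => by
        ext τ <;> simp; ring } 2
    (fun z => by
      rw [ContinuousMap.norm_le _ (by positivity)]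
      intro τ
      have h1 : |(τ : ℝ)| ≤ 1 := abs_le.2 τ.2
      have e1 : ‖z.1‖ ≤ ‖z‖ := norm_fst_le z
      have e2 : ‖z.2‖ ≤ ‖z‖ := norm_snd_le z
      have e3 : ‖z.1.1‖ ≤ ‖z.1‖ := norm_fst_le z.1
      have e4 : ‖z.1.2‖ ≤ ‖z.1‖ := norm_snd_le z.1
      have e5 : ‖z.1.2.1‖ ≤ ‖z.1.2‖ := norm_fst_le z.1.2
      have e6 : ‖z.1.2.2‖ ≤ ‖z.1.2‖ := norm_snd_le z.1.2
      have e7 : ‖z.2 τ‖ ≤ ‖z.2‖ := z.2.norm_coe_le_norm τ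
      have e8 : 0 ≤ ‖z‖ := norm_nonneg z
      simp only [LinearMap.coe_mk, AddHom.coe_mk, ContinuousMap.coe_mk]
      refine max_le ?_ (max_le (by linarith) (by linarith))
      refine (norm_add_le _ _).trans ?_
      have : ‖z.1.1 * (τ : ℝ)‖ ≤ ‖z.1.1‖ := by
        rw [norm_mul]
        exact mul_le_of_le_one_right (norm_nonneg _) h1
      linarith)

theorem timeGraph_apply (z : (ℝ × ℝ × S) × C(UnitTime, V)) (τ : UnitTime) :
    timeGraph V S z τ = (z.1.2.1 + z.1.1 * τ, z.1.2.2, z.2 τ) := rfl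

end Volterra

/-! ### Short time solutions by the implicit function theorem -/

section LocalFlow

universe u

variable {S : Type} [NormedAddCommGroup S] [NormedSpace ℝ S] {V : Type u} [NormedAddCommGroup V]
  [NormedSpace ℝ V] [CompleteSpace V]

/-- Short time solutions of `y' = f(x, s, y)`, `y(c) = e`, on the interval with centre `c` and radius
`δ` (rescaled to `[-1, 1]`) depend smoothly on `δ`, `c` and `s` at `δ = 0`. -/
theorem exists_local_flow [CompleteSpace S] (f : ℝ × S × V → V) (hf : ContDiff ℝ ∞ f) (e : V)
    (c₀ : ℝ) (s₀ : S) :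
    ∃ Ψ : ℝ × ℝ × S → C(UnitTime, V), ContDiffAt ℝ ∞ Ψ (0, c₀, s₀) ∧
      Ψ (0, c₀, s₀) = ContinuousMap.const _ e ∧
      ∀ᶠ q in 𝓝 ((0, c₀, s₀) : ℝ × ℝ × S), Ψ q (toUnitTime 0) = e ∧
        ∀ τ ∈ Set.Ioo (-1 : ℝ) 1, HasDerivAt (fun x => Ψ q (toUnitTime x))
          (q.1 • f (q.2.1 + q.1 * τ, q.2.2, Ψ q (toUnitTime τ))) τ := by
  set g : C(ℝ × S × V, V) := ⟨f, hf.continuous⟩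
  -- Zeros of `F` are the solutions of the rescaled integral equation `y = e + δ ∫ f`. At `δ = 0`
  -- the equation degenerates to `y = e`.
  set F : (ℝ × ℝ × S) × C(UnitTime, V) → C(UnitTime, V) := fun z =>
    z.2 - ContinuousMap.const _ e - z.1.1 • volterra V (superpos UnitTime g (timeGraph V S z))
    with hF
  set u₀ : (ℝ × ℝ × S) × C(UnitTime, V) := ((0, c₀, s₀), ContinuousMap.const _ e) with hu₀
  have hFs : ContDiff ℝ ∞ F := by
    have h1 : ContDiff ℝ ∞ (superpos UnitTime g) := contDiff_superpos g hf
    have h2 : ContDiff ℝ ∞ (fun z => timeGraph V S z) := ContinuousLinearMap.contDiff _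
    have h4 := (volterra V).contDiff.comp (h1.comp h2)
    exact (contDiff_snd.sub contDiff_const).sub ((contDiff_fst.comp contDiff_fst).smul h4)
  have hFu : F u₀ = 0 := by simp [hF, hu₀]
  -- For `δ = 0` the map `F` is a translation in `y`, so its partial derivative is the identity and
  -- the implicit function theorem applies.
  have hinv : fderiv ℝ F u₀ ∘L .inr ℝ (ℝ × ℝ × S) C(UnitTime, V) = .id ℝ _ := by
    have h1 : HasFDerivAt (fun y => F (u₀.1, y))
        (fderiv ℝ F u₀ ∘L .inr ℝ (ℝ × ℝ × S) C(UnitTime, V)) u₀.2 :=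
      ((hFs.differentiable (by simp) u₀).hasFDerivAt).comp u₀.2 (hasFDerivAt_prodMk_right u₀.1 u₀.2)
    have h2 : (fun y => F (u₀.1, y)) = fun y => y - ContinuousMap.const _ e := by
      ext y; simp [hF, hu₀]
    rw [h2] at h1
    exact h1.unique ((hasFDerivAt_id _).sub_const _)
  have hinv' : (fderiv ℝ F u₀ ∘L .inr ℝ (ℝ × ℝ × S) C(UnitTime, V)).IsInvertible := by
    rw [hinv]; exact ⟨.refl ℝ _, rfl⟩
  have hFa : ContDiffAt ℝ ∞ F u₀ := hFs.contDiffAt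
  refine ⟨hFa.implicitFunction (by simp) hinv', hFa.contDiffAt_implicitFunction (by simp) hinv',
    hFa.implicitFunction_apply_self (by simp) hinv', ?_⟩
  filter_upwards [hFa.eventually_apply_implicitFunction (by simp) hinv'] with q hq
  set y := hFa.implicitFunction (by simp) hinv' q
  rw [hFu] at hq
  have hy : ∀ τ : UnitTime, y τ = e + q.1 • ∫ x in (0 : ℝ)..τ,
      f (q.2.1 + q.1 * (toUnitTime x : ℝ), q.2.2, y (toUnitTime x)) := by
    intro τ
    have := congrArg (fun w : C(UnitTime, V) => w τ) hq
    simp only [hF, ContinuousMap.sub_apply, ContinuousMap.const_apply, ContinuousMap.smul_apply,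
      volterra_apply, ContinuousMap.zero_apply] at this
    rw [sub_sub, sub_eq_zero] at this
    exact this
  have h0 : (toUnitTime 0 : ℝ) = 0 := by
    simp [toUnitTime, Set.projIcc_of_mem (by norm_num : (-1 : ℝ) ≤ 1)
      (by norm_num : (0 : ℝ) ∈ Set.Icc (-1 : ℝ) 1)]
  refine ⟨by rw [hy, h0]; simp, fun τ hτ => ?_⟩
  have hv : ∀ x ∈ Set.Ioo (-1 : ℝ) 1, (toUnitTime x : ℝ) = x := fun x hx => by
    simp [toUnitTime, Set.projIcc_of_mem (by norm_num : (-1 : ℝ) ≤ 1) (Set.Ioo_subset_Icc_self hx)]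
  have hcont : Continuous fun x =>
      f (q.2.1 + q.1 * (toUnitTime x : ℝ), q.2.2, y (toUnitTime x)) := by
    have := continuous_projIcc (a := (-1 : ℝ)) (b := 1) (h := by norm_num)
    exact hf.continuous.comp (by fun_prop)
  have h1 := ((hcont.integral_hasStrictDerivAt 0 τ).hasDerivAt.const_smul q.1).const_add e
  rw [hv τ hτ] at h1
  refine h1.congr_of_eventuallyEq ?_
  filter_upwards [isOpen_Ioo.mem_nhds hτ] with x hx
  rw [hy (toUnitTime x), hv x hx]
  rfl

/-- Smooth functions depending smoothly on parameters have smooth primitives. -/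
theorem exists_primitive (f : ℝ × S → V) (hf : ContDiff ℝ ∞ f) (x₀ : ℝ) :
    ∃ F : ℝ × S → V, ContDiff ℝ ∞ F ∧ (∀ s, F (x₀, s) = 0) ∧
      ∀ x s, HasDerivAt (fun x => F (x, s)) (f (x, s)) x := by
  set g : C(ℝ × S × V, V) := ⟨fun z => f (z.1, z.2.1), hf.continuous.comp (by fun_prop)⟩ with hg
  have hgs : ContDiff ℝ ∞ g := hf.comp (contDiff_fst.prodMk (contDiff_fst.comp contDiff_snd))
  have h0 : (-1 : ℝ) ≤ 1 := by norm_num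
  -- The integral from `x₀` to `x` is rescaled to `[0, 1]`, which moves the endpoint into the
  -- integrand, where superposition handles it. The function `0` fills the argument that `g`
  -- ignores.
  refine ⟨fun z => (z.1 - x₀) • volterra V (superpos UnitTime g
    (timeGraph V S ((z.1 - x₀, x₀, z.2), 0))) (toUnitTime 1), ?_, by simp, ?_⟩
  · have h1 : ContDiff ℝ ∞ (superpos UnitTime g) := contDiff_superpos g hgs
    have h2 : ContDiff ℝ ∞ (fun z => timeGraph V S z) := ContinuousLinearMap.contDiff _
    have h4 := (volterra V).contDiff.comp (h1.comp h2)
    have h3 : ContDiff ℝ ∞ fun z : ℝ × S =>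
        (((z.1 - x₀, x₀, z.2), 0) : (ℝ × ℝ × S) × C(UnitTime, V)) :=
      ((contDiff_fst.sub contDiff_const).prodMk
        (contDiff_const.prodMk contDiff_snd)).prodMk contDiff_const
    have h5 := contDiff_evalTime (V := V) (toUnitTime 1)
    exact (contDiff_fst.sub contDiff_const).smul (h5.comp (h4.comp h3))
  · intro x s
    have e : ∀ x, (x - x₀) • volterra V (superpos UnitTime g
        (timeGraph V S ((x - x₀, x₀, s), 0))) (toUnitTime 1) = ∫ t in x₀..x, f (t, s) := by
      intro x
      have h1 : (toUnitTime 1 : ℝ) = 1 := by simp [toUnitTime, Set.projIcc_right]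
      have h2 : ∀ t ∈ Set.uIcc (0 : ℝ) 1, superpos UnitTime g
          (timeGraph V S ((x - x₀, x₀, s), 0)) (toUnitTime t) = f (x₀ + (x - x₀) * t, s) := by
        intro t ht
        rw [Set.uIcc_of_le zero_le_one] at ht
        have : (toUnitTime t : ℝ) = t := by
          simp [toUnitTime, Set.projIcc_of_mem h0 (x := t) ⟨by linarith [ht.1], ht.2⟩]
        simp [superpos, timeGraph_apply, hg, this]
      rw [volterra_apply, h1, intervalIntegral.integral_congr h2]
      have := intervalIntegral.smul_integral_comp_add_mul (f := fun t => f (t, s)) (a := 0) (b := 1)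
        (x - x₀) x₀
      simpa using this
    rw [funext e]
    have hc : Continuous fun t => f (t, s) := hf.continuous.comp (by fun_prop)
    exact hc.integral_hasStrictDerivAt x₀ x |>.hasDerivAt

end LocalFlow

/-! ### Differentials of maps between manifolds -/

section Tang

/-- Smoothness at a point. -/
abbrev SmoothAt (V W : Type*) {X Y : Type*} [NormedAddCommGroup V] [NormedSpace ℝ V]
    [NormedAddCommGroup W] [NormedSpace ℝ W] [TopologicalSpace X] [ChartedSpace V X]
    [TopologicalSpace Y] [ChartedSpace W Y] (f : X → Y) (x : X) : Prop :=
  ContMDiffAt 𝓘(ℝ, V) 𝓘(ℝ, W) ∞ f x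

/-- Differentiability at a point. -/
abbrev MDAt (V W : Type*) {X Y : Type*} [NormedAddCommGroup V] [NormedSpace ℝ V]
    [NormedAddCommGroup W] [NormedSpace ℝ W] [TopologicalSpace X] [ChartedSpace V X]
    [TopologicalSpace Y] [ChartedSpace W Y] (f : X → Y) (x : X) : Prop :=
  MDifferentiableAt 𝓘(ℝ, V) 𝓘(ℝ, W) f x

variable {V W U N : Type*} [NormedAddCommGroup V] [NormedSpace ℝ V]
  [NormedAddCommGroup W] [NormedSpace ℝ W] [NormedAddCommGroup U] [NormedSpace ℝ U]
  [NormedAddCommGroup N] [NormedSpace ℝ N]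
  {X Y Z T : Type*} [TopologicalSpace X] [ChartedSpace V X] [TopologicalSpace Y] [ChartedSpace W Y]
  [TopologicalSpace Z] [ChartedSpace U Z] [TopologicalSpace T] [ChartedSpace N T]

theorem SmoothAt.mdAt {f : X → Y} {x : X} (h : SmoothAt V W f x) : MDAt V W f x :=
  h.mdifferentiableAt (by simp)

theorem tang_comp {f : Y → Z} {g : X → Y} (x : X) (hf : MDAt W U f (g x)) (hg : MDAt V W g x) :
    tang V U (fun x => f (g x)) x = (tang W U f (g x)).comp (tang V W g x) :=
  mfderiv_comp x hf hg

theorem MDAt.comp {f : Y → Z} {g : X → Y} (x : X) (hf : MDAt W U f (g x)) (hg : MDAt V W g x) :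
    MDAt V U (fun x => f (g x)) x :=
  MDifferentiableAt.comp x hf hg

@[simp] theorem tang_const (c : Y) (x : X) : tang V W (fun _ : X => c) x = 0 := mfderiv_const

@[simp] theorem tang_id (x : X) : tang V V (fun x : X => x) x = .id ℝ V := mfderiv_id

theorem tang_eq_fderiv (f : V → W) (x : V) : tang V W f x = fderiv ℝ f x := mfderiv_eq_fderiv

theorem tang_congr {f g : X → Y} {x : X} (h : f =ᶠ[𝓝 x] g) : tang V W f x = tang V W g x :=
  h.mfderiv_eq

theorem tang_comp₂ {F : X × Y → Z} {p : T → X} {q : T → Y} (s : T)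
    (hF : MDifferentiableAt (𝓘(ℝ, V).prod 𝓘(ℝ, W)) 𝓘(ℝ, U) F (p s, q s))
    (hp : MDAt N V p s) (hq : MDAt N W q s) :
    tang N U (fun s => F (p s, q s)) s =
      (tang V U (fun x => F (x, q s)) (p s)).comp (tang N V p s) +
        (tang W U (fun y => F (p s, y)) (q s)).comp (tang N W q s) := by
  have h1 : tang N U (fun s => F (p s, q s)) s =
      (mfderiv (𝓘(ℝ, V).prod 𝓘(ℝ, W)) 𝓘(ℝ, U) F (p s, q s)).comp
        (mfderiv 𝓘(ℝ, N) (𝓘(ℝ, V).prod 𝓘(ℝ, W)) (fun s => (p s, q s)) s) :=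
    mfderiv_comp s hF (hp.prodMk hq)
  rw [h1]
  ext v
  erw [ContinuousLinearMap.comp_apply, mfderiv_prod_eq_add_apply hF, hp.mfderiv_prod hq]
  rfl

end Tang

/-! ### Logarithmic derivatives -/

section LogDeriv

variable {V W : Type*} [NormedAddCommGroup V] [NormedSpace ℝ V]
  [NormedAddCommGroup W] [NormedSpace ℝ W] {X Y : Type*} [TopologicalSpace X] [ChartedSpace V X]
  [TopologicalSpace Y] [ChartedSpace W Y]
  {𝔨 : Type*} [NormedAddCommGroup 𝔨] [NormedSpace ℝ 𝔨]
  {K : Type*} [Group K] [TopologicalSpace K] [ChartedSpace 𝔨 K]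

/-- The logarithmic derivative `du u⁻¹` of a map into a Lie group. -/
def rlog (V 𝔨 : Type*) {X K : Type*} [NormedAddCommGroup V] [NormedSpace ℝ V]
    [TopologicalSpace X] [ChartedSpace V X] [NormedAddCommGroup 𝔨] [NormedSpace ℝ 𝔨]
    [Group K] [TopologicalSpace K] [ChartedSpace 𝔨 K] (u : X → K) (x : X) : V →L[ℝ] 𝔨 :=
  tang V 𝔨 (fun z => u z * (u x)⁻¹) x

@[simp] theorem rlog_const (c : K) (x : X) : rlog V 𝔨 (fun _ : X => c) x = 0 := tang_const _ _

theorem rlog_mul_const (u : X → K) (c : K) (x : X) :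
    rlog V 𝔨 (fun z => u z * c) x = rlog V 𝔨 u x := by
  simp only [rlog]
  congr 1
  ext z
  group

theorem rlog_congr {u w : X → K} {x : X} (h : u =ᶠ[𝓝 x] w) : rlog V 𝔨 u x = rlog V 𝔨 w x := by
  refine tang_congr ?_
  filter_upwards [h] with z hz
  rw [hz, h.eq_of_nhds]

variable [LieGroup 𝓘(ℝ, 𝔨) ∞ K]

theorem mdifferentiable_mul (z : K × K) :
    MDifferentiableAt (𝓘(ℝ, 𝔨).prod 𝓘(ℝ, 𝔨)) 𝓘(ℝ, 𝔨) (fun z : K × K => z.1 * z.2) z :=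
  (contMDiff_mul 𝓘(ℝ, 𝔨) ∞).mdifferentiableAt (by simp)

theorem MDAt.mul {p q : X → K} {x : X} (hp : MDAt V 𝔨 p x) (hq : MDAt V 𝔨 q x) :
    MDAt V 𝔨 (fun z => p z * q z) x :=
  MDifferentiableAt.comp x (mdifferentiable_mul (p x, q x)) (hp.prodMk hq)

theorem MDAt.inv {p : X → K} {x : X} (hp : MDAt V 𝔨 p x) : MDAt V 𝔨 (fun z => (p z)⁻¹) x :=
  MDifferentiableAt.comp x ((contMDiff_inv 𝓘(ℝ, 𝔨) ∞).mdifferentiableAt (by simp)) hp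

theorem MDAt.const (c : K) (x : X) : MDAt V 𝔨 (fun _ : X => c) x := mdifferentiableAt_const

theorem MDAt.id' (x : X) : MDAt V V (fun x : X => x) x := mdifferentiableAt_id

theorem tang_mul_of_eq_one {p q : X → K} {x : X} (hp : MDAt V 𝔨 p x) (hq : MDAt V 𝔨 q x)
    (hp1 : p x = 1) (hq1 : q x = 1) :
    tang V 𝔨 (fun z => p z * q z) x = tang V 𝔨 p x + tang V 𝔨 q x := by
  rw [tang_comp₂ (F := fun z : K × K => z.1 * z.2) x (mdifferentiable_mul _) hp hq]
  simp [hp1, hq1]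

/-- The quotient `u w (u(x) w(x))⁻¹` factors into two maps with value `1` at `x`, and the
differential of multiplication at `(1, 1)` is addition. -/
theorem rlog_mul {u w : X → K} {x : X} (hu : MDAt V 𝔨 u x) (hw : MDAt V 𝔨 w x) :
    rlog V 𝔨 (fun z => u z * w z) x = rlog V 𝔨 u x + (Ad (u x)).comp (rlog V 𝔨 w x) := by
  have e : (fun z => u z * w z * (u x * w x)⁻¹) =
      fun z => (u z * (u x)⁻¹) * (u x * (w z * (w x)⁻¹) * (u x)⁻¹) := by
    ext z; group
  have h1 : MDAt V 𝔨 (fun z => w z * (w x)⁻¹) x := hw.mul (.const _ _)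
  have h2 : ∀ b : K, MDAt 𝔨 𝔨 (fun b : K => u x * b * (u x)⁻¹) b := fun b =>
    ((MDAt.const _ _).mul (.id' b)).mul (.const _ _)
  have h3 := tang_comp (f := fun b : K => u x * b * (u x)⁻¹) x (h2 _) h1
  have h4 : MDAt V 𝔨 (fun z => u x * (w z * (w x)⁻¹) * (u x)⁻¹) x := MDAt.comp x (h2 _) h1
  rw [rlog, e, tang_mul_of_eq_one (hu.mul (.const _ _)) h4 (by simp) (by simp), h3,
    mul_inv_cancel]
  rfl

theorem rlog_inv {u : X → K} {x : X} (hu : MDAt V 𝔨 u x) :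
    rlog V 𝔨 (fun z => (u z)⁻¹) x = -(Ad (u x)⁻¹).comp (rlog V 𝔨 u x) := by
  have h := rlog_mul hu.inv hu
  simp only [inv_mul_cancel, rlog_const] at h
  exact eq_neg_of_add_eq_zero_left h.symm

theorem rlog_comp {u : X → K} {h : Y → X} (y : Y) (hu : MDAt V 𝔨 u (h y)) (hh : MDAt W V h y) :
    rlog W 𝔨 (fun y => u (h y)) y = (rlog V 𝔨 u (h y)).comp (tang W V h y) :=
  tang_comp (f := fun z => u z * (u (h y))⁻¹) y (hu.mul (.const _ _)) hh

theorem rlog_hom {𝔩 L : Type*} [NormedAddCommGroup 𝔩] [NormedSpace ℝ 𝔩] [Group L]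
    [TopologicalSpace L] [ChartedSpace 𝔩 L] (φ : K →* L) (hφ : MDAt 𝔨 𝔩 φ 1) {u : X → K} {x : X}
    (hu : MDAt V 𝔨 u x) :
    rlog V 𝔩 (fun z => φ (u z)) x = (tang 𝔨 𝔩 φ 1).comp (rlog V 𝔨 u x) := by
  have e : (fun z => φ (u z) * (φ (u x))⁻¹) = fun z => φ (u z * (u x)⁻¹) := by
    ext z; simp
  have h1 : MDAt 𝔨 𝔩 φ (u x * (u x)⁻¹) := by rwa [mul_inv_cancel]
  rw [rlog, e, tang_comp (f := φ) x h1 (hu.mul (.const _ _)), mul_inv_cancel]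
  rfl

/-- A differential depending on a parameter is smooth when read in tangent coordinates around the
base parameter. If the chart at `g x` and the point `f x (g x)` do not vary with `x`, the coordinate
changes are identities and the differential itself is smooth. This covers all maps that send a fixed
point to the identity of a group. -/
theorem contMDiffAt_tang_of_const {N M M' : Type*} {EN EM EM' : Type*}
    [NormedAddCommGroup EN] [NormedSpace ℝ EN] [NormedAddCommGroup EM] [NormedSpace ℝ EM]
    [NormedAddCommGroup EM'] [NormedSpace ℝ EM']
    [TopologicalSpace N] [ChartedSpace EN N] [TopologicalSpace M] [ChartedSpace EM M]
    [TopologicalSpace M'] [ChartedSpace EM' M'] [IsManifold 𝓘(ℝ, EN) ∞ N]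
    [IsManifold 𝓘(ℝ, EM) ∞ M] [IsManifold 𝓘(ℝ, EM') ∞ M']
    (f : N → M → M') (g : N → M) (x₀ : N)
    (hf : ContMDiffAt (𝓘(ℝ, EN).prod 𝓘(ℝ, EM)) 𝓘(ℝ, EM') ∞ (Function.uncurry f) (x₀, g x₀))
    (hg : SmoothAt EN EM g x₀) (hgc : ∀ x, chartAt EM (g x) = chartAt EM (g x₀))
    (hfc : ∀ x, f x (g x) = f x₀ (g x₀)) :
    ContMDiffAt 𝓘(ℝ, EN) 𝓘(ℝ, EM →L[ℝ] EM') ∞ (fun x => tang EM EM' (f x) (g x)) x₀ := by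
  have : IsManifold 𝓘(ℝ, EM) 1 M := IsManifold.of_le (n := ∞) (by simp)
  have : IsManifold 𝓘(ℝ, EM') 1 M' := IsManifold.of_le (n := ∞) (by simp)
  have h : ContMDiffAt 𝓘(ℝ, EN) 𝓘(ℝ, EM →L[ℝ] EM') ∞
      (inTangentCoordinates 𝓘(ℝ, EM) 𝓘(ℝ, EM') g (fun x => f x (g x))
        (fun x => tang EM EM' (f x) (g x)) x₀) x₀ :=
    ContMDiffAt.mfderiv (I := 𝓘(ℝ, EM)) (I' := 𝓘(ℝ, EM')) (m := ∞) f g hf hg (by simp)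
  convert! h using 1
  ext x v
  have h1 : g x ∈ (chartAt EM (g x₀)).source := by rw [← hgc]; exact mem_chart_source _ _
  have h2 : f x (g x) ∈ (chartAt EM' (f x₀ (g x₀))).source := by
    simpa only [hfc x] using mem_chart_source EM' (f x₀ (g x₀))
  have h3 : achart EM (g x) = achart EM (g x₀) := Subtype.ext (hgc x)
  have h4 : achart EM' (f x (g x)) = achart EM' (f x₀ (g x₀)) := by rw [hfc]
  rw [inTangentCoordinates_eq (I := 𝓘(ℝ, EM)) (I' := 𝓘(ℝ, EM')) g (fun x => f x (g x)) _ h1 h2, h3, h4]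
  simp only [ContinuousLinearMap.comp_apply]
  rw [(tangentBundleCore 𝓘(ℝ, EM) M).coordChange_self _ _ h1,
    (tangentBundleCore 𝓘(ℝ, EM') M').coordChange_self _ _ h2]

theorem contDiffAt_rlog [FiniteDimensional ℝ 𝔨] {u : V → K} {z : V} (hu : SmoothAt V 𝔨 u z) :
    ContDiffAt ℝ ∞ (rlog V 𝔨 u) z := by
  rw [← contMDiffAt_iff_contDiffAt]
  refine contMDiffAt_tang_of_const (fun z z' => u z' * (u z)⁻¹) (fun z => z) z ?_ contMDiffAt_id
    (fun _ => rfl) (fun _ => by simp)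
  exact (hu.comp (z, z) contMDiffAt_snd).mul (hu.comp (z, z) contMDiffAt_fst).inv

end LogDeriv

/-! ### Infinitesimal actions -/

section Action

variable {V X : Type*} [NormedAddCommGroup V] [NormedSpace ℝ V] [TopologicalSpace X]
  [ChartedSpace V X] {𝔤 𝔥 G H : Type*}
  [NormedAddCommGroup 𝔤] [NormedSpace ℝ 𝔤] [NormedAddCommGroup 𝔥] [NormedSpace ℝ 𝔥]
  [Group G] [TopologicalSpace G] [ChartedSpace 𝔤 G] [LieGroup 𝓘(ℝ, 𝔤) ∞ G]
  [Group H] [TopologicalSpace H] [ChartedSpace 𝔥 H] [LieGroup 𝓘(ℝ, 𝔥) ∞ H]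

namespace LieCrossedModule

variable (C : LieCrossedModule 𝔤 𝔥 G H)

theorem mdAt_m (a : G) (Y : H) : MDAt 𝔥 𝔥 (fun X : H => C.m a X) Y :=
  MDifferentiableAt.comp (f := fun X : H => (a, X)) (g := fun z : G × H => C.m z.1 z.2) Y
    (C.smooth_m.mdifferentiableAt (by simp)) (mdifferentiableAt_const.prodMk mdifferentiableAt_id)

theorem mdAt_t (Y : H) : MDAt 𝔥 𝔤 (fun X : H => C.t X) Y :=
  C.smooth_t.mdifferentiableAt (by simp)

theorem mdot_mul (a b : G) : C.mdot (a * b) = (C.mdot a).comp (C.mdot b) := by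
  have h1 : MDAt 𝔥 𝔥 (fun X : H => C.m a X) (C.m b 1) := C.mdAt_m _ _
  have := tang_comp (f := fun X : H => C.m a X) (1 : H) h1 (C.mdAt_m b 1)
  rw [map_one] at this
  rw [mdot, map_mul]
  exact this

@[simp] theorem mdot_one : C.mdot 1 = .id ℝ 𝔥 := by
  have : (fun X : H => C.m 1 X) = fun X => X := by ext X; simp
  rw [mdot, this, tang_id]

theorem contMDiff_mdot : Smooth 𝔤 (𝔥 →L[ℝ] 𝔥) C.mdot := by
  intro a
  refine contMDiffAt_tang_of_const (fun (a : G) (X : H) => C.m a X) (fun _ => 1) a ?_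
    contMDiffAt_const (fun _ => rfl) (fun _ => by simp)
  exact C.smooth_m (a, 1)

theorem rlog_m (a : G) {u : X → H} {x : X} (hu : MDAt V 𝔥 u x) :
    rlog V 𝔥 (fun z => C.m a (u z)) x = (C.mdot a).comp (rlog V 𝔥 u x) :=
  rlog_hom (C.m a).toMonoidHom (C.mdAt_m a 1) hu

theorem rlog_t {u : X → H} {x : X} (hu : MDAt V 𝔥 u x) :
    rlog V 𝔤 (fun z => C.t (u z)) x = C.tdot.comp (rlog V 𝔥 u x) :=
  rlog_hom C.t (C.mdAt_t 1) hu

/-- Translating to the identity: `ṁ(u(z)) = ṁ(u(z) u(x)⁻¹) ∘ ṁ(u(x))`, and the first factor is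
differentiated at `1`, where `mhat` is defined. -/
theorem tang_mdot {u : X → G} {x : X} (hu : MDAt V 𝔤 u x) (v : V) :
    tang V (𝔥 →L[ℝ] 𝔥) (fun z => C.mdot (u z)) x v =
      (C.mhat (rlog V 𝔤 u x v)).comp (C.mdot (u x)) := by
  have e : (fun z => C.mdot (u z)) =
      fun z => (C.mdot (u z * (u x)⁻¹)).comp (C.mdot (u x)) := by
    ext1 z
    rw [← mdot_mul, inv_mul_cancel_right]
  set R : (𝔥 →L[ℝ] 𝔥) →L[ℝ] (𝔥 →L[ℝ] 𝔥) :=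
    (ContinuousLinearMap.compL ℝ 𝔥 𝔥 𝔥).flip (C.mdot (u x)) with hR
  have hd : ∀ a : G, MDAt 𝔤 (𝔥 →L[ℝ] 𝔥) C.mdot a :=
    fun a => C.contMDiff_mdot.mdifferentiableAt (by simp)
  have hu' : MDAt V 𝔤 (fun z => u z * (u x)⁻¹) x := hu.mul (.const _ _)
  have h1 : MDAt V (𝔥 →L[ℝ] 𝔥) (fun z => C.mdot (u z * (u x)⁻¹)) x := MDAt.comp x (hd _) hu'
  have h2 : MDAt (𝔥 →L[ℝ] 𝔥) (𝔥 →L[ℝ] 𝔥) R (C.mdot (u x * (u x)⁻¹)) :=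
    R.differentiableAt.mdifferentiableAt
  have h3 := tang_comp (f := R) x h2 h1
  have h4 : tang V (𝔥 →L[ℝ] 𝔥) (fun z => C.mdot (u z * (u x)⁻¹)) x =
      C.mhat.comp (rlog V 𝔤 u x) := by
    rw [tang_comp (f := C.mdot) x (hd _) hu', mul_inv_cancel]
    rfl
  rw [e]
  change tang V (𝔥 →L[ℝ] 𝔥) (fun z => R (C.mdot (u z * (u x)⁻¹))) x v = _
  rw [h3, h4, tang_eq_fderiv, R.fderiv]
  simp [hR]

end LieCrossedModule

variable (𝔤 G) in
/-- The crossed module of a Lie group acting on itself by conjugation. -/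
def conjModule : LieCrossedModule 𝔤 𝔤 G G where
  t := MonoidHom.id G
  m := MulAut.conj
  smooth_t := contMDiff_id
  smooth_m := (contMDiff_fst.mul contMDiff_snd).mul contMDiff_fst.inv
  equivariant a X := by simp
  peiffer X Y := by simp

/-- `Ad` is by definition the `mdot` of `conjModule`, so results on crossed modules specialize to
the adjoint action. -/
theorem Ad_mul (a b : G) : (Ad (a * b) : 𝔤 →L[ℝ] 𝔤) = (Ad a).comp (Ad b) :=
  (conjModule 𝔤 G).mdot_mul a b

@[simp] theorem Ad_one : (Ad (1 : G) : 𝔤 →L[ℝ] 𝔤) = .id ℝ 𝔤 := (conjModule 𝔤 G).mdot_one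

end Action

/-! ### The Maurer-Cartan equation -/

section OneForm

variable {N W F : Type*} [NormedAddCommGroup N] [NormedSpace ℝ N] [NormedAddCommGroup W]
  [NormedSpace ℝ W] [NormedAddCommGroup F] [NormedSpace ℝ F]

/-- The exterior derivative of `1`-forms is natural. -/
theorem fderiv_pullback_sub {R : W → W →L[ℝ] F} {y : N → W} {z : N}
    (hR : DifferentiableAt ℝ R (y z)) (hy : ContDiffAt ℝ ∞ y z) (v w : N) :
    fderiv ℝ (fun x => R (y x) (fderiv ℝ y x w)) z v -
        fderiv ℝ (fun x => R (y x) (fderiv ℝ y x v)) z w =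
      fderiv ℝ R (y z) (fderiv ℝ y z v) (fderiv ℝ y z w) -
        fderiv ℝ R (y z) (fderiv ℝ y z w) (fderiv ℝ y z v) := by
  have h1 : DifferentiableAt ℝ (fderiv ℝ y) z :=
    (hy.fderiv_right (m := 1) (by norm_cast)).differentiableAt (by simp)
  have h2 : DifferentiableAt ℝ y z := hy.differentiableAt (by simp)
  have h3 : ∀ w : N, fderiv ℝ (fun x => R (y x) (fderiv ℝ y x w)) z = fun v =>
      fderiv ℝ R (y z) (fderiv ℝ y z v) (fderiv ℝ y z w) + R (y z) (fderiv ℝ (fderiv ℝ y) z v w) := by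
    intro w
    have h4 : HasFDerivAt (fun x => R (y x) (fderiv ℝ y x w)) _ z :=
      (hR.hasFDerivAt.comp z h2.hasFDerivAt).clm_apply (h1.hasFDerivAt.clm_apply (hasFDerivAt_const w z))
    ext v
    rw [h4.fderiv]
    simp [add_comm]
  -- The terms containing the second derivative of `y` cancel by its symmetry.
  have h5 := hy.isSymmSndFDerivAt
    (by rw [minSmoothness_of_isRCLikeNormedField]; exact WithTop.coe_le_coe.2 (le_top : (2 : ℕ∞) ≤ ⊤)) v w
  rw [h3, h3]
  simp only
  rw [h5]
  abel

end OneForm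

/-! ### Product rules for the infinitesimal action -/

section ProductRule

variable {V : Type*} [NormedAddCommGroup V] [NormedSpace ℝ V] {𝔤 𝔥 G H : Type*}
  [NormedAddCommGroup 𝔤] [NormedSpace ℝ 𝔤] [NormedAddCommGroup 𝔥] [NormedSpace ℝ 𝔥]
  [Group G] [TopologicalSpace G] [ChartedSpace 𝔤 G] [LieGroup 𝓘(ℝ, 𝔤) ∞ G]
  [Group H] [TopologicalSpace H] [ChartedSpace 𝔥 H] [LieGroup 𝓘(ℝ, 𝔥) ∞ H]

namespace LieCrossedModule

variable (C : LieCrossedModule 𝔤 𝔥 G H) {u : V → G} {z : V} {f : V → 𝔥}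

theorem differentiableAt_mdot (hu : MDAt V 𝔤 u z) :
    DifferentiableAt ℝ (fun z => C.mdot (u z)) z :=
  mdifferentiableAt_iff_differentiableAt.1
    (MDAt.comp (f := C.mdot) z (C.contMDiff_mdot.mdifferentiableAt (by simp)) hu)

theorem fderiv_mdot (hu : MDAt V 𝔤 u z) (v : V) :
    fderiv ℝ (fun z => C.mdot (u z)) z v = (C.mhat (rlog V 𝔤 u z v)).comp (C.mdot (u z)) := by
  rw [← tang_eq_fderiv, C.tang_mdot hu]

theorem fderiv_mdot_apply (hu : MDAt V 𝔤 u z) (hf : DifferentiableAt ℝ f z) (v : V) :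
    fderiv ℝ (fun z => C.mdot (u z) (f z)) z v =
      C.mhat (rlog V 𝔤 u z v) (C.mdot (u z) (f z)) + C.mdot (u z) (fderiv ℝ f z v) := by
  rw [((C.differentiableAt_mdot hu).hasFDerivAt.clm_apply hf.hasFDerivAt).fderiv]
  simp [C.fderiv_mdot hu, add_comm]

theorem contDiffAt_mdot_apply (hu : SmoothAt V 𝔤 u z) (hf : ContDiffAt ℝ ∞ f z) :
    ContDiffAt ℝ ∞ (fun z => C.mdot (u z) (f z)) z := by
  have : ContMDiffAt 𝓘(ℝ, V) 𝓘(ℝ, 𝔥 →L[ℝ] 𝔥) ∞ (fun z => C.mdot (u z)) z :=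
    ContMDiffAt.comp z C.contMDiff_mdot.contMDiffAt hu
  exact (contMDiffAt_iff_contDiffAt.1 this).clm_apply hf

end LieCrossedModule

end ProductRule

/-! ### The Maurer-Cartan form in the preferred chart at the identity -/

section MaurerCartan

variable {𝔨 K : Type*} [NormedAddCommGroup 𝔨] [NormedSpace ℝ 𝔨] [FiniteDimensional ℝ 𝔨]
  [Group K] [TopologicalSpace K] [ChartedSpace 𝔨 K] [LieGroup 𝓘(ℝ, 𝔨) ∞ K]

variable (𝔨 K) in
/-- The preferred chart at the identity. -/
abbrev chartOne : PartialEquiv K 𝔨 := extChartAt 𝓘(ℝ, 𝔨) (1 : K)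

variable (𝔨 K) in
/-- The image of the identity under the preferred chart. -/
abbrev origin : 𝔨 := chartOne 𝔨 K 1

variable (𝔨 K) in
/-- The right-invariant Maurer-Cartan form in the preferred chart at the identity. -/
def mcForm : 𝔨 → 𝔨 →L[ℝ] 𝔨 := rlog 𝔨 𝔨 (chartOne 𝔨 K).symm

omit [FiniteDimensional ℝ 𝔨] in
theorem smoothAt_chartOne_symm {y : 𝔨} (hy : y ∈ (chartOne 𝔨 K).target) :
    SmoothAt 𝔨 𝔨 (chartOne 𝔨 K).symm y :=
  (contMDiffOn_extChartAt_symm 1 y hy).contMDiffAt ((isOpen_extChartAt_target 1).mem_nhds hy)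

omit [FiniteDimensional ℝ 𝔨] in
theorem smoothAt_chartOne {a : K} (ha : a ∈ (chartOne 𝔨 K).source) :
    SmoothAt 𝔨 𝔨 (chartOne 𝔨 K) a :=
  contMDiffAt_extChartAt' (by simpa using ha)

omit [FiniteDimensional ℝ 𝔨] [LieGroup 𝓘(ℝ, 𝔨) ∞ K] in
theorem origin_mem : origin 𝔨 K ∈ (chartOne 𝔨 K).target := mem_extChartAt_target 1

omit [FiniteDimensional ℝ 𝔨] [LieGroup 𝓘(ℝ, 𝔨) ∞ K] in
@[simp] theorem chartOne_symm_origin : (chartOne 𝔨 K).symm (origin 𝔨 K) = 1 :=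
  extChartAt_to_inv 1

/-- The tangent space at `1` is identified with `𝔨` through this very chart. -/
theorem tang_chartOne_symm : tang 𝔨 𝔨 (chartOne 𝔨 K).symm (origin 𝔨 K) = .id ℝ 𝔨 := by
  have : IsManifold 𝓘(ℝ, 𝔨) 1 K := IsManifold.of_le (n := ∞) (by simp)
  have := mfderivWithin_range_extChartAt_symm (I := 𝓘(ℝ, 𝔨)) (x := (1 : K))
  rwa [ModelWithCorners.range_eq_univ, mfderivWithin_univ] at this

theorem mcForm_eq {y : 𝔨} (hy : y ∈ (chartOne 𝔨 K).target) :
    mcForm 𝔨 K y = (tang 𝔨 𝔨 (fun a : K => a * ((chartOne 𝔨 K).symm y)⁻¹)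
      ((chartOne 𝔨 K).symm y)).comp (tang 𝔨 𝔨 (chartOne 𝔨 K).symm y) :=
  tang_comp (f := fun a : K => a * ((chartOne 𝔨 K).symm y)⁻¹) y ((MDAt.id' _).mul (.const _ _))
    (smoothAt_chartOne_symm hy).mdAt

@[simp] theorem mcForm_origin : mcForm 𝔨 K (origin 𝔨 K) = .id ℝ 𝔨 := by
  rw [mcForm_eq origin_mem, tang_chartOne_symm, chartOne_symm_origin]
  simp

theorem contDiffAt_mcForm {y : 𝔨} (hy : y ∈ (chartOne 𝔨 K).target) :
    ContDiffAt ℝ ∞ (mcForm 𝔨 K) y :=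
  contDiffAt_rlog (smoothAt_chartOne_symm hy)

variable {N : Type*} [NormedAddCommGroup N] [NormedSpace ℝ N]

theorem SmoothAt.eventually_mdAt {V W X Y : Type*} [NormedAddCommGroup V] [NormedSpace ℝ V]
    [NormedAddCommGroup W] [NormedSpace ℝ W] [TopologicalSpace X] [ChartedSpace V X]
    [TopologicalSpace Y] [ChartedSpace W Y] [IsManifold 𝓘(ℝ, V) ∞ X] [IsManifold 𝓘(ℝ, W) ∞ Y]
    {f : X → Y} {x : X} (h : SmoothAt V W f x) :
    ∀ᶠ x' in 𝓝 x, MDAt V W f x' := by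
  have : IsManifold 𝓘(ℝ, V) 1 X := IsManifold.of_le (n := ∞) (by simp)
  have : IsManifold 𝓘(ℝ, W) 1 Y := IsManifold.of_le (n := ∞) (by simp)
  have h1 : ContMDiffAt 𝓘(ℝ, V) 𝓘(ℝ, W) 1 f x := h.of_le (by simp)
  filter_upwards [(contMDiffAt_iff_contMDiffAt_nhds (by simp)).1 h1] with y hy
  exact hy.mdifferentiableAt (by simp)

/-- Near a point where `u = 1` the map stays in the chart domain, so `du u⁻¹` is the pull-back of
`mcForm` and becomes accessible to calculus on vector spaces. -/
theorem rlog_eventuallyEq {u : N → K} {z : N} (hu : SmoothAt N 𝔨 u z) (h1 : u z = 1) :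
    ∀ᶠ x in 𝓝 z, rlog N 𝔨 u x =
      (mcForm 𝔨 K (chartOne 𝔨 K (u x))).comp (fderiv ℝ (fun x => chartOne 𝔨 K (u x)) x) := by
  have hs : ∀ᶠ x in 𝓝 z, u x ∈ (chartOne 𝔨 K).source := by
    refine hu.continuousAt.eventually ?_
    rw [h1]
    exact extChartAt_source_mem_nhds 1
  filter_upwards [hs.eventually_nhds, hu.eventually_mdAt] with x hx hx'
  have e : u =ᶠ[𝓝 x] fun x => (chartOne 𝔨 K).symm (chartOne 𝔨 K (u x)) := by
    filter_upwards [hx] with w hw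
    exact ((chartOne 𝔨 K).left_inv hw).symm
  have h2 : MDAt N 𝔨 (fun x => chartOne 𝔨 K (u x)) x :=
    MDAt.comp x (smoothAt_chartOne hx.self_of_nhds).mdAt hx'
  have h3 := (smoothAt_chartOne_symm ((chartOne 𝔨 K).map_source hx.self_of_nhds)).mdAt
  rw [rlog_congr e, rlog_comp x h3 h2, tang_eq_fderiv]
  rfl

theorem smoothAt_chartOne_comp {u : N → K} {z : N} (hu : SmoothAt N 𝔨 u z) (h1 : u z = 1) :
    ContDiffAt ℝ ∞ (fun x => chartOne 𝔨 K (u x)) z := by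
  have : u z ∈ (chartOne 𝔨 K).source := by rw [h1]; exact mem_extChartAt_source 1
  exact contMDiffAt_iff_contDiffAt.1 ((smoothAt_chartOne this).comp z hu)

/-- The exterior derivative commutes with pull-back, and `mcForm` is the identity at the origin, so
the derivative of `u` in the chart may be replaced by its logarithmic derivative at `z`. It remains
to identify the exterior derivative of `mcForm` at one point. -/
theorem maurerCartan_aux {u : N → K} {z : N} (hu : SmoothAt N 𝔨 u z) (h1 : u z = 1) (v w : N) :
    fderiv ℝ (fun x => rlog N 𝔨 u x w) z v - fderiv ℝ (fun x => rlog N 𝔨 u x v) z w =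
      fderiv ℝ (mcForm 𝔨 K) (origin 𝔨 K) (rlog N 𝔨 u z v) (rlog N 𝔨 u z w) -
        fderiv ℝ (mcForm 𝔨 K) (origin 𝔨 K) (rlog N 𝔨 u z w) (rlog N 𝔨 u z v) := by
  have hy := smoothAt_chartOne_comp hu h1
  have he := rlog_eventuallyEq hu h1
  have h2 : ∀ w : N, (fun x => rlog N 𝔨 u x w) =ᶠ[𝓝 z] fun x =>
      mcForm 𝔨 K (chartOne 𝔨 K (u x)) (fderiv ℝ (fun x => chartOne 𝔨 K (u x)) x w) := fun w => by
    filter_upwards [he] with x hx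
    rw [hx]; rfl
  have h3 : rlog N 𝔨 u z = fderiv ℝ (fun x => chartOne 𝔨 K (u x)) z := by
    rw [he.self_of_nhds, h1, mcForm_origin]
    rfl
  have h4 : DifferentiableAt ℝ (mcForm 𝔨 K) (chartOne 𝔨 K (u z)) := by
    rw [h1]; exact (contDiffAt_mcForm origin_mem).differentiableAt (by simp)
  rw [(h2 w).fderiv_eq, (h2 v).fderiv_eq, 
    fderiv_pullback_sub (y := fun x => chartOne 𝔨 K (u x)) h4 hy, h3, h1]

/-- `maurerCartan_aux` is applied to the product map `(y₁, y₂) ↦ ψ(y₁) ψ(y₂)` in the directions `(v,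
0)` and `(0, w)`. Its logarithmic derivative is `mcForm(y₁) + Ad(ψ(y₁)) mcForm(y₂)`; only the factor
`Ad(ψ(y₁))` contributes, and its derivative in the direction `v` is the infinitesimal conjugation
action. -/
theorem fderiv_mcForm_sub (v w : 𝔨) :
    fderiv ℝ (mcForm 𝔨 K) (origin 𝔨 K) v w - fderiv ℝ (mcForm 𝔨 K) (origin 𝔨 K) w v =
      (conjModule 𝔨 K).mhat v w := by
  set e := origin 𝔨 K with he
  set ψ := (chartOne 𝔨 K).symm with hψ
  have hψe : ψ e = 1 := chartOne_symm_origin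
  have hme : mcForm 𝔨 K e = .id ℝ 𝔨 := mcForm_origin
  have hs : SmoothAt 𝔨 𝔨 ψ e := smoothAt_chartOne_symm origin_mem
  have s1 : SmoothAt (𝔨 × 𝔨) 𝔨 (fun z : 𝔨 × 𝔨 => ψ z.1) (e, e) :=
    ContMDiffAt.comp (e, e) hs contDiff_fst.contMDiff.contMDiffAt
  have s2 : SmoothAt (𝔨 × 𝔨) 𝔨 (fun z : 𝔨 × 𝔨 => ψ z.2) (e, e) :=
    ContMDiffAt.comp (e, e) hs contDiff_snd.contMDiff.contMDiffAt
  have hu : SmoothAt (𝔨 × 𝔨) 𝔨 (fun z : 𝔨 × 𝔨 => ψ z.1 * ψ z.2) (e, e) := s1.mul s2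
  have t1 : ∀ z : 𝔨 × 𝔨, MDAt (𝔨 × 𝔨) 𝔨 (Prod.fst : 𝔨 × 𝔨 → 𝔨) z := fun z =>
    differentiableAt_fst.mdifferentiableAt
  have t2 : ∀ z : 𝔨 × 𝔨, MDAt (𝔨 × 𝔨) 𝔨 (Prod.snd : 𝔨 × 𝔨 → 𝔨) z := fun z =>
    differentiableAt_snd.mdifferentiableAt
  have hd := hs.eventually_mdAt
  have hl : ∀ᶠ z : 𝔨 × 𝔨 in 𝓝 (e, e), ∀ x : 𝔨 × 𝔨,
      rlog (𝔨 × 𝔨) 𝔨 (fun z : 𝔨 × 𝔨 => ψ z.1 * ψ z.2) z x =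
        mcForm 𝔨 K z.1 x.1 + Ad (ψ z.1) (mcForm 𝔨 K z.2 x.2) := by
    filter_upwards [continuous_fst.continuousAt.eventually hd,
      continuous_snd.continuousAt.eventually hd] with z h1 h2 x
    rw [rlog_mul (MDAt.comp (f := ψ) z h1 (t1 z)) (MDAt.comp (f := ψ) z h2 (t2 z)),
      rlog_comp (u := ψ) z h1 (t1 z), rlog_comp (u := ψ) z h2 (t2 z), tang_eq_fderiv,
      tang_eq_fderiv, fderiv_fst, fderiv_snd]
    rfl
  have hz := hl.self_of_nhds
  have hR : DifferentiableAt ℝ (mcForm 𝔨 K) e :=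
    (contDiffAt_mcForm origin_mem).differentiableAt (by simp)
  have key := maurerCartan_aux hu (by simp [hψe]) ((v, 0) : 𝔨 × 𝔨) ((0, w) : 𝔨 × 𝔨)
  rw [hz, hz] at key
  simp only [← he, hme, hψe, Ad_one, map_zero, add_zero, zero_add,
    ContinuousLinearMap.id_apply] at key
  have e1 : (fun z => rlog (𝔨 × 𝔨) 𝔨 (fun z : 𝔨 × 𝔨 => ψ z.1 * ψ z.2) z (0, w)) =ᶠ[𝓝 (e, e)]
      fun z => (conjModule 𝔨 K).mdot (ψ z.1) (mcForm 𝔨 K z.2 w) := by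
    filter_upwards [hl] with z hz
    rw [hz, map_zero, zero_add]
    rfl
  have e2 : (fun z => rlog (𝔨 × 𝔨) 𝔨 (fun z : 𝔨 × 𝔨 => ψ z.1 * ψ z.2) z (v, 0)) =ᶠ[𝓝 (e, e)]
      fun z => mcForm 𝔨 K z.1 v := by
    filter_upwards [hl] with z hz
    rw [hz, map_zero, map_zero, add_zero]
  have f1 : HasFDerivAt (fun z : 𝔨 × 𝔨 => mcForm 𝔨 K z.1 v) _ (e, e) :=
    (hR.hasFDerivAt.comp (e, e) hasFDerivAt_fst).clm_apply (hasFDerivAt_const v _)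
  have f2 : HasFDerivAt (fun z : 𝔨 × 𝔨 => mcForm 𝔨 K z.2 w) _ (e, e) :=
    (hR.hasFDerivAt.comp (e, e) hasFDerivAt_snd).clm_apply (hasFDerivAt_const w _)
  rw [e1.fderiv_eq, e2.fderiv_eq, f1.fderiv,
    (conjModule 𝔨 K).fderiv_mdot_apply s1.mdAt f2.differentiableAt, f2.fderiv,
    rlog_comp (u := ψ) (e, e) hs.mdAt (t1 _), tang_eq_fderiv, fderiv_fst] at key
  have hz1 : rlog 𝔨 𝔨 ψ e = .id ℝ 𝔨 := mcForm_origin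
  simp [hψe, hz1, hme] at key
  exact key.symm

theorem conjModule_mhat_swap (v w : 𝔨) :
    (conjModule 𝔨 K).mhat w v = -(conjModule 𝔨 K).mhat v w := by
  rw [← fderiv_mcForm_sub, ← fderiv_mcForm_sub]
  abel

/-- A left-invariant vector field in the preferred chart at the identity. -/
def chartField (K : Type*) [Group K] [TopologicalSpace K] [ChartedSpace 𝔨 K] (X : 𝔨) : 𝔨 → 𝔨 :=
  VectorField.mpullback 𝓘(ℝ, 𝔨) 𝓘(ℝ, 𝔨) (chartOne 𝔨 K).symm
    (mulInvariantVectorField (I := 𝓘(ℝ, 𝔨)) (G := K) (X : GroupLieAlgebra 𝓘(ℝ, 𝔨) K))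

/-- The left-invariant field at `g` is `g X = (Ad(g) X) g`, so its right trivialization is `Ad(g)
X`. -/
theorem mcForm_chartField (X : 𝔨) {y : 𝔨} (hy : y ∈ (chartOne 𝔨 K).target) :
    mcForm 𝔨 K y (chartField K X y) = Ad ((chartOne 𝔨 K).symm y) X := by
  have : IsManifold 𝓘(ℝ, 𝔨) 1 K := IsManifold.of_le (n := ∞) (by simp)
  have hi := isInvertible_mfderivWithin_extChartAt_symm (I := 𝓘(ℝ, 𝔨)) (x := (1 : K)) hy
  rw [ModelWithCorners.range_eq_univ, mfderivWithin_univ] at hi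
  set g := (chartOne 𝔨 K).symm y
  have h1 : tang 𝔨 𝔨 (chartOne 𝔨 K).symm y (chartField K X y) = tang 𝔨 𝔨 (fun b : K => g * b) 1 X :=
    hi.self_apply_inverse _
  have h2 := tang_comp (V := 𝔨) (W := 𝔨) (U := 𝔨) (f := fun a : K => a * g⁻¹) (1 : K) (((MDAt.id' _).mul (.const _ _)))
    ((MDAt.const g (1 : K)).mul (.id' _))
  rw [mcForm_eq hy, ContinuousLinearMap.comp_apply, h1, Ad, h2, mul_one]
  rfl

/-- Solving `mcForm_chartField` for the field near the origin, which shows its differentiability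
there. -/
theorem chartField_eventuallyEq (X : 𝔨) :
    chartField K X =ᶠ[𝓝 (origin 𝔨 K)] fun y =>
      (mcForm 𝔨 K y).inverse (Ad ((chartOne 𝔨 K).symm y) X) := by
  have h1 : ∀ᶠ y in 𝓝 (origin 𝔨 K), (mcForm 𝔨 K y).IsInvertible := by
    have hc := (contDiffAt_mcForm (origin_mem (𝔨 := 𝔨) (K := K))).continuousAt
    refine hc.eventually (p := fun A => A.IsInvertible) ?_
    rw [mcForm_origin]
    exact (ContinuousLinearEquiv.isOpen : IsOpen (Set.range ((↑) : (𝔨 ≃L[ℝ] 𝔨) → 𝔨 →L[ℝ] 𝔨))).mem_nhds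
      ⟨.refl ℝ 𝔨, rfl⟩
  filter_upwards [h1, (isOpen_extChartAt_target (I := 𝓘(ℝ, 𝔨)) (1 : K)).mem_nhds origin_mem]
    with y hy hy'
  rw [← mcForm_chartField X hy', hy.inverse_apply_self]

/-- The bracket is computed in the chart from the derivatives of the two left-invariant fields.
Differentiating `mcForm_chartField` at the origin expresses these derivatives by `mhat` and the
derivative of `mcForm`; the antisymmetric combination has the contribution `2 m̂(X)Y` from the
former and `-m̂(X)Y` from the latter. -/
theorem lieBr_eq_mhat (X Y : 𝔨) : lieBr K X Y = (conjModule 𝔨 K).mhat X Y := by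
  have hc : CompleteSpace 𝔨 := FiniteDimensional.complete ℝ 𝔨
  have : IsManifold 𝓘(ℝ, 𝔨) 1 K := IsManifold.of_le (n := ∞) (by simp)
  set e := origin 𝔨 K with he
  have hs : SmoothAt 𝔨 𝔨 (chartOne 𝔨 K).symm e := smoothAt_chartOne_symm origin_mem
  have hR : DifferentiableAt ℝ (mcForm 𝔨 K) e :=
    (contDiffAt_mcForm origin_mem).differentiableAt (by simp)
  have hA : ∀ X : 𝔨, DifferentiableAt ℝ
      (fun y => (conjModule 𝔨 K).mdot ((chartOne 𝔨 K).symm y) X) e := fun X =>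
    ((conjModule 𝔨 K).differentiableAt_mdot hs.mdAt).clm_apply (differentiableAt_const _)
  have hd : ∀ X : 𝔨, DifferentiableAt ℝ (chartField K X) e := by
    intro X
    have h1 : (mcForm 𝔨 K e).IsInvertible := by rw [mcForm_origin]; exact ⟨.refl ℝ 𝔨, rfl⟩
    have h2 : ContDiffAt ℝ ∞ ContinuousLinearMap.inverse (mcForm 𝔨 K e) := h1.contDiffAt_map_inverse
    exact (((h2.differentiableAt (by simp)).comp e hR).clm_apply (hA X)).congr_of_eventuallyEq
      (chartField_eventuallyEq X)
  have hv : ∀ X : 𝔨, chartField K X e = X := fun X => by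
    have := mcForm_chartField (K := K) X origin_mem
    rwa [mcForm_origin, chartOne_symm_origin, Ad_one] at this
  have key : ∀ X v : 𝔨, fderiv ℝ (mcForm 𝔨 K) e v X + fderiv ℝ (chartField K X) e v =
      (conjModule 𝔨 K).mhat v X := by
    intro X v
    have e1 : (fun y => mcForm 𝔨 K y (chartField K X y)) =ᶠ[𝓝 e] fun y =>
        (conjModule 𝔨 K).mdot ((chartOne 𝔨 K).symm y) X := by
      filter_upwards [(isOpen_extChartAt_target (I := 𝓘(ℝ, 𝔨)) (1 : K)).mem_nhds origin_mem] with y hy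
      exact mcForm_chartField X hy
    have e2 := congrArg (fun A : 𝔨 →L[ℝ] 𝔨 => A v) e1.fderiv_eq
    rw [(hR.hasFDerivAt.clm_apply (hd X).hasFDerivAt).fderiv,
      (conjModule 𝔨 K).fderiv_mdot_apply hs.mdAt (differentiableAt_const X)] at e2
    have hz1 : rlog 𝔨 𝔨 (chartOne 𝔨 K).symm e = .id ℝ 𝔨 := mcForm_origin
    have hme : mcForm 𝔨 K e = .id ℝ 𝔨 := mcForm_origin
    have hψe : (chartOne 𝔨 K).symm e = 1 := chartOne_symm_origin
    rw [hz1, hψe, LieCrossedModule.mdot_one] at e2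
    simp only [add_apply, ContinuousLinearMap.comp_apply,
      ContinuousLinearMap.flip_apply, hme, hv, ContinuousLinearMap.id_apply, fderiv_fun_const,
      Pi.zero_apply, zero_apply, add_zero] at e2
    rw [← e2, add_comm]
  -- The bracket on the group is that of the fields in the chart, transported by the derivative of
  -- the chart at its own centre, which is the identity.
  have hb : lieBr K X Y = VectorField.lieBracket ℝ (chartField K X) (chartField K Y) e := by
    change VectorField.mlieBracketWithin _ _ _ _ _ = _
    rw [← VectorField.lieBracketWithin_univ, VectorField.mlieBracketWithin_apply, mfderiv_extChartAt_self]
    simp only [ModelWithCorners.range_eq_univ, Set.preimage_univ, Set.inter_univ,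
      VectorField.mpullbackWithin_univ]
    erw [ContinuousLinearMap.inverse_id]
    rfl
  rw [hb, VectorField.lieBracket_eq]
  simp only [hv]
  have k1 := key Y X
  have k2 := key X Y
  have k3 := fderiv_mcForm_sub (K := K) X Y
  have k4 := conjModule_mhat_swap (K := K) X Y
  rw [k4] at k2
  rw [eq_sub_of_add_eq' k1, eq_sub_of_add_eq' k2, ← k3]
  abel

theorem mhat_conjModule : (conjModule 𝔨 K).mhat = ad K := by
  ext X Y
  rw [ad_apply, lieBr_eq_mhat]

/-- The Maurer-Cartan equation. -/
theorem maurerCartan_eq {u : N → K} {z : N} (hu : SmoothAt N 𝔨 u z) (v w : N) :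
    fderiv ℝ (fun x => rlog N 𝔨 u x w) z v - fderiv ℝ (fun x => rlog N 𝔨 u x v) z w =
      ad K (rlog N 𝔨 u z v) (rlog N 𝔨 u z w) := by
  -- A right translation leaves `rlog` unchanged and reduces to the case `u(z) = 1`.
  have h1 : SmoothAt N 𝔨 (fun x => u x * (u z)⁻¹) z := hu.mul contMDiffAt_const
  have h2 := maurerCartan_aux h1 (by simp) v w
  simp only [rlog_mul_const] at h2
  rw [h2, fderiv_mcForm_sub, mhat_conjModule]

end MaurerCartan

/-! ### Differential equations on Lie groups -/

section GroupODE

variable {𝔨 K : Type*} [NormedAddCommGroup 𝔨] [NormedSpace ℝ 𝔨] [FiniteDimensional ℝ 𝔨]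
  [Group K] [TopologicalSpace K] [ChartedSpace 𝔨 K] [LieGroup 𝓘(ℝ, 𝔨) ∞ K]

/-- `u` solves `u' u⁻¹ = b` on the set `J`. -/
def SolvesOn (b : ℝ → 𝔨) (u : ℝ → K) (J : Set ℝ) : Prop :=
  ∀ x ∈ J, MDAt ℝ 𝔨 u x ∧ rightLogDeriv u x = b x

theorem rightLogDeriv_eq (u : ℝ → K) (x : ℝ) :
    (rightLogDeriv u x : 𝔨) = rlog ℝ 𝔨 u x 1 := rfl

theorem tang_eq_rlog {V X : Type*} [NormedAddCommGroup V] [NormedSpace ℝ V] [TopologicalSpace X]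
    [ChartedSpace V X] {u : X → K} {x : X} (hu : MDAt V 𝔨 u x) :
    tang V 𝔨 u x = (tang 𝔨 𝔨 (fun a : K => a * u x) 1).comp (rlog V 𝔨 u x) := by
  have h1 : MDAt V 𝔨 (fun z => u z * (u x)⁻¹) x := hu.mul (.const _ _)
  have h2 : MDAt 𝔨 𝔨 (fun a : K => a * u x) (u x * (u x)⁻¹) := (MDAt.id' _).mul (.const _ _)
  have := tang_comp (f := fun a : K => a * u x) x h2 h1
  simp only [inv_mul_cancel_right, mul_inv_cancel] at this
  exact this

/-- After a right translation the curve lies in the chart at the identity, where it has zero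
derivative on a ball. -/
theorem eventually_eq_of_rlog_eq_zero {u : ℝ → K} {x : ℝ}
    (hu : ∀ᶠ y in 𝓝 x, MDAt ℝ 𝔨 u y ∧ rlog ℝ 𝔨 u y = 0) : ∀ᶠ y in 𝓝 x, u y = u x := by
  set q : ℝ → K := fun y => u y * (u x)⁻¹ with hq
  have hq1 : q x = 1 := by simp [hq]
  have hqd : ∀ᶠ y in 𝓝 x, MDAt ℝ 𝔨 q y ∧ tang ℝ 𝔨 q y = 0 := by
    filter_upwards [hu] with y hy
    have h1 : MDAt ℝ 𝔨 q y := hy.1.mul (.const _ _)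
    refine ⟨h1, ?_⟩
    rw [tang_eq_rlog h1, rlog_mul_const, hy.2, ContinuousLinearMap.comp_zero]
  have hs : ∀ᶠ y in 𝓝 x, q y ∈ (chartOne 𝔨 K).source := by
    have : ContinuousAt q x := hqd.self_of_nhds.1.continuousAt
    refine this.eventually ?_
    rw [hq1]
    exact extChartAt_source_mem_nhds 1
  obtain ⟨r, hr, H⟩ := Metric.eventually_nhds_iff_ball.1 (hqd.and hs)
  have hd : ∀ y ∈ Metric.ball x r, DifferentiableAt ℝ (fun y => chartOne 𝔨 K (q y)) y ∧
      fderiv ℝ (fun y => chartOne 𝔨 K (q y)) y = 0 := by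
    intro y hy
    have h1 := (smoothAt_chartOne (H y hy).2).mdAt
    have h2 := (H y hy).1
    refine ⟨mdifferentiableAt_iff_differentiableAt.1 (MDAt.comp y h1 h2.1), ?_⟩
    rw [← tang_eq_fderiv, tang_comp (f := chartOne 𝔨 K) y h1 h2.1, h2.2,
      ContinuousLinearMap.comp_zero]
  filter_upwards [Metric.ball_mem_nhds x hr] with y hy
  have h1 := Metric.isOpen_ball.is_const_of_fderiv_eq_zero (convex_ball x r).isPreconnected
    (fun y hy => (hd y hy).1.differentiableWithinAt) (fun y hy => (hd y hy).2) hy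
    (Metric.mem_ball_self hr)
  have h2 := (chartOne 𝔨 K).injOn (H y hy).2 (H x (Metric.mem_ball_self hr)).2 h1
  exact mul_right_cancel h2

theorem eq_of_rlog_eq_zero {u : ℝ → K} {J : Set ℝ} (hJ : IsOpen J) (hJ' : IsPreconnected J)
    (hu : ∀ y ∈ J, MDAt ℝ 𝔨 u y ∧ rlog ℝ 𝔨 u y = 0) {x y : ℝ} (hx : x ∈ J) (hy : y ∈ J) :
    u x = u y := by
  refine hJ'.induction₂ (fun x y => u x = u y) (fun x hx => ?_) ?_ ?_ hx hy
  · filter_upwards [mem_nhdsWithin_of_mem_nhds (eventually_eq_of_rlog_eq_zero (𝔨 := 𝔨)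
      ((hJ.eventually_mem hx).mono hu))] with y hy
    exact hy.symm
  · intro x y z _ _ _ h1 h2
    exact h1.trans h2
  · intro x y _ _ h
    exact h.symm

/-- For two solutions the logarithmic derivative of `u⁻¹ w` vanishes, so this product is constant on
the connected set `J`. -/
theorem SolvesOn.eqOn {b : ℝ → 𝔨} {u w : ℝ → K} {J : Set ℝ} (hJ : IsOpen J) (hJ' : IsPreconnected J)
    (hu : SolvesOn b u J) (hw : SolvesOn b w J) {x y : ℝ} (hx : x ∈ J) (hy : y ∈ J)
    (h : u x = w x) : u y = w y := by
  have h1 : ∀ y ∈ J, MDAt ℝ 𝔨 (fun y => (u y)⁻¹ * w y) y ∧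
      rlog ℝ 𝔨 (fun y => (u y)⁻¹ * w y) y = 0 := by
    intro y hy
    have h1 := (hu y hy).1
    have h2 := (hw y hy).1
    refine ⟨h1.inv.mul h2, ?_⟩
    rw [rlog_mul h1.inv h2, rlog_inv h1]
    ext
    have h3 := (hu y hy).2
    have h4 := (hw y hy).2
    rw [rightLogDeriv_eq] at h3 h4
    simp [h3, h4]
  have h2 := eq_of_rlog_eq_zero hJ hJ' h1 hx hy
  rw [h, inv_mul_cancel] at h2
  exact inv_mul_eq_one.1 h2.symm

theorem SolvesOn.mul_const {b : ℝ → 𝔨} {u : ℝ → K} {J : Set ℝ} (hu : SolvesOn b u J) (c : K) :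
    SolvesOn b (fun x => u x * c) J := fun x hx =>
  ⟨(hu x hx).1.mul (.const _ _), by
    rw [rightLogDeriv_eq, rlog_mul_const, ← rightLogDeriv_eq, (hu x hx).2]⟩

theorem rightLogDeriv_congr {u w : ℝ → K} {x : ℝ} (h : u =ᶠ[𝓝 x] w) :
    (rightLogDeriv u x : 𝔨) = rightLogDeriv w x := by
  rw [rightLogDeriv_eq, rightLogDeriv_eq, rlog_congr h]

theorem rightLogDeriv_comp {u : ℝ → K} {h : ℝ → ℝ} {x h' : ℝ} (hu : MDAt ℝ 𝔨 u (h x))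
    (hh : HasDerivAt h h' x) :
    MDAt ℝ 𝔨 (fun x => u (h x)) x ∧
      (rightLogDeriv (fun x => u (h x)) x : 𝔨) = h' • rightLogDeriv u (h x) := by
  have h1 : MDAt ℝ ℝ h x := hh.differentiableAt.mdifferentiableAt
  refine ⟨MDAt.comp x hu h1, ?_⟩
  rw [rightLogDeriv_eq, rightLogDeriv_eq, rlog_comp x hu h1, ContinuousLinearMap.comp_apply,
    tang_eq_fderiv]
  have : fderiv ℝ h x 1 = h' • 1 := by
    rw [fderiv_apply_one_eq_deriv, hh.deriv, smul_eq_mul, mul_one]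
  rw [this, map_smul]

variable {S : Type} [NormedAddCommGroup S] [NormedSpace ℝ S]

/-- A short time solution of `u' u⁻¹ = b` depending smoothly on parameters. -/
theorem exists_local_solution [CompleteSpace S] (b : ℝ × S → 𝔨) (hb : ContDiff ℝ ∞ b) (c₀ : ℝ)
    (s₀ : S) :
    ∃ Z : ℝ × ℝ × S → ℝ → K, (∀ τ, SmoothAt (ℝ × ℝ × S) 𝔨 (fun q => Z q τ) (0, c₀, s₀)) ∧
      ∀ᶠ q in 𝓝 ((0, c₀, s₀) : ℝ × ℝ × S), Z q 0 = 1 ∧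
        SolvesOn (fun τ => q.1 • b (q.2.1 + q.1 * τ, q.2.2)) (Z q) (Set.Ioo (-1) 1) := by
  have hc : CompleteSpace 𝔨 := FiniteDimensional.complete ℝ 𝔨
  set e := origin 𝔨 K with he
  have h1 : ∀ᶠ y in 𝓝 e, y ∈ (chartOne 𝔨 K).target ∧ (mcForm 𝔨 K y).IsInvertible := by
    refine ((isOpen_extChartAt_target (I := 𝓘(ℝ, 𝔨)) (1 : K)).eventually_mem origin_mem).and ?_
    refine (contDiffAt_mcForm (origin_mem (𝔨 := 𝔨) (K := K))).continuousAt.eventually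
      (p := fun A => A.IsInvertible) ?_
    rw [mcForm_origin]
    exact (ContinuousLinearEquiv.isOpen : IsOpen (Set.range ((↑) : (𝔨 ≃L[ℝ] 𝔨) → 𝔨 →L[ℝ] 𝔨))).mem_nhds
      ⟨.refl ℝ 𝔨, rfl⟩
  obtain ⟨r, hr, H⟩ := Metric.eventually_nhds_iff_ball.1 h1
  -- In the chart the equation is `y' = mcForm(y)⁻¹ b`. The cut-off makes the right-hand side
  -- globally smooth: it is supported inside the ball of radius `r`, where `mcForm` is invertible,
  -- and equals `1` up to radius `r / 3`.
  let χ : ContDiffBump e := ⟨r / 3, r / 2, by positivity, by linarith⟩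
  have hf : ContDiff ℝ ∞ (fun z : ℝ × S × 𝔨 => χ z.2.2 • (mcForm 𝔨 K z.2.2).inverse (b (z.1, z.2.1))) := by
    rw [contDiff_iff_contDiffAt]
    rintro ⟨x, s, y⟩
    by_cases hy : y ∈ Metric.ball e r
    · have g1 : ContDiffAt ℝ ∞ (fun z : ℝ × S × 𝔨 => mcForm 𝔨 K z.2.2) (x, s, y) :=
        (contDiffAt_mcForm (H y hy).1).comp (x, s, y) (contDiffAt_snd.comp _ contDiffAt_snd)
      have g2 : ContDiffAt ℝ ∞ (fun z : ℝ × S × 𝔨 => (mcForm 𝔨 K z.2.2).inverse) (x, s, y) :=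
        ContDiffAt.comp (g := ContinuousLinearMap.inverse) (x, s, y)
          (H y hy).2.contDiffAt_map_inverse g1
      have g3 : ContDiff ℝ ∞ (fun z : ℝ × S × 𝔨 => b (z.1, z.2.1)) :=
        hb.comp (contDiff_fst.prodMk (contDiff_fst.comp contDiff_snd))
      have g4 : ContDiff ℝ ∞ (fun z : ℝ × S × 𝔨 => χ z.2.2) :=
        χ.contDiff.comp (contDiff_snd.comp contDiff_snd)
      exact g4.contDiffAt.smul (g2.clm_apply g3.contDiffAt)
    · have hy' : y ∈ (Metric.closedBall e (r / 2))ᶜ := fun h => hy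
        (Metric.closedBall_subset_ball (by linarith) h)
      have g1 : ∀ᶠ z : ℝ × S × 𝔨 in 𝓝 (x, s, y), z.2.2 ∈ (Metric.closedBall e (r / 2))ᶜ :=
        (continuous_snd.comp continuous_snd).continuousAt.eventually
          (Metric.isClosed_closedBall.isOpen_compl.mem_nhds hy')
      refine (contDiffAt_const (c := (0 : 𝔨))).congr_of_eventuallyEq ?_
      filter_upwards [g1] with z hz
      have : χ z.2.2 = 0 := χ.zero_of_le_dist (by
        have : ¬ dist z.2.2 e ≤ r / 2 := hz
        exact (not_le.1 this).le)
      rw [this, zero_smul]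
  obtain ⟨Ψ, hΨ, hΨ0, hev⟩ := exists_local_flow _ hf e c₀ s₀
  refine ⟨fun q τ => (chartOne 𝔨 K).symm (Ψ q (toUnitTime τ)), fun τ => ?_, ?_⟩
  · have g1 : ContDiffAt ℝ ∞ (fun q => Ψ q (toUnitTime τ)) (0, c₀, s₀) :=
      (contDiff_evalTime (toUnitTime τ)).contDiffAt.comp _ hΨ
    have g2 : SmoothAt 𝔨 𝔨 (chartOne 𝔨 K).symm (Ψ (0, c₀, s₀) (toUnitTime τ)) := by
      rw [hΨ0]; exact smoothAt_chartOne_symm origin_mem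
    exact ContMDiffAt.comp (0, c₀, s₀) g2 g1.contMDiffAt
  -- For parameters near `δ = 0` the solution stays where the cut-off is `1`, so it solves the
  -- original equation.
  · have hn : ∀ᶠ q in 𝓝 ((0, c₀, s₀) : ℝ × ℝ × S), Ψ q ∈ Metric.ball (ContinuousMap.const _ e) (r / 3) := by
      refine hΨ.continuousAt.eventually ?_
      rw [hΨ0]
      exact Metric.ball_mem_nhds _ (by positivity)
    filter_upwards [hn, hev] with q hq hq'
    refine ⟨by rw [hq'.1]; exact chartOne_symm_origin, fun τ hτ => ?_⟩
    have k1 : dist (Ψ q (toUnitTime τ)) e < r / 3 :=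
      (ContinuousMap.dist_apply_le_dist (toUnitTime τ)).trans_lt hq
    have k2 := H (Ψ q (toUnitTime τ)) (Metric.mem_ball.2 (by linarith))
    have k3 := (smoothAt_chartOne_symm k2.1).mdAt
    have k4 := hq'.2 τ hτ
    have k5 : MDAt ℝ 𝔨 (fun τ => Ψ q (toUnitTime τ)) τ := k4.differentiableAt.mdifferentiableAt
    refine ⟨MDAt.comp τ k3 k5, ?_⟩
    rw [rightLogDeriv_eq, rlog_comp (u := (chartOne 𝔨 K).symm) τ k3 k5, tang_eq_fderiv,
      ContinuousLinearMap.comp_apply, fderiv_apply_one_eq_deriv, k4.deriv]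
    have k6 : χ (Ψ q (toUnitTime τ)) = 1 := χ.one_of_mem_closedBall (Metric.mem_closedBall.2 k1.le)
    rw [k6, one_smul, map_smul]
    change q.1 • mcForm 𝔨 K _ _ = _
    rw [k2.2.self_apply_inverse]

/-- The relation "`c` and `d` lie in a common interval of existence" holds locally, is symmetric,
and is transitive by gluing. Since `ℝ` is connected it holds for all pairs. No bound on the
existence time is needed, because right translates of solutions are solutions. -/
theorem exists_solution_containing (b : ℝ → 𝔨) (hb : ContDiff ℝ ∞ b) (c d : ℝ) :
    ∃ J : Set ℝ, IsOpen J ∧ IsPreconnected J ∧ c ∈ J ∧ d ∈ J ∧ ∃ u : ℝ → K, SolvesOn b u J := by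
  refine isPreconnected_univ.induction₂ (fun c d => ∃ J : Set ℝ, IsOpen J ∧ IsPreconnected J ∧
    c ∈ J ∧ d ∈ J ∧ ∃ u : ℝ → K, SolvesOn b u J) (fun c _ => ?_) ?_ ?_
    (Set.mem_univ c) (Set.mem_univ d)
  · rw [nhdsWithin_univ]
    obtain ⟨Z, -, hZ⟩ := exists_local_solution (K := K) (S := ℝ) (fun z => b z.1)
      (hb.comp contDiff_fst) c 0
    have h1 : Continuous fun δ : ℝ => ((δ, c, 0) : ℝ × ℝ × ℝ) := by fun_prop
    obtain ⟨r, hr, H⟩ := Metric.eventually_nhds_iff_ball.1 (h1.continuousAt.eventually hZ)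
    -- A time scale different from `0` is needed to undo the rescaling to `[-1, 1]`.
    have hδ := (H (r / 2) (by simp [abs_of_pos, hr])).2
    have hs : SolvesOn b (fun x => Z (r / 2, c, 0) ((x - c) / (r / 2)))
        (Set.Ioo (c - r / 2) (c + r / 2)) := by
      intro x hx
      have h2 : (x - c) / (r / 2) ∈ Set.Ioo (-1 : ℝ) 1 := by
        rw [Set.mem_Ioo, lt_div_iff₀ (by positivity), div_lt_iff₀ (by positivity)]
        constructor <;> linarith [hx.1, hx.2]
      have h3 : HasDerivAt (fun x => (x - c) / (r / 2)) (1 / (r / 2)) x :=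
        ((hasDerivAt_id x).sub_const c).div_const _
      have h4 := rightLogDeriv_comp (h := fun x => (x - c) / (r / 2)) (hδ _ h2).1 h3
      refine ⟨h4.1, ?_⟩
      rw [h4.2, (hδ _ h2).2]
      simp only
      rw [smul_smul, one_div_mul_cancel (by positivity), one_smul, mul_div_cancel₀ _ (by positivity)]
      congr 1
      ring
    filter_upwards [Metric.ball_mem_nhds c (half_pos hr)] with d hd
    refine ⟨_, isOpen_Ioo, isPreconnected_Ioo, by constructor <;> linarith, ?_, _, hs⟩
    rw [Metric.mem_ball, Real.dist_eq, abs_lt] at hd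
    constructor <;> linarith
  · rintro c d e - - - ⟨J, hJ, hJ', hc, hd, u, hu⟩ ⟨J₂, hJ₂, hJ₂', hd', he, w, hw⟩
    refine ⟨J ∪ J₂, hJ.union hJ₂, hJ'.union d hd hd' hJ₂', Or.inl hc, Or.inr he, ?_⟩
    classical
    -- The second solution is right translated so as to agree with the first at the common point
    -- `d`; by uniqueness they agree on the whole overlap.
    set w' : ℝ → K := fun x => w x * ((w d)⁻¹ * u d) with hw'
    have h1 : SolvesOn b w' J₂ := hw.mul_const _
    have hI : IsPreconnected (J ∩ J₂) :=
      (hJ'.ordConnected.inter hJ₂'.ordConnected).isPreconnected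
    have h2 : ∀ x ∈ J, x ∈ J₂ → u x = w' x := fun x hx hx' =>
      SolvesOn.eqOn (hJ.inter hJ₂) hI (fun y hy => hu y hy.1) (fun y hy => h1 y hy.2)
        ⟨hd, hd'⟩ ⟨hx, hx'⟩ (by simp [hw'])
    refine ⟨fun x => if x ∈ J then u x else w' x, fun x hx => ?_⟩
    rcases hx with hx | hx
    · have e1 : (fun x => if x ∈ J then u x else w' x) =ᶠ[𝓝 x] u := by
        filter_upwards [hJ.mem_nhds hx] with y hy
        exact if_pos hy
      exact ⟨(hu x hx).1.congr_of_eventuallyEq e1, by rw [rightLogDeriv_congr e1, (hu x hx).2]⟩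
    · have e1 : (fun x => if x ∈ J then u x else w' x) =ᶠ[𝓝 x] w' := by
        filter_upwards [hJ₂.mem_nhds hx] with y hy
        split_ifs with hy'
        · exact h2 y hy' hy
        · rfl
      exact ⟨(h1 x hx).1.congr_of_eventuallyEq e1, by rw [rightLogDeriv_congr e1, (h1 x hx).2]⟩
  · rintro c d - - ⟨J, hJ, hJ', hc, hd, u, hu⟩
    exact ⟨J, hJ, hJ', hd, hc, u, hu⟩

theorem exists_solution (b : ℝ → 𝔨) (hb : ContDiff ℝ ∞ b) (x₀ : ℝ) :
    ∃ u : ℝ → K, u x₀ = 1 ∧ SolvesOn b u Set.univ := by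
  choose J hJ hJ' hx₀ hd u hu using exists_solution_containing (K := K) b hb x₀
  -- Normalized to `1` at `x₀`, the solutions on the various intervals agree on overlaps, so the
  -- diagonal `x ↦ n x x` coincides with `n x` near each `x`.
  set n : ℝ → ℝ → K := fun d x => u d x * (u d x₀)⁻¹ with hn
  have h1 : ∀ d, SolvesOn b (n d) (J d) := fun d => (hu d).mul_const _
  have h2 : ∀ d, n d x₀ = 1 := fun d => by simp [hn]
  have h3 : ∀ d, ∀ y ∈ J d, n y y = n d y := fun d y hy =>
    SolvesOn.eqOn ((hJ y).inter (hJ d))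
      ((hJ' y).ordConnected.inter (hJ' d).ordConnected).isPreconnected
      (fun z hz => h1 y z hz.1) (fun z hz => h1 d z hz.2)
      ⟨hx₀ y, hx₀ d⟩ ⟨hd y, hy⟩ (by rw [h2, h2])
  refine ⟨fun x => n x x, h2 x₀, fun x _ => ?_⟩
  have e1 : (fun x => n x x) =ᶠ[𝓝 x] n x := by
    filter_upwards [(hJ x).mem_nhds (hd x)] with y hy
    exact h3 x y hy
  exact ⟨(h1 x x (hd x)).1.congr_of_eventuallyEq e1, by rw [rightLogDeriv_congr e1, (h1 x x (hd x)).2]⟩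

theorem SolvesOn.eq {b : ℝ → 𝔨} {u w : ℝ → K} (hu : SolvesOn b u Set.univ)
    (hw : SolvesOn b w Set.univ) {x : ℝ} (h : u x = w x) : u = w :=
  funext fun y => SolvesOn.eqOn isOpen_univ isPreconnected_univ hu hw (Set.mem_univ x)
    (Set.mem_univ y) h

/-- Solutions of `u' u⁻¹ = b` exist globally and depend smoothly on parameters. -/
theorem exists_smooth_solution [CompleteSpace S] (b : ℝ × S → 𝔨) (hb : ContDiff ℝ ∞ b) (x₀ : ℝ) :
    ∃ u : ℝ × S → K, Smooth (ℝ × S) 𝔨 u ∧ (∀ s, u (x₀, s) = 1) ∧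
      ∀ s, SolvesOn (fun x => b (x, s)) (fun x => u (x, s)) Set.univ := by
  have hbs : ∀ s, ContDiff ℝ ∞ fun x => b (x, s) := fun s =>
    hb.comp (contDiff_id.prodMk contDiff_const)
  choose U hU1 hU using fun (c : ℝ) (s : S) => exists_solution (K := K) (fun x => b (x, s)) (hbs s) c
  -- `T (e, c, s)` is the evolution from time `c` to time `e`. Its cocycle property propagates
  -- smoothness from the diagonal `e = c` to all times.
  set T : ℝ × ℝ × S → K := fun q => U q.2.1 q.2.2 q.1 with hT
  have hmul : ∀ e d c s, T (e, c, s) = T (e, d, s) * T (d, c, s) := by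
    intro e d c s
    exact congrFun (SolvesOn.eq (hU c s) ((hU d s).mul_const (U c s d)) (x := d)
      (by simp [hU1])) e
  have hone : ∀ c s, T (c, c, s) = 1 := fun c s => hU1 c s
  have hinv : ∀ d c s, T (d, c, s) = (T (c, d, s))⁻¹ := fun d c s => by
    rw [eq_inv_iff_mul_eq_one, ← hmul, hone]
  have hloc : ∀ c s, SmoothAt (ℝ × ℝ × S) 𝔨 T (c, c, s) := by
    intro c₀ s₀
    obtain ⟨Z, hZs, hZ⟩ := exists_local_solution (K := K) b hb c₀ s₀
    -- The short time solution with centre `c` and time scale `2 (e - c)` is evaluated at `τ = 1 /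
    -- 2`, inside `(-1, 1)`, and then computes `T (e, c, s)`.
    set p : ℝ × ℝ × S → ℝ × ℝ × S := fun q => (2 * (q.1 - q.2.1), q.2.1, q.2.2) with hp
    have hps : ContDiff ℝ ∞ p := by
      refine (contDiff_const.mul (contDiff_fst.sub (contDiff_fst.comp contDiff_snd))).prodMk
        contDiff_snd
    have hp0 : p (c₀, c₀, s₀) = (0, c₀, s₀) := by simp [hp]
    have h1 : SmoothAt (ℝ × ℝ × S) 𝔨 (fun q => Z (p q) (1 / 2)) (c₀, c₀, s₀) := by
      refine ContMDiffAt.comp (c₀, c₀, s₀) (g := fun q => Z q (1 / 2)) ?_ hps.contMDiff.contMDiffAt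
      rw [hp0]
      exact hZs _
    refine h1.congr_of_eventuallyEq ?_
    have h2 : ∀ᶠ q in 𝓝 ((c₀, c₀, s₀) : ℝ × ℝ × S), _ :=
      hps.continuous.continuousAt.eventually (by rw [hp0]; exact hZ)
    filter_upwards [h2] with q hq
    have h3 : SolvesOn (fun τ => (p q).1 • b ((p q).2.1 + (p q).1 * τ, (p q).2.2))
        (fun τ => U q.2.1 q.2.2 (q.2.1 + (p q).1 * τ)) (Set.Ioo (-1) 1) := by
      intro τ _
      have h5 : HasDerivAt (fun τ => q.2.1 + (p q).1 * τ) (p q).1 τ := by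
        simpa using ((hasDerivAt_id τ).const_mul (p q).1).const_add q.2.1
      have h4 := rightLogDeriv_comp (h := fun τ => q.2.1 + (p q).1 * τ)
        (hU q.2.1 q.2.2 _ (Set.mem_univ _)).1 h5
      exact ⟨h4.1, by rw [h4.2, (hU q.2.1 q.2.2 _ (Set.mem_univ _)).2]⟩
    have h4 := SolvesOn.eqOn isOpen_Ioo isPreconnected_Ioo h3 hq.2 (x := 0) (y := 1 / 2)
      (by norm_num) (by norm_num) (by simp [hU1, hq.1])
    rw [← h4]
    simp only [hT, hp]
    congr 1
    ring
  -- Finite orders are treated separately, since being `C^n` at a point spreads to a neighbourhood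
  -- for finite `n`; this provides the local step of the connectedness argument.
  have hall : ∀ (n : ℕ) (s : S) (c d : ℝ),
      ContMDiffAt 𝓘(ℝ, ℝ × ℝ × S) 𝓘(ℝ, 𝔨) n T (d, c, s) := by
    intro n s c d
    have : IsManifold 𝓘(ℝ, 𝔨) n K := IsManifold.of_le (n := ∞) (by exact_mod_cast le_top)
    have : LieGroup 𝓘(ℝ, 𝔨) n K := LieGroup.of_le (n := ∞) (by exact_mod_cast le_top)
    refine isPreconnected_univ.induction₂
      (fun c d => ContMDiffAt 𝓘(ℝ, ℝ × ℝ × S) 𝓘(ℝ, 𝔨) n T (d, c, s)) (fun c _ => ?_) ?_ ?_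
      (Set.mem_univ c) (Set.mem_univ d)
    · rw [nhdsWithin_univ]
      have h1 : ContMDiffAt 𝓘(ℝ, ℝ × ℝ × S) 𝓘(ℝ, 𝔨) n T (c, c, s) :=
        (hloc c s).of_le (by exact_mod_cast le_top)
      have h2 := (contMDiffAt_iff_contMDiffAt_nhds (by simp)).1 h1
      have h3 : Continuous fun d : ℝ => ((d, c, s) : ℝ × ℝ × S) := by fun_prop
      exact h3.continuousAt.eventually h2
    · intro c d e _ _ _ h1 h2
      have e1 : T = fun q => T (q.1, d, q.2.2) * T (d, q.2.1, q.2.2) := by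
        ext q; exact hmul _ _ _ _
      rw [e1]
      have g1 : ContDiff ℝ n fun q : ℝ × ℝ × S => (q.1, d, q.2.2) :=
        contDiff_fst.prodMk (contDiff_const.prodMk (contDiff_snd.comp contDiff_snd))
      have g2 : ContDiff ℝ n fun q : ℝ × ℝ × S => (d, q.2.1, q.2.2) :=
        contDiff_const.prodMk contDiff_snd
      exact (ContMDiffAt.comp (g := T) (e, c, s) h2 g1.contMDiff.contMDiffAt).mul
        (ContMDiffAt.comp (g := T) (e, c, s) h1 g2.contMDiff.contMDiffAt)
    · intro c d _ _ h1
      have e1 : T = fun q => (T (q.2.1, q.1, q.2.2))⁻¹ := by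
        ext q; exact hinv _ _ _
      rw [e1]
      have g1 : ContDiff ℝ n fun q : ℝ × ℝ × S => (q.2.1, q.1, q.2.2) :=
        (contDiff_fst.comp contDiff_snd).prodMk
          (contDiff_fst.prodMk (contDiff_snd.comp contDiff_snd))
      exact (ContMDiffAt.comp (g := T) (c, d, s) h1 g1.contMDiff.contMDiffAt).inv
  refine ⟨fun z => T (z.1, x₀, z.2), ?_, fun s => hone x₀ s, fun s => hU x₀ s⟩
  have h1 : Smooth (ℝ × ℝ × S) 𝔨 T := fun q => contMDiffAt_infty.2 fun n => hall n q.2.2 q.2.1 q.1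
  have g1 : ContDiff ℝ ∞ fun z : ℝ × S => (z.1, x₀, z.2) :=
    contDiff_fst.prodMk (contDiff_const.prodMk contDiff_snd)
  exact h1.comp g1.contMDiff

theorem smooth_of_solvesOn {b : ℝ → 𝔨} (hb : ContDiff ℝ ∞ b) {u : ℝ → K}
    (hu : SolvesOn b u Set.univ) : Smooth ℝ 𝔨 u := by
  obtain ⟨w, hw, hw1, hws⟩ := exists_smooth_solution (K := K) (S := ℝ) (fun z => b z.1)
    (hb.comp contDiff_fst) 0
  have e : u = fun x => w (x, 0) * u 0 := SolvesOn.eq hu ((hws 0).mul_const _) (x := 0)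
    (by simp [hw1])
  rw [e]
  have h1 : ContDiff ℝ ∞ fun x : ℝ => (x, (0 : ℝ)) := contDiff_id.prodMk contDiff_const
  exact (hw.comp h1.contMDiff).mul contMDiff_const

theorem existsUnique_parallelSolution (a : ℝ → 𝔨) (x₀ : ℝ) (ha : ContDiff ℝ ∞ a) :
    ∃! u : ℝ → K, IsParallelSolution a x₀ u := by
  obtain ⟨u, hu1, hu⟩ := exists_solution (K := K) (fun x => -a x) ha.neg x₀
  refine ⟨u, ⟨smooth_of_solvesOn ha.neg hu, hu1, fun x => (hu x (Set.mem_univ x)).2⟩, ?_⟩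
  rintro w ⟨hw, hw1, hwa⟩
  exact SolvesOn.eq (b := fun x => -a x) (fun x _ => ⟨(hw x).mdifferentiableAt (by simp), hwa x⟩) hu
    (x := x₀) (by rw [hw1, hu1])

end GroupODE

/-! ### The differential crossed module -/

section Infinitesimal

variable {𝔤 𝔥 G H : Type*}
  [NormedAddCommGroup 𝔤] [NormedSpace ℝ 𝔤] [NormedAddCommGroup 𝔥] [NormedSpace ℝ 𝔥]
  [FiniteDimensional ℝ 𝔤] [FiniteDimensional ℝ 𝔥]
  [Group G] [TopologicalSpace G] [ChartedSpace 𝔤 G] [LieGroup 𝓘(ℝ, 𝔤) ∞ G]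
  [Group H] [TopologicalSpace H] [ChartedSpace 𝔥 H] [LieGroup 𝓘(ℝ, 𝔥) ∞ H]

variable (𝔤 G) in
/-- A parametrization of a neighbourhood of the identity of a Lie group. -/
theorem exists_parametrization :
    ∃ (ψ : 𝔤 → G) (e : 𝔤), ψ e = 1 ∧ MDAt 𝔤 𝔤 ψ e ∧ ∀ x, rlog 𝔤 𝔤 ψ e x = x :=
  ⟨(chartOne 𝔤 G).symm, origin 𝔤 G, chartOne_symm_origin, (smoothAt_chartOne_symm origin_mem).mdAt,
    fun x => congrArg (fun A : 𝔤 →L[ℝ] 𝔤 => A x) mcForm_origin⟩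

omit [FiniteDimensional ℝ 𝔤] [FiniteDimensional ℝ 𝔥] in
theorem fderiv_clm_apply_comp {V A B : Type*} [NormedAddCommGroup V] [NormedSpace ℝ V]
    [NormedAddCommGroup A] [NormedSpace ℝ A] [NormedAddCommGroup B] [NormedSpace ℝ B]
    (L : A →L[ℝ] B) {f : V → A} {z : V} (hf : DifferentiableAt ℝ f z) (v : V) :
    fderiv ℝ (fun z => L (f z)) z v = L (fderiv ℝ f z v) := by
  have h : HasFDerivAt (fun z => L (f z)) _ z := L.hasFDerivAt.comp z hf.hasFDerivAt
  rw [h.fderiv]; rfl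

omit [FiniteDimensional ℝ 𝔤] [FiniteDimensional ℝ 𝔥] in
theorem fderiv_bilin {V A B D : Type*} [NormedAddCommGroup V] [NormedSpace ℝ V]
    [NormedAddCommGroup A] [NormedSpace ℝ A] [NormedAddCommGroup B] [NormedSpace ℝ B]
    [NormedAddCommGroup D] [NormedSpace ℝ D]
    (b : A →L[ℝ] B →L[ℝ] D) {f : V → A} {g : V → B} {z : V} (hf : DifferentiableAt ℝ f z)
    (hg : DifferentiableAt ℝ g z) (v : V) :
    fderiv ℝ (fun z => b (f z) (g z)) z v = b (fderiv ℝ f z v) (g z) + b (f z) (fderiv ℝ g z v) := by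
  have h : HasFDerivAt (fun z => b (f z) (g z)) _ z :=
    (b.hasFDerivAt.comp z hf.hasFDerivAt).clm_apply hg.hasFDerivAt
  rw [h.fderiv]
  simp [add_comm]

theorem ad_swap (x y : 𝔤) : ad G y x = -ad G x y := by
  rw [← mhat_conjModule]; exact conjModule_mhat_swap x y

theorem fderiv_Ad_apply {V : Type*} [NormedAddCommGroup V] [NormedSpace ℝ V] {u : V → G} {f : V → 𝔤}
    {z : V} (hu : MDAt V 𝔤 u z) (hf : DifferentiableAt ℝ f z) (v : V) :
    fderiv ℝ (fun z => Ad (u z) (f z)) z v =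
      ad G (rlog V 𝔤 u z v) (Ad (u z) (f z)) + Ad (u z) (fderiv ℝ f z v) := by
  rw [← mhat_conjModule]
  exact (conjModule 𝔤 G).fderiv_mdot_apply hu hf v

theorem differentiableAt_Ad_apply {V : Type*} [NormedAddCommGroup V] [NormedSpace ℝ V] {u : V → G}
    {f : V → 𝔤} {z : V} (hu : MDAt V 𝔤 u z) (hf : DifferentiableAt ℝ f z) :
    DifferentiableAt ℝ (fun z => Ad (u z) (f z)) z :=
  ((conjModule 𝔤 G).differentiableAt_mdot hu).clm_apply hf

theorem contDiffAt_Ad_apply {V : Type*} [NormedAddCommGroup V] [NormedSpace ℝ V] {u : V → G}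
    {f : V → 𝔤} {z : V} (hu : SmoothAt V 𝔤 u z) (hf : ContDiffAt ℝ ∞ f z) :
    ContDiffAt ℝ ∞ (fun z => Ad (u z) (f z)) z :=
  (conjModule 𝔤 G).contDiffAt_mdot_apply hu hf

theorem Ad_apply_Ad_inv (a : G) (x : 𝔤) : Ad a (Ad a⁻¹ x) = x := by
  rw [← ContinuousLinearMap.comp_apply, ← Ad_mul, mul_inv_cancel, Ad_one]; rfl

namespace LieCrossedModule

variable (C : LieCrossedModule 𝔤 𝔥 G H)

theorem mdot_mul_apply (a b : G) (x : 𝔥) : C.mdot (a * b) x = C.mdot a (C.mdot b x) := by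
  rw [mdot_mul]; rfl

theorem mdot_one_apply (x : 𝔥) : C.mdot 1 x = x := by
  rw [mdot_one]; rfl

theorem mdot_inv_apply_mdot (a : G) (x : 𝔥) : C.mdot a⁻¹ (C.mdot a x) = x := by
  rw [← mdot_mul_apply, inv_mul_cancel, mdot_one_apply]

theorem mdot_apply_mdot_inv (a : G) (x : 𝔥) : C.mdot a (C.mdot a⁻¹ x) = x := by
  rw [← mdot_mul_apply, mul_inv_cancel, mdot_one_apply]

theorem differentiableAt_mdot_apply {V : Type*} [NormedAddCommGroup V] [NormedSpace ℝ V] {u : V → G}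
    {f : V → 𝔥} {z : V} (hu : MDAt V 𝔤 u z) (hf : DifferentiableAt ℝ f z) :
    DifferentiableAt ℝ (fun z => C.mdot (u z) (f z)) z :=
  (C.differentiableAt_mdot hu).clm_apply hf

theorem tdot_mdot (a : G) (x : 𝔥) : C.tdot (C.mdot a x) = Ad a (C.tdot x) := by
  have e : (fun X : H => C.t (C.m a X)) = fun X => a * C.t X * a⁻¹ := funext (C.equivariant a)
  have h1 := tang_comp (f := fun X : H => C.t X) (1 : H) (C.mdAt_t _) (C.mdAt_m a 1)
  have h2 := tang_comp (V := 𝔥) (f := fun b : G => a * b * a⁻¹) (1 : H)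
    (((MDAt.const a _).mul (.id' _)).mul (.const _ _)) (C.mdAt_t 1)
  rw [← e] at h2
  rw [map_one] at h1 h2
  exact congrArg (fun A : 𝔥 →L[ℝ] 𝔤 => A x) (h1.symm.trans h2)

theorem mdot_t (X : H) : C.mdot (C.t X) = Ad X := by
  rw [mdot, Ad]
  congr 1
  ext Y
  exact C.peiffer X Y

/-- The infinitesimal Peiffer identity. -/
theorem mhat_tdot (x y : 𝔥) : C.mhat (C.tdot x) y = ad H x y := by
  obtain ⟨ψ, e, h1, hψ, hr⟩ := exists_parametrization 𝔥 H
  have e1 : (fun z => C.mdot (C.t (ψ z)) y) = fun z => Ad (ψ z) y := by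
    ext z; rw [mdot_t]
  have e2 := congrArg (fun f : 𝔥 → 𝔥 => fderiv ℝ f e x) e1
  beta_reduce at e2
  rw [C.fderiv_mdot_apply (u := fun z => C.t (ψ z)) (MDAt.comp e (C.mdAt_t _) hψ)
    (differentiableAt_const _), fderiv_Ad_apply hψ (differentiableAt_const _), C.rlog_t hψ] at e2
  simpa [h1, hr] using e2

/-- Like the other infinitesimal identities of this section, it is the derivative of an identity for
group elements, here `tdot_mdot`, along a parametrization `ψ` with `ψ(e) = 1` and logarithmic
derivative the identity at `e`. -/
theorem tdot_mhat (x : 𝔤) (y : 𝔥) : C.tdot (C.mhat x y) = ad G x (C.tdot y) := by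
  obtain ⟨ψ, e, h1, hψ, hr⟩ := exists_parametrization 𝔤 G
  have e1 : (fun z => C.tdot (C.mdot (ψ z) y)) = fun z => Ad (ψ z) (C.tdot y) := by
    ext z; rw [tdot_mdot]
  have e2 := congrArg (fun f : 𝔤 → 𝔤 => fderiv ℝ f e x) e1
  beta_reduce at e2
  rw [fderiv_clm_apply_comp _ (C.differentiableAt_mdot_apply hψ (differentiableAt_const _)),
    C.fderiv_mdot_apply hψ (differentiableAt_const _),
    fderiv_Ad_apply hψ (differentiableAt_const _)] at e2
  simpa [h1, hr] using e2

theorem tdot_ad (x y : 𝔥) : C.tdot (ad H x y) = ad G (C.tdot x) (C.tdot y) := by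
  rw [← mhat_tdot C, tdot_mhat]

/-- By the Peiffer identity `Ad X = ṁ(t X)`, so equivariance of `t` gives `ṁ(a) Ad(X) = Ad(m(a)X)
ṁ(a)`, which is differentiated in `X`. -/
theorem mdot_ad (a : G) (x y : 𝔥) : C.mdot a (ad H x y) = ad H (C.mdot a x) (C.mdot a y) := by
  have h0 : ∀ (X : H) (y : 𝔥), C.mdot a (Ad X y) = Ad (C.m a X) (C.mdot a y) := by
    intro X y
    rw [← C.mdot_t, ← C.mdot_t, C.equivariant, mdot_mul_apply, mdot_mul_apply,
      mdot_inv_apply_mdot]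
  obtain ⟨ψ, e, h1, hψ, hr⟩ := exists_parametrization 𝔥 H
  have e2 := congrArg (fun f : 𝔥 → 𝔥 => fderiv ℝ f e x) (funext fun z => h0 (ψ z) y)
  beta_reduce at e2
  rw [fderiv_clm_apply_comp _ (differentiableAt_Ad_apply hψ (differentiableAt_const _)),
    fderiv_Ad_apply hψ (differentiableAt_const _),
    fderiv_Ad_apply (u := fun z => C.m a (ψ z)) (MDAt.comp e (C.mdAt_m a _) hψ)
      (differentiableAt_const _), C.rlog_m a hψ] at e2
  simpa [h1, hr] using e2

theorem mdot_mhat (a : G) (x : 𝔤) (y : 𝔥) :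
    C.mdot a (C.mhat x y) = C.mhat (Ad a x) (C.mdot a y) := by
  obtain ⟨ψ, e, h1, hψ, hr⟩ := exists_parametrization 𝔤 G
  have e1 : (fun z => C.mdot a (C.mdot (ψ z) y)) =
      fun z => C.mdot (a * ψ z * a⁻¹) (C.mdot a y) := by
    ext z; simp [mdot_mul_apply, mdot_inv_apply_mdot]
  have e2 := congrArg (fun f : 𝔤 → 𝔥 => fderiv ℝ f e x) e1
  beta_reduce at e2
  have h2 : MDAt 𝔤 𝔤 (fun z => a * ψ z * a⁻¹) e := ((MDAt.const _ _).mul hψ).mul (.const _ _)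
  have h3 : rlog 𝔤 𝔤 (fun z => a * ψ z * a⁻¹) e x = Ad a x := by
    rw [rlog_mul_const, rlog_mul (.const a e) hψ, rlog_const]
    simp [hr]
  rw [fderiv_clm_apply_comp _ (C.differentiableAt_mdot_apply hψ (differentiableAt_const _)),
    C.fderiv_mdot_apply hψ (differentiableAt_const _),
    C.fderiv_mdot_apply h2 (differentiableAt_const _), h3] at e2
  simpa [h1, hr] using e2

theorem mhat_ad (v : 𝔤) (x y : 𝔥) :
    C.mhat v (ad H x y) = ad H (C.mhat v x) y + ad H x (C.mhat v y) := by
  obtain ⟨ψ, e, h1, hψ, hr⟩ := exists_parametrization 𝔤 G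
  have e2 := congrArg (fun f : 𝔤 → 𝔥 => fderiv ℝ f e v) (funext fun z => C.mdot_ad (ψ z) x y)
  beta_reduce at e2
  rw [C.fderiv_mdot_apply hψ (differentiableAt_const _),
    fderiv_bilin _ (C.differentiableAt_mdot_apply hψ (differentiableAt_const _))
      (C.differentiableAt_mdot_apply hψ (differentiableAt_const _)),
    C.fderiv_mdot_apply hψ (differentiableAt_const _),
    C.fderiv_mdot_apply hψ (differentiableAt_const _)] at e2
  simpa [h1, hr] using e2

/-- Differentiating the equivariance `mdot_mhat` in the group element shows that `mhat` is a Lie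
algebra representation. -/
theorem mhat_mhat (v w : 𝔤) (y : 𝔥) :
    C.mhat v (C.mhat w y) = C.mhat (ad G v w) y + C.mhat w (C.mhat v y) := by
  obtain ⟨ψ, e, h1, hψ, hr⟩ := exists_parametrization 𝔤 G
  have e2 := congrArg (fun f : 𝔤 → 𝔥 => fderiv ℝ f e v) (funext fun z => C.mdot_mhat (ψ z) w y)
  beta_reduce at e2
  rw [C.fderiv_mdot_apply hψ (differentiableAt_const _),
    fderiv_bilin _ (differentiableAt_Ad_apply hψ (differentiableAt_const _))
      (C.differentiableAt_mdot_apply hψ (differentiableAt_const _)),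
    C.fderiv_mdot_apply hψ (differentiableAt_const _),
    fderiv_Ad_apply hψ (differentiableAt_const _)] at e2
  simpa [h1, hr] using e2

end LieCrossedModule

theorem Ad_ad (a : G) (x y : 𝔤) : Ad a (ad G x y) = ad G (Ad a x) (Ad a y) :=
  (conjModule 𝔤 G).mdot_ad a x y

/-- The Jacobi identity. -/
theorem ad_ad (x y z : 𝔤) : ad G x (ad G y z) = ad G (ad G x y) z + ad G y (ad G x z) := by
  have := (conjModule 𝔤 G).mhat_mhat x y z
  rwa [mhat_conjModule] at this

end Infinitesimal

/-! ### Pull-back of forms to a vector space -/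

section Alternating

variable {V E F : Type*} [NormedAddCommGroup V] [NormedSpace ℝ V] [NormedAddCommGroup E]
  [NormedSpace ℝ E] [NormedAddCommGroup F] [NormedSpace ℝ F]

/-- Induction on the number of arguments: currying the first one leaves a smooth family of
alternating maps in one argument fewer. -/
theorem contDiffAt_alternating_apply {n : ℕ} {c : V → E [⋀^Fin n]→L[ℝ] F} {w : Fin n → V → E}
    {z : V} (hc : ContDiffAt ℝ ∞ c z) (hw : ∀ i, ContDiffAt ℝ ∞ (w i) z) :
    ContDiffAt ℝ ∞ (fun z => c z (fun i => w i z)) z := by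
  induction n with
  | zero =>
    have e : (fun z => c z (fun i => w i z)) =
        fun z => (ContinuousAlternatingMap.apply ℝ E F (0 : Fin 0 → E)) (c z) := by
      ext z
      rw [ContinuousAlternatingMap.apply_apply]
      congr 1
      exact Subsingleton.elim _ _
    rw [e]
    exact (ContinuousLinearMap.contDiff _).contDiffAt.comp z hc
  | succ n ih =>
    have e : (fun z => c z (fun i => w i z)) = fun z =>
        (ContinuousAlternatingMap.curryLeft (c z) (w 0 z)) (fun i => w i.succ z) := by
      ext z
      rw [ContinuousAlternatingMap.curryLeft_apply_apply]
      congr 1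
      ext i
      refine Fin.cases ?_ (fun i => ?_) i <;> simp
    rw [e]
    refine ih (ContDiffAt.clm_apply ?_ (hw 0)) (fun i => hw i.succ)
    let L : (E [⋀^Fin (n + 1)]→L[ℝ] F) →L[ℝ] (E →L[ℝ] E [⋀^Fin n]→L[ℝ] F) :=
      ContinuousAlternatingMap.curryLeftLI.toContinuousLinearMap
    have h2 : ContDiff ℝ ∞ (fun f => L f) := by fun_prop
    exact h2.contDiffAt.comp z hc

/-- An alternating map is determined by its finitely many values on tuples of basis vectors, and the
injective evaluation map has a continuous linear left inverse. -/
theorem contDiffAt_alternating [FiniteDimensional ℝ E] [FiniteDimensional ℝ F] {n : ℕ}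
    {c : V → E [⋀^Fin n]→L[ℝ] F} {z : V} (h : ∀ w, ContDiffAt ℝ ∞ (fun z => c z w) z) :
    ContDiffAt ℝ ∞ c z := by
  let b := Module.finBasis ℝ E
  let T : (E [⋀^Fin n]→L[ℝ] F) →ₗ[ℝ] ((Fin n → Fin (Module.finrank ℝ E)) → F) :=
    { toFun := fun f s => f (fun i => b (s i))
      map_add' := fun _ _ => rfl
      map_smul' := fun _ _ => rfl }
  have hT : LinearMap.ker T = ⊥ := by
    rw [LinearMap.ker_eq_bot]
    intro f g hfg
    refine ContinuousAlternatingMap.toAlternatingMap_injective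
      (Module.Basis.ext_alternating b fun s _ => congrFun hfg s)
  obtain ⟨L, hL⟩ := T.exists_leftInverse_of_injective hT
  have e : c = fun z => LinearMap.toContinuousLinearMap L (T (c z)) := by
    ext1 z
    exact (congrArg (fun A => A (c z)) hL).symm
  rw [e]
  refine (ContinuousLinearMap.contDiff _).contDiffAt.comp z ?_
  exact contDiffAt_pi.2 fun s => h _

end Alternating

section Pull

variable {V E M F : Type*} [NormedAddCommGroup V] [NormedSpace ℝ V] [NormedAddCommGroup E]
  [NormedSpace ℝ E] [TopologicalSpace M] [ChartedSpace E M] [IsManifold 𝓘(ℝ, E) ∞ M]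
  [NormedAddCommGroup F] [NormedSpace ℝ F] {n : ℕ} {h : V → M} {z : V}

/-- The pull-back of a form along a map from a vector space. -/
def pull (h : V → M) (α : DForm E M F n) (z : V) : V [⋀^Fin n]→L[ℝ] F :=
  (α (h z)).compContinuousLinearMap (tang V E h z)

theorem pull_apply (h : V → M) (α : DForm E M F n) (z : V) (v : Fin n → V) :
    pull h α z v = α (h z) (fun i => tang V E h z (v i)) := rfl

omit [IsManifold 𝓘(ℝ, E) ∞ M] in
theorem continuousAt_extChartAt_comp (hh : SmoothAt V E h z) :
    ∀ᶠ z' in 𝓝 z, h z' ∈ (extChartAt 𝓘(ℝ, E) (h z)).source :=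
  hh.continuousAt.eventually (extChartAt_source_mem_nhds (h z))

theorem smoothAt_extChartAt_comp (hh : SmoothAt V E h z) :
    ContDiffAt ℝ ∞ (fun z' => extChartAt 𝓘(ℝ, E) (h z) (h z')) z :=
  contMDiffAt_iff_contDiffAt.1
    (ContMDiffAt.comp z (contMDiffAt_extChartAt (I := 𝓘(ℝ, E)) (x := h z)) hh)

theorem smoothAt_extChartAt_symm (c : M) {y : E} (hy : y ∈ (extChartAt 𝓘(ℝ, E) c).target) :
    SmoothAt E E (extChartAt 𝓘(ℝ, E) c).symm y :=
  (contMDiffOn_extChartAt_symm c y hy).contMDiffAt ((isOpen_extChartAt_target c).mem_nhds hy)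

/-- Near `z` the map factors through the chart at `h z`, so the pull-back is that of the
representative in this chart, a form on a vector space. -/
theorem pull_eventuallyEq (α : DForm E M F n) (hh : SmoothAt V E h z) :
    pull h α =ᶠ[𝓝 z] fun z' =>
      (α.rep (h z) (extChartAt 𝓘(ℝ, E) (h z) (h z'))).compContinuousLinearMap
        (fderiv ℝ (fun z' => extChartAt 𝓘(ℝ, E) (h z) (h z')) z') := by
  filter_upwards [(continuousAt_extChartAt_comp hh).eventually_nhds, hh.eventually_mdAt] with x hx hx'
  set φ := extChartAt 𝓘(ℝ, E) (h z) with hφ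
  have hs := hx.self_of_nhds
  have e : h =ᶠ[𝓝 x] fun x => φ.symm (φ (h x)) := by
    filter_upwards [hx] with w hw
    exact (φ.left_inv hw).symm
  have h1 : MDAt E E φ (h x) :=
    (contMDiffAt_extChartAt' (n := ∞) (by simpa [hφ] using hs)).mdifferentiableAt (by simp)
  have h2 : MDAt V E (fun x => φ (h x)) x := MDAt.comp x h1 hx'
  have h3 := tang_comp (f := φ.symm) x (smoothAt_extChartAt_symm (h z) (φ.map_source hs)).mdAt h2
  rw [← tang_congr e, tang_eq_fderiv] at h3
  ext v
  rw [pull_apply, h3]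
  simp only [ContinuousAlternatingMap.compContinuousLinearMap_apply, DForm.rep, ← hφ,
    φ.left_inv hs]
  rfl

theorem DForm.IsSmooth.contDiffAt_rep {α : DForm E M F n} (hα : α.IsSmooth) (p : M) :
    ContDiffAt ℝ ∞ (α.rep p) (extChartAt 𝓘(ℝ, E) p p) :=
  (hα p).contDiffAt ((isOpen_extChartAt_target p).mem_nhds (mem_extChartAt_target p))

theorem contDiffAt_pull_apply {α : DForm E M F n} (hα : α.IsSmooth) (hh : SmoothAt V E h z)
    (v : Fin n → V) : ContDiffAt ℝ ∞ (fun z => pull h α z v) z := by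
  have hy := smoothAt_extChartAt_comp hh
  have e : (fun z => pull h α z v) =ᶠ[𝓝 z] fun z' =>
      (α.rep (h z) (extChartAt 𝓘(ℝ, E) (h z) (h z')))
        (fun i => fderiv ℝ (fun z' => extChartAt 𝓘(ℝ, E) (h z) (h z')) z' (v i)) := by
    filter_upwards [pull_eventuallyEq α hh] with x hx
    rw [hx]
    rfl
  refine ContDiffAt.congr_of_eventuallyEq ?_ e
  refine contDiffAt_alternating_apply ?_ fun i => ?_
  · exact ContDiffAt.comp z (hα.contDiffAt_rep (h z)) hy
  · exact (hy.fderiv_right (m := ∞) (by simp)).clm_apply contDiffAt_const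

theorem contDiffAt_pull [FiniteDimensional ℝ V] [FiniteDimensional ℝ F] {α : DForm E M F n}
    (hα : α.IsSmooth) (hh : SmoothAt V E h z) : ContDiffAt ℝ ∞ (pull h α) z :=
  contDiffAt_alternating (contDiffAt_pull_apply hα hh)

/-- The exterior derivative is natural. -/
theorem extDeriv_pull {α : DForm E M F n} (hα : α.IsSmooth) (hh : SmoothAt V E h z) :
    extDeriv (pull h α) z = pull h α.d z := by
  have hy := smoothAt_extChartAt_comp hh
  have h1 : MDAt E E (extChartAt 𝓘(ℝ, E) (h z)) (h z) :=
    (contMDiffAt_extChartAt (n := ∞)).mdifferentiableAt (by simp)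
  have h2 := tang_comp z h1 hh.mdAt
  rw [tang_eq_fderiv] at h2
  have h3 : DifferentiableAt ℝ (α.rep (h z)) (extChartAt 𝓘(ℝ, E) (h z) (h z)) :=
    (hα.contDiffAt_rep (h z)).differentiableAt (by simp)
  have h4 := extDeriv_pullback (f := fun z' => extChartAt 𝓘(ℝ, E) (h z) (h z')) h3 hy
    (by rw [minSmoothness_of_isRCLikeNormedField]
        exact WithTop.coe_le_coe.2 (le_top : (2 : ℕ∞) ≤ ⊤))
  rw [(pull_eventuallyEq α hh).extDeriv_eq, h4, h2]
  rfl

variable [FiniteDimensional ℝ V] [FiniteDimensional ℝ F]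

theorem fderiv_pull₁ {α : DForm E M F 1} (hα : α.IsSmooth) (hh : SmoothAt V E h z) (v w : V) :
    fderiv ℝ (fun z => pull h α z ![w]) z v - fderiv ℝ (fun z => pull h α z ![v]) z w =
      pull h α.d z ![v, w] := by
  have e0 : (0 : Fin 2).removeNth ![v, w] = ![w] := by ext i; fin_cases i; rfl
  have e1 : (1 : Fin 2).removeNth ![v, w] = ![v] := by ext i; fin_cases i; rfl
  rw [← extDeriv_pull hα hh, extDeriv_apply ((contDiffAt_pull hα hh).differentiableAt (by simp)),
    Fin.sum_univ_two, e0, e1]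
  simp [sub_eq_add_neg]

theorem fderiv_pull₂ {α : DForm E M F 2} (hα : α.IsSmooth) (hh : SmoothAt V E h z) (v₁ v₂ v₃ : V) :
    fderiv ℝ (fun z => pull h α z ![v₂, v₃]) z v₁ - fderiv ℝ (fun z => pull h α z ![v₁, v₃]) z v₂ +
      fderiv ℝ (fun z => pull h α z ![v₁, v₂]) z v₃ = pull h α.d z ![v₁, v₂, v₃] := by
  have e0 : (0 : Fin 3).removeNth ![v₁, v₂, v₃] = ![v₂, v₃] := by ext i; fin_cases i <;> rfl
  have e1 : (1 : Fin 3).removeNth ![v₁, v₂, v₃] = ![v₁, v₃] := by ext i; fin_cases i <;> rfl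
  have e2 : (2 : Fin 3).removeNth ![v₁, v₂, v₃] = ![v₁, v₂] := by ext i; fin_cases i <;> rfl
  rw [← extDeriv_pull hα hh, extDeriv_apply ((contDiffAt_pull hα hh).differentiableAt (by simp)),
    Fin.sum_univ_three, e0, e1, e2]
  simp [sub_eq_add_neg]

theorem wedge_apply₁ {A B D : Type*} [NormedAddCommGroup A] [NormedSpace ℝ A]
    [NormedAddCommGroup B] [NormedSpace ℝ B] [NormedAddCommGroup D] [NormedSpace ℝ D]
    (b : A →L[ℝ] B →L[ℝ] D) (α : E [⋀^Fin 1]→L[ℝ] A) (β : E [⋀^Fin 1]→L[ℝ] B) (v w : E) :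
    wedge b α β ![v, w] = b (α ![v]) (β ![w]) - b (α ![w]) (β ![v]) := by
  have e0 : (0 : Fin 2).removeNth ![v, w] = ![w] := by ext i; fin_cases i; rfl
  have e1 : (1 : Fin 2).removeNth ![v, w] = ![v] := by ext i; fin_cases i; rfl
  rw [wedge_apply, Fin.sum_univ_two, e0, e1]
  simp [sub_eq_add_neg]

theorem wedge_apply₂ {A B D : Type*} [NormedAddCommGroup A] [NormedSpace ℝ A]
    [NormedAddCommGroup B] [NormedSpace ℝ B] [NormedAddCommGroup D] [NormedSpace ℝ D]
    (b : A →L[ℝ] B →L[ℝ] D) (α : E [⋀^Fin 1]→L[ℝ] A) (β : E [⋀^Fin 2]→L[ℝ] B) (v₁ v₂ v₃ : E) :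
    wedge b α β ![v₁, v₂, v₃] =
      b (α ![v₁]) (β ![v₂, v₃]) - b (α ![v₂]) (β ![v₁, v₃]) + b (α ![v₃]) (β ![v₁, v₂]) := by
  have e0 : (0 : Fin 3).removeNth ![v₁, v₂, v₃] = ![v₂, v₃] := by ext i; fin_cases i <;> rfl
  have e1 : (1 : Fin 3).removeNth ![v₁, v₂, v₃] = ![v₁, v₃] := by ext i; fin_cases i <;> rfl
  have e2 : (2 : Fin 3).removeNth ![v₁, v₂, v₃] = ![v₁, v₂] := by ext i; fin_cases i <;> rfl
  rw [wedge_apply, Fin.sum_univ_three, e0, e1, e2]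
  simp [sub_eq_add_neg]

end Pull

/-! ### Curvatures and gauge transformations in components -/

section Components

variable {V 𝔤 𝔥 G H : Type*} [NormedAddCommGroup V] [NormedSpace ℝ V]
  [NormedAddCommGroup 𝔤] [NormedSpace ℝ 𝔤] [NormedAddCommGroup 𝔥] [NormedSpace ℝ 𝔥]
  [FiniteDimensional ℝ 𝔤] [FiniteDimensional ℝ 𝔥]
  [Group G] [TopologicalSpace G] [ChartedSpace 𝔤 G] [LieGroup 𝓘(ℝ, 𝔤) ∞ G]
  [Group H] [TopologicalSpace H] [ChartedSpace 𝔥 H] [LieGroup 𝓘(ℝ, 𝔥) ∞ H]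

variable (G) in
/-- The curvature `da + ½[a, a]` of a `1`-form on a vector space. -/
def curv (a : V → V → 𝔤) (z v w : V) : 𝔤 :=
  fderiv ℝ (fun z => a z w) z v - fderiv ℝ (fun z => a z v) z w + ad G (a z v) (a z w)

/-- The form `dB + m̂(a, B)` on a vector space. -/
def curv₃ (C : LieCrossedModule 𝔤 𝔥 G H) (a : V → V → 𝔤) (B : V → V → V → 𝔥) (z v₁ v₂ v₃ : V) : 𝔥 :=
  fderiv ℝ (fun z => B z v₂ v₃) z v₁ - fderiv ℝ (fun z => B z v₁ v₃) z v₂ +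
    fderiv ℝ (fun z => B z v₁ v₂) z v₃ +
    (C.mhat (a z v₁) (B z v₂ v₃) - C.mhat (a z v₂) (B z v₁ v₃) + C.mhat (a z v₃) (B z v₁ v₂))

/-- The gauge transformation `Ad u(a) - du u⁻¹` of a `1`-form. -/
def rotate (u : V → G) (a : V → V → 𝔤) (z v : V) : 𝔤 := Ad (u z) (a z v) - rlog V 𝔤 u z v

/-- The exterior derivative of a `1`-form. -/
def curl {F : Type*} [NormedAddCommGroup F] [NormedSpace ℝ F] (J : V → V → F) (z v w : V) : F :=
  fderiv ℝ (fun z => J z w) z v - fderiv ℝ (fun z => J z v) z w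

/-- The `2`-form `dJ + ½[J,J] + m̂(a, J)`. -/
def shift (C : LieCrossedModule 𝔤 𝔥 G H) (a : V → V → 𝔤) (J : V → V → 𝔥) (z v w : V) : 𝔥 :=
  curl J z v w + ad H (J z v) (J z w) + (C.mhat (a z v) (J z w) - C.mhat (a z w) (J z v))

variable (C : LieCrossedModule 𝔤 𝔥 G H) {u : V → G} {a : V → V → 𝔤} {B : V → V → V → 𝔥}
  {J : V → V → 𝔥} {z : V}

omit [FiniteDimensional ℝ 𝔤] [LieGroup 𝓘(ℝ, 𝔤) ∞ G] in
theorem contDiffAt_rotate [FiniteDimensional ℝ 𝔤] [LieGroup 𝓘(ℝ, 𝔤) ∞ G] (hu : SmoothAt V 𝔤 u z) {v : V}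
    (ha : ContDiffAt ℝ ∞ (fun z => a z v) z) : ContDiffAt ℝ ∞ (fun z => rotate u a z v) z :=
  (contDiffAt_Ad_apply hu ha).sub ((contDiffAt_rlog hu).clm_apply contDiffAt_const)

theorem fderiv_rotate (hu : SmoothAt V 𝔤 u z) {v : V}
    (ha : ContDiffAt ℝ ∞ (fun z => a z v) z) (w : V) :
    fderiv ℝ (fun z => rotate u a z v) z w =
      ad G (rlog V 𝔤 u z w) (Ad (u z) (a z v)) + Ad (u z) (fderiv ℝ (fun z => a z v) z w) -
        fderiv ℝ (fun z => rlog V 𝔤 u z v) z w := by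
  have h1 := ha.differentiableAt (by simp)
  have h2 : DifferentiableAt ℝ (fun z => rlog V 𝔤 u z v) z :=
    ((contDiffAt_rlog hu).clm_apply contDiffAt_const).differentiableAt (by simp)
  rw [← fderiv_Ad_apply hu.mdAt h1]
  have := fderiv_fun_sub (differentiableAt_Ad_apply hu.mdAt h1) h2
  simp only [rotate]
  rw [this]; rfl

/-- The exterior derivative of `du u⁻¹` is a bracket by the Maurer-Cartan equation and cancels the
quadratic term; the mixed brackets cancel by antisymmetry. -/
theorem curv_rotate (hu : SmoothAt V 𝔤 u z) {v w : V} (hv : ContDiffAt ℝ ∞ (fun z => a z v) z)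
    (hw : ContDiffAt ℝ ∞ (fun z => a z w) z) :
    curv G (rotate u a) z v w = Ad (u z) (curv G a z v w) := by
  have h := maurerCartan_eq hu v w
  simp only [curv]
  rw [fderiv_rotate hu hv, fderiv_rotate hu hw]
  simp only [rotate, map_add, map_sub, Ad_ad, sub_apply]
  have h2 := ad_swap (G := G) (rlog V 𝔤 u z w) (Ad (u z) (a z v))
  linear_combination (norm := module) -h - h2

/-- The derivative of `ṁ(u)` contributes `m̂(du u⁻¹)`, exactly what `rotate` subtracts from the
connection. -/
theorem curv₃_rotate (hu : SmoothAt V 𝔤 u z) {v₁ v₂ v₃ : V}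
    (h₁₂ : DifferentiableAt ℝ (fun z => B z v₁ v₂) z) (h₁₃ : DifferentiableAt ℝ (fun z => B z v₁ v₃) z)
    (h₂₃ : DifferentiableAt ℝ (fun z => B z v₂ v₃) z) :
    curv₃ C (rotate u a) (fun z v w => C.mdot (u z) (B z v w)) z v₁ v₂ v₃ =
      C.mdot (u z) (curv₃ C a B z v₁ v₂ v₃) := by
  simp only [curv₃]
  rw [C.fderiv_mdot_apply hu.mdAt h₁₂, C.fderiv_mdot_apply hu.mdAt h₁₃,
    C.fderiv_mdot_apply hu.mdAt h₂₃]
  simp only [rotate, map_add, map_sub, C.mdot_mhat, sub_apply]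
  abel

theorem fderiv_sub_tdot {v : V} (ha : DifferentiableAt ℝ (fun z => a z v) z)
    (hJ : DifferentiableAt ℝ (fun z => J z v) z) (w : V) :
    fderiv ℝ (fun z => a z v - C.tdot (J z v)) z w =
      fderiv ℝ (fun z => a z v) z w - C.tdot (fderiv ℝ (fun z => J z v) z w) := by
  have h2 : DifferentiableAt ℝ (fun z => C.tdot (J z v)) z :=
    C.tdot.differentiableAt.comp z hJ
  rw [← fderiv_clm_apply_comp C.tdot hJ, fderiv_fun_sub ha h2]; rfl

/-- The effect of a shift by `J` on the curvature. -/
theorem curv_sub_tdot {v w : V} (hv : DifferentiableAt ℝ (fun z => a z v) z)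
    (hw : DifferentiableAt ℝ (fun z => a z w) z) (hJv : DifferentiableAt ℝ (fun z => J z v) z)
    (hJw : DifferentiableAt ℝ (fun z => J z w) z) :
    curv G (fun z v => a z v - C.tdot (J z v)) z v w =
      curv G a z v w - C.tdot (shift C (fun z v => a z v - C.tdot (J z v)) J z v w) := by
  simp only [curv, shift, curl]
  rw [fderiv_sub_tdot C hv hJv, fderiv_sub_tdot C hw hJw]
  simp only [map_add, map_sub, sub_apply, C.tdot_ad, C.tdot_mhat]
  have h1 := ad_swap (G := G) (a z w) (C.tdot (J z v))
  have h2 := ad_swap (G := G) (C.tdot (J z w)) (C.tdot (J z v))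
  linear_combination (norm := module) -h1 + h2

omit [FiniteDimensional ℝ 𝔤] [FiniteDimensional ℝ 𝔥] in
theorem fderiv_fderiv_symm {F : Type*} [NormedAddCommGroup F] [NormedSpace ℝ F] {f : V → F}
    (hf : ContDiffAt ℝ ∞ f z) (v w : V) :
    fderiv ℝ (fun z => fderiv ℝ f z v) z w = fderiv ℝ (fun z => fderiv ℝ f z w) z v := by
  have h1 : DifferentiableAt ℝ (fderiv ℝ f) z :=
    (hf.fderiv_right (m := 1) (by norm_cast)).differentiableAt (by simp)
  have h5 := hf.isSymmSndFDerivAt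
    (by rw [minSmoothness_of_isRCLikeNormedField]; exact WithTop.coe_le_coe.2 (le_top : (2 : ℕ∞) ≤ ⊤)) v w
  have h3 : ∀ v : V, HasFDerivAt (fun z => fderiv ℝ f z v) _ z := fun v =>
    h1.hasFDerivAt.clm_apply (hasFDerivAt_const v z)
  rw [(h3 v).fderiv, (h3 w).fderiv]
  simp [h5]

omit [FiniteDimensional ℝ 𝔤] [FiniteDimensional ℝ 𝔥] in
theorem contDiffAt_fderiv_apply {F : Type*} [NormedAddCommGroup F] [NormedSpace ℝ F] {f : V → F}
    (hf : ContDiffAt ℝ ∞ f z) (v : V) : ContDiffAt ℝ ∞ (fun z => fderiv ℝ f z v) z :=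
  (hf.fderiv_right (m := ∞) (by simp)).clm_apply contDiffAt_const

omit [FiniteDimensional ℝ 𝔤] [FiniteDimensional ℝ 𝔥] in
theorem contDiffAt_bilin {V A B D : Type*} [NormedAddCommGroup V] [NormedSpace ℝ V]
    [NormedAddCommGroup A] [NormedSpace ℝ A] [NormedAddCommGroup B] [NormedSpace ℝ B]
    [NormedAddCommGroup D] [NormedSpace ℝ D] {z : V}
    (b : A →L[ℝ] B →L[ℝ] D) {f : V → A} {g : V → B} (hf : ContDiffAt ℝ ∞ f z)
    (hg : ContDiffAt ℝ ∞ g z) : ContDiffAt ℝ ∞ (fun z => b (f z) (g z)) z :=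
  ContDiffAt.clm_apply ((ContinuousLinearMap.contDiff b).contDiffAt.comp z hf) hg

theorem contDiffAt_shift {v w : V} (hv : ContDiffAt ℝ ∞ (fun z => a z v) z)
    (hw : ContDiffAt ℝ ∞ (fun z => a z w) z) (hJv : ContDiffAt ℝ ∞ (fun z => J z v) z)
    (hJw : ContDiffAt ℝ ∞ (fun z => J z w) z) :
    ContDiffAt ℝ ∞ (fun z => shift C a J z v w) z := by
  exact (((contDiffAt_fderiv_apply hJw v).sub (contDiffAt_fderiv_apply hJv w)).add
    (contDiffAt_bilin (ad H) hJv hJw)).add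
      ((contDiffAt_bilin C.mhat hv hJw).sub (contDiffAt_bilin C.mhat hw hJv))

theorem fderiv_shift {v w : V} (hv : ContDiffAt ℝ ∞ (fun z => a z v) z)
    (hw : ContDiffAt ℝ ∞ (fun z => a z w) z) (hJv : ContDiffAt ℝ ∞ (fun z => J z v) z)
    (hJw : ContDiffAt ℝ ∞ (fun z => J z w) z) (x : V) :
    fderiv ℝ (fun z => shift C a J z v w) z x =
      fderiv ℝ (fun z => fderiv ℝ (fun z => J z w) z v) z x -
        fderiv ℝ (fun z => fderiv ℝ (fun z => J z v) z w) z x +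
      (ad H (fderiv ℝ (fun z => J z v) z x) (J z w) + ad H (J z v) (fderiv ℝ (fun z => J z w) z x)) +
      ((C.mhat (fderiv ℝ (fun z => a z v) z x) (J z w) +
          C.mhat (a z v) (fderiv ℝ (fun z => J z w) z x)) -
        (C.mhat (fderiv ℝ (fun z => a z w) z x) (J z v) +
          C.mhat (a z w) (fderiv ℝ (fun z => J z v) z x))) := by
  have d1 := (contDiffAt_fderiv_apply hJw v).differentiableAt (by simp)
  have d2 := (contDiffAt_fderiv_apply hJv w).differentiableAt (by simp)
  have d3 := hv.differentiableAt (by simp)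
  have d4 := hw.differentiableAt (by simp)
  have d5 := hJv.differentiableAt (by simp)
  have d6 := hJw.differentiableAt (by simp)
  have e1 := (contDiffAt_bilin (ad H) hJv hJw).differentiableAt (by simp)
  have e2 := (contDiffAt_bilin C.mhat hv hJw).differentiableAt (by simp)
  have e3 := (contDiffAt_bilin C.mhat hw hJv).differentiableAt (by simp)
  rw [← fderiv_bilin (ad H) d5 d6, ← fderiv_bilin C.mhat d3 d6, ← fderiv_bilin C.mhat d4 d5]
  have h : HasFDerivAt (fun z => shift C a J z v w) _ z :=
    ((d1.hasFDerivAt.sub d2.hasFDerivAt).add e1.hasFDerivAt).add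
      (e2.hasFDerivAt.sub e3.hasFDerivAt)
  rw [h.fderiv]
  rfl

/-- The effect of a shift by `J` on the `2`-curvature. -/
theorem curv₃_shift {v₁ v₂ v₃ : V} {a' : V → V → 𝔤} {B' : V → V → V → 𝔥}
    (ha' : ∀ z v, a' z v = a z v - C.tdot (J z v))
    (hB' : ∀ z v w, B' z v w = B z v w - shift C a' J z v w)
    (ha : ∀ v, ContDiffAt ℝ ∞ (fun z => a z v) z) (hJ : ∀ v, ContDiffAt ℝ ∞ (fun z => J z v) z)
    (hB : ∀ v w, ContDiffAt ℝ ∞ (fun z => B z v w) z)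
    (hc : ∀ v w, curv G a z v w = C.tdot (B z v w)) :
    curv₃ C a' B' z v₁ v₂ v₃ = curv₃ C a B z v₁ v₂ v₃ := by
  obtain rfl : a' = fun z v => a z v - C.tdot (J z v) := funext fun z => funext fun v => ha' z v
  set a' : V → V → 𝔤 := fun z v => a z v - C.tdot (J z v) with haa
  obtain rfl : B' = fun z v w => B z v w - shift C a' J z v w :=
    funext fun z => funext fun v => funext fun w => hB' z v w
  have hd : ∀ v, DifferentiableAt ℝ (fun z => a z v) z := fun v => (ha v).differentiableAt (by simp)
  have hJd : ∀ v, DifferentiableAt ℝ (fun z => J z v) z := fun v => (hJ v).differentiableAt (by simp)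
  have ha1 : ∀ v, ContDiffAt ℝ ∞ (fun z => a' z v) z := fun v =>
    (ha v).sub ((ContinuousLinearMap.contDiff C.tdot).contDiffAt.comp z (hJ v))
  -- The curvature of `a'` lies in the image of `ṫ`, so by the infinitesimal Peiffer identity its
  -- action on `𝔥` is a bracket with the transformed `2`-form.
  have hc' : ∀ v w x, C.mhat (curv G a' z v w) x = ad H (B z v w - shift C a' J z v w) x := by
    intro v w x
    rw [haa, curv_sub_tdot C (hd v) (hd w) (hJd v) (hJd w), hc, ← map_sub, C.mhat_tdot]
  have hm : ∀ v x, C.mhat (a z v) x = C.mhat (a' z v) x + ad H (J z v) x := by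
    intro v x
    simp [haa, C.mhat_tdot]
  have hf : ∀ v w x, fderiv ℝ (fun z => B z v w - shift C a' J z v w) z x =
      fderiv ℝ (fun z => B z v w) z x - fderiv ℝ (fun z => shift C a' J z v w) z x := by
    intro v w x
    rw [fderiv_fun_sub ((hB v w).differentiableAt (by simp))
      ((contDiffAt_shift C (ha1 v) (ha1 w) (hJ v) (hJ w)).differentiableAt (by simp))]
    rfl
  simp only [curv₃, hf, hm, fderiv_shift C (ha1 _) (ha1 _) (hJ _) (hJ _)]
  have k1 := hc' v₁ v₂ (J z v₃)
  have k2 := hc' v₁ v₃ (J z v₂)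
  have k3 := hc' v₂ v₃ (J z v₁)
  simp only [curv, map_add, map_sub, add_apply, sub_apply, shift, curl] at k1 k2 k3 ⊢
  -- This is the Bianchi identity for the shift: second derivatives of `J` cancel by symmetry,
  -- double actions combine with derivatives of `a'` into its curvature, and the terms cubic in `J`
  -- cancel by the Jacobi identity.
  have s1 := fderiv_fderiv_symm (hJ v₁) v₂ v₃
  have s2 := fderiv_fderiv_symm (hJ v₂) v₁ v₃
  have s3 := fderiv_fderiv_symm (hJ v₃) v₁ v₂
  have m1 := C.mhat_mhat (a' z v₁) (a' z v₂) (J z v₃)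
  have m2 := C.mhat_mhat (a' z v₁) (a' z v₃) (J z v₂)
  have m3 := C.mhat_mhat (a' z v₂) (a' z v₃) (J z v₁)
  have j := ad_ad (G := H) (J z v₁) (J z v₂) (J z v₃)
  -- Antisymmetry oriented in one direction brings all brackets to a common form, after which only
  -- linear algebra remains.
  have w1 : ∀ (f : V → 𝔥) (v : V) (y : 𝔥), ad H (fderiv ℝ f z v) y = -ad H y (fderiv ℝ f z v) :=
    fun _ _ _ => ad_swap _ _
  have w2 : ∀ (v : 𝔤) (x y : 𝔥), ad H (C.mhat v x) y = -ad H y (C.mhat v x) :=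
    fun _ _ _ => ad_swap _ _
  have w3 : ∀ (x x' y : 𝔥), ad H (ad H x x') y = -ad H y (ad H x x') := fun _ _ _ => ad_swap _ _
  have w4 : ∀ (v w : V) (y : 𝔥), ad H (B z v w) y = -ad H y (B z v w) := fun _ _ _ => ad_swap _ _
  simp only [C.mhat_ad, w1, w2, w3, w4] at k1 k2 k3 j ⊢
  linear_combination (norm := module) s1 - s2 + s3 - m1 + m2 - m3 - k1 + k2 - k3 - j

end Components

/-! ### Connection doublets and gauge transformations in components -/

section PulledDoublets

variable {V E M F 𝔤 𝔥 G H : Type*} [NormedAddCommGroup V] [NormedSpace ℝ V]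
  [FiniteDimensional ℝ V]
  [NormedAddCommGroup E] [NormedSpace ℝ E]
  [TopologicalSpace M] [ChartedSpace E M] [IsManifold 𝓘(ℝ, E) ∞ M]
  [NormedAddCommGroup F] [NormedSpace ℝ F] [FiniteDimensional ℝ F]
  [NormedAddCommGroup 𝔤] [NormedSpace ℝ 𝔤] [NormedAddCommGroup 𝔥] [NormedSpace ℝ 𝔥]
  [FiniteDimensional ℝ 𝔤] [FiniteDimensional ℝ 𝔥]
  [Group G] [TopologicalSpace G] [ChartedSpace 𝔤 G] [LieGroup 𝓘(ℝ, 𝔤) ∞ G]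
  [Group H] [TopologicalSpace H] [ChartedSpace 𝔥 H] [LieGroup 𝓘(ℝ, 𝔥) ∞ H]

/-- The components of the pull-back of a `1`-form. -/
def comp₁ (h : V → M) (α : DForm E M F 1) (z v : V) : F := α (h z) ![tang V E h z v]

/-- The components of the pull-back of a `2`-form. -/
def comp₂ (h : V → M) (α : DForm E M F 2) (z v w : V) : F :=
  α (h z) ![tang V E h z v, tang V E h z w]

theorem pull_one (h : V → M) (α : DForm E M F 1) (z v : V) : pull h α z ![v] = comp₁ h α z v := by
  rw [pull_apply, comp₁]
  congr 1
  ext i; fin_cases i; rfl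

theorem pull_two (h : V → M) (α : DForm E M F 2) (z v w : V) :
    pull h α z ![v, w] = comp₂ h α z v w := by
  rw [pull_apply, comp₂]
  congr 1
  ext i; fin_cases i <;> rfl

theorem pull_three (h : V → M) (α : DForm E M F 3) (z v w x : V) :
    pull h α z ![v, w, x] = α (h z) ![tang V E h z v, tang V E h z w, tang V E h z x] := by
  rw [pull_apply]
  congr 1
  ext i; fin_cases i <;> rfl

variable {h : V → M} {z : V}

theorem contDiffAt_comp₁ {α : DForm E M F 1} (hα : α.IsSmooth) (hh : SmoothAt V E h z) (v : V) :
    ContDiffAt ℝ ∞ (fun z => comp₁ h α z v) z := by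
  simpa only [pull_one] using contDiffAt_pull_apply hα hh ![v]

theorem contDiffAt_comp₂ {α : DForm E M F 2} (hα : α.IsSmooth) (hh : SmoothAt V E h z) (v w : V) :
    ContDiffAt ℝ ∞ (fun z => comp₂ h α z v w) z := by
  simpa only [pull_two] using contDiffAt_pull_apply hα hh ![v, w]

theorem comp₂_d {α : DForm E M F 1} (hα : α.IsSmooth) (hh : SmoothAt V E h z) (v w : V) :
    comp₂ h α.d z v w = curl (comp₁ h α) z v w := by
  rw [← pull_two, ← fderiv_pull₁ hα hh]
  simp only [pull_one]
  rfl

variable {θ : DForm E M 𝔤 1} {Υ : DForm E M 𝔥 2} {J : DForm E M 𝔥 1} {g : M → G}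
  (C : LieCrossedModule 𝔤 𝔥 G H)

/-- The wedge is a sum of two terms which antisymmetry of the bracket makes equal; the factor `1 /
2` compensates. -/
theorem half_wedge_ad (α : E [⋀^Fin 1]→L[ℝ] 𝔤) (v w : E) :
    ((1 / 2 : ℝ) • wedge (ad G) α α) ![v, w] = ad G (α ![v]) (α ![w]) := by
  rw [ContinuousAlternatingMap.smul_apply, wedge_apply₁, ad_swap (G := G) (α ![v]) (α ![w])]
  module

theorem curv_comp₁ (hθ : θ.IsSmooth) (hh : SmoothAt V E h z) (v w : V) :
    curv G (comp₁ h θ) z v w =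
      comp₂ h (fun p => θ.d p + (1 / 2 : ℝ) • wedge (ad G) (θ p) (θ p)) z v w := by
  rw [curv, ← curl, ← comp₂_d hθ hh]
  simp only [comp₂]
  rw [ContinuousAlternatingMap.add_apply, half_wedge_ad]
  rfl

theorem curv₃_comp (hΥ : Υ.IsSmooth) (hh : SmoothAt V E h z) (v₁ v₂ v₃ : V) :
    curv₃ C (comp₁ h θ) (comp₂ h Υ) z v₁ v₂ v₃ =
      pull h (fun p => Υ.d p + wedge C.mhat (θ p) (Υ p)) z ![v₁, v₂, v₃] := by
  have := fderiv_pull₂ hΥ hh v₁ v₂ v₃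
  simp only [pull_two] at this
  rw [curv₃, this, pull_three, pull_three, ContinuousAlternatingMap.add_apply, wedge_apply₂]
  rfl

variable {C}

theorem IsConnectionDoublet.curv_eq (hD : IsConnectionDoublet C θ Υ) (hh : SmoothAt V E h z)
    (v w : V) : curv G (comp₁ h θ) z v w = C.tdot (comp₂ h Υ z v w) := by
  have h1 := hD.fake_flat (h z)
  rw [sub_eq_zero] at h1
  rw [curv_comp₁ hD.smooth_θ hh]
  simp only [comp₂]
  rw [h1]
  rfl

theorem IsFlat.curv₃_eq (hF : IsFlat C θ Υ) (hΥ : Υ.IsSmooth) (hh : SmoothAt V E h z)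
    (v₁ v₂ v₃ : V) : curv₃ C (comp₁ h θ) (comp₂ h Υ) z v₁ v₂ v₃ = 0 := by
  rw [curv₃_comp C hΥ hh, pull_apply, hF]
  rfl

theorem comp₁_gaugeθ (hg : Smooth E 𝔤 g) (hh : MDAt V E h z) (v : V) :
    comp₁ h (gaugeθ C g J θ) z v =
      rotate (fun z => g (h z)) (comp₁ h θ) z v - C.tdot (comp₁ h J z v) := by
  have h1 : MDAt E 𝔤 g (h z) := (hg (h z)).mdifferentiableAt (by simp)
  rw [rotate, rlog_comp z h1 hh]
  rfl

theorem comp₂_gaugeΥ (hJ : J.IsSmooth) (hh : SmoothAt V E h z) (v w : V) :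
    comp₂ h (gaugeΥ C g J θ Υ) z v w =
      C.mdot (g (h z)) (comp₂ h Υ z v w) - shift C (comp₁ h (gaugeθ C g J θ)) (comp₁ h J) z v w := by
  rw [shift, ← comp₂_d hJ hh]
  simp only [comp₂, gaugeΥ]
  rw [ContinuousAlternatingMap.sub_apply, ContinuousAlternatingMap.sub_apply,
    ContinuousAlternatingMap.sub_apply, half_wedge_ad, wedge_apply₁, sub_sub, sub_sub]
  simp only [add_assoc]
  rfl

/-! ### Smoothness of the gauge transformed forms -/

section Chart

variable [FiniteDimensional ℝ E]

theorem tang_extChartAt_symm (p : M) :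
    tang E E (extChartAt 𝓘(ℝ, E) p).symm (extChartAt 𝓘(ℝ, E) p p) = .id ℝ E := by
  have : IsManifold 𝓘(ℝ, E) 1 M := IsManifold.of_le (n := ∞) (by simp)
  have := mfderivWithin_range_extChartAt_symm (I := 𝓘(ℝ, E)) (x := p)
  rwa [ModelWithCorners.range_eq_univ, mfderivWithin_univ] at this

theorem pull_extChartAt_symm {n : ℕ} (α : DForm E M F n) (p : M) :
    pull (extChartAt 𝓘(ℝ, E) p).symm α (extChartAt 𝓘(ℝ, E) p p) = α p := by
  ext v
  rw [pull_apply, tang_extChartAt_symm, extChartAt_to_inv]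
  rfl

/-- The representative of a form in a chart is its pull-back by the inverse chart, which is smooth
only on the open target; this is why `h` is smooth only near `z`. -/
theorem DForm.isSmooth_of_pull {n : ℕ} {α : DForm E M F n}
    (hα : ∀ (h : E → M) (z : E), (∀ᶠ z in 𝓝 z, SmoothAt E E h z) →
      ∀ v, ContDiffAt ℝ ∞ (fun z => pull h α z v) z) : α.IsSmooth := by
  intro c y hy
  refine (contDiffAt_alternating fun v => hα _ y ?_ v).contDiffWithinAt
  filter_upwards [(isOpen_extChartAt_target c).mem_nhds hy] with z hz
  exact smoothAt_extChartAt_symm c hz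

theorem isSmooth_gaugeθ (hθ : θ.IsSmooth) (hg : Smooth E 𝔤 g) (hJ : J.IsSmooth) :
    (gaugeθ C g J θ).IsSmooth := by
  refine DForm.isSmooth_of_pull fun h z hh v => ?_
  have hv : v = ![v 0] := by ext i; fin_cases i; rfl
  rw [hv]
  simp only [pull_one]
  have h1 : SmoothAt E E h z := hh.self_of_nhds
  refine ContDiffAt.congr_of_eventuallyEq (f := fun z =>
    rotate (fun z => g (h z)) (comp₁ h θ) z (v 0) - C.tdot (comp₁ h J z (v 0))) ?_ ?_
  · exact (contDiffAt_rotate (ContMDiffAt.comp z (hg (h z)) h1) (contDiffAt_comp₁ hθ h1 _)).sub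
      ((ContinuousLinearMap.contDiff C.tdot).contDiffAt.comp z (contDiffAt_comp₁ hJ h1 _))
  · filter_upwards [hh] with x hx
    exact comp₁_gaugeθ hg hx.mdAt _

theorem isSmooth_gaugeΥ (hD : IsConnectionDoublet C θ Υ) (hg : Smooth E 𝔤 g) (hJ : J.IsSmooth) :
    (gaugeΥ C g J θ Υ).IsSmooth := by
  have hθ' : (gaugeθ C g J θ).IsSmooth := isSmooth_gaugeθ hD.smooth_θ hg hJ
  refine DForm.isSmooth_of_pull fun h z hh v => ?_
  have hv : v = ![v 0, v 1] := by ext i; fin_cases i <;> rfl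
  rw [hv]
  simp only [pull_two]
  have h1 : SmoothAt E E h z := hh.self_of_nhds
  refine ContDiffAt.congr_of_eventuallyEq (f := fun z => C.mdot (g (h z)) (comp₂ h Υ z (v 0) (v 1)) -
    shift C (comp₁ h (gaugeθ C g J θ)) (comp₁ h J) z (v 0) (v 1)) ?_ ?_
  · exact (C.contDiffAt_mdot_apply (ContMDiffAt.comp z (hg (h z)) h1)
      (contDiffAt_comp₂ hD.smooth_Υ h1 _ _)).sub
      (contDiffAt_shift C (contDiffAt_comp₁ hθ' h1 _) (contDiffAt_comp₁ hθ' h1 _)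
        (contDiffAt_comp₁ hJ h1 _) (contDiffAt_comp₁ hJ h1 _))
  · filter_upwards [hh] with x hx
    exact comp₂_gaugeΥ hJ hx _ _

end Chart

theorem curv_congr {a a' : V → V → 𝔤} (h : ∀ᶠ z in 𝓝 z, a z = a' z) (v w : V) :
    curv G a z v w = curv G a' z v w := by
  have e : ∀ v, (fun z => a z v) =ᶠ[𝓝 z] fun z => a' z v := fun v =>
    h.mono fun z hz => congrFun hz v
  rw [curv, curv, (e v).fderiv_eq, (e w).fderiv_eq, h.self_of_nhds]

theorem curv₃_congr {a a' : V → V → 𝔤} {B B' : V → V → V → 𝔥} (h : a z = a' z)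
    (hB : ∀ᶠ z in 𝓝 z, B z = B' z) (v₁ v₂ v₃ : V) :
    curv₃ C a B z v₁ v₂ v₃ = curv₃ C a' B' z v₁ v₂ v₃ := by
  have e : ∀ v w, (fun z => B z v w) =ᶠ[𝓝 z] fun z => B' z v w := fun v w =>
    hB.mono fun z hz => congrFun (congrFun hz v) w
  rw [curv₃, curv₃, (e v₂ v₃).fderiv_eq, (e v₁ v₃).fderiv_eq, (e v₁ v₂).fderiv_eq,
    h, hB.self_of_nhds]

/-- The transformation is a rotation by `g` followed by a shift by `J`. The rotation acts on the
curvature by `Ad`, and the shift changes it by `ṫ` of what is subtracted from the `2`-form. -/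
theorem curv_gauge_eq (hD : IsConnectionDoublet C θ Υ) (hg : Smooth E 𝔤 g) (hJ : J.IsSmooth)
    (hh : ∀ᶠ z in 𝓝 z, SmoothAt V E h z) (v w : V) :
    curv G (comp₁ h (gaugeθ C g J θ)) z v w = C.tdot (comp₂ h (gaugeΥ C g J θ Υ) z v w) := by
  have h1 : SmoothAt V E h z := hh.self_of_nhds
  have hu : SmoothAt V 𝔤 (fun z => g (h z)) z := ContMDiffAt.comp z (hg (h z)) h1
  have e : ∀ᶠ z in 𝓝 z, comp₁ h (gaugeθ C g J θ) z =
      fun v => rotate (fun z => g (h z)) (comp₁ h θ) z v - C.tdot (comp₁ h J z v) := by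
    filter_upwards [hh] with x hx
    exact funext fun v => comp₁_gaugeθ hg hx.mdAt v
  have d1 : ∀ v, DifferentiableAt ℝ (fun z => rotate (fun z => g (h z)) (comp₁ h θ) z v) z := fun v =>
    (contDiffAt_rotate hu (contDiffAt_comp₁ hD.smooth_θ h1 v)).differentiableAt (by simp)
  have d2 : ∀ v, DifferentiableAt ℝ (fun z => comp₁ h J z v) z := fun v =>
    (contDiffAt_comp₁ hJ h1 v).differentiableAt (by simp)
  have e2 : shift C (comp₁ h (gaugeθ C g J θ)) (comp₁ h J) z v w = shift C (fun z v =>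
      rotate (fun z => g (h z)) (comp₁ h θ) z v - C.tdot (comp₁ h J z v)) (comp₁ h J) z v w := by
    simp only [shift, e.self_of_nhds]
  rw [curv_congr e, comp₂_gaugeΥ hJ h1, e2, map_sub, C.tdot_mdot, ← hD.curv_eq h1,
    ← curv_rotate hu (contDiffAt_comp₁ hD.smooth_θ h1 v) (contDiffAt_comp₁ hD.smooth_θ h1 w)]
  exact curv_sub_tdot C (d1 v) (d1 w) (d2 v) (d2 w)

/-- The `2`-curvature is equivariant under the rotation and unchanged by the shift. The latter needs
the curvature equation of the rotated doublet. -/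
theorem curv₃_gauge_eq (hD : IsConnectionDoublet C θ Υ) (hg : Smooth E 𝔤 g) (hJ : J.IsSmooth)
    (hh : ∀ᶠ z in 𝓝 z, SmoothAt V E h z) (v₁ v₂ v₃ : V) :
    curv₃ C (comp₁ h (gaugeθ C g J θ)) (comp₂ h (gaugeΥ C g J θ Υ)) z v₁ v₂ v₃ =
      C.mdot (g (h z)) (curv₃ C (comp₁ h θ) (comp₂ h Υ) z v₁ v₂ v₃) := by
  have h1 : SmoothAt V E h z := hh.self_of_nhds
  have hu : SmoothAt V 𝔤 (fun z => g (h z)) z := ContMDiffAt.comp z (hg (h z)) h1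
  set a' : V → V → 𝔤 := fun z v =>
    rotate (fun z => g (h z)) (comp₁ h θ) z v - C.tdot (comp₁ h J z v) with ha'
  have e : ∀ᶠ z in 𝓝 z, comp₁ h (gaugeθ C g J θ) z = a' z := by
    filter_upwards [hh] with x hx
    exact funext fun v => comp₁_gaugeθ hg hx.mdAt v
  have e2 : ∀ᶠ z in 𝓝 z, comp₂ h (gaugeΥ C g J θ Υ) z =
      fun v w => C.mdot (g (h z)) (comp₂ h Υ z v w) - shift C a' (comp₁ h J) z v w := by
    filter_upwards [hh, e] with x hx hx'
    refine funext fun v => funext fun w => ?_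
    rw [comp₂_gaugeΥ hJ hx, shift, shift, hx']
  have hB : ∀ v w, ContDiffAt ℝ ∞ (fun z => comp₂ h Υ z v w) z := contDiffAt_comp₂ hD.smooth_Υ h1
  rw [curv₃_congr e.self_of_nhds e2, ← curv₃_rotate C (a := comp₁ h θ) hu
    ((hB _ _).differentiableAt (by simp)) ((hB _ _).differentiableAt (by simp))
    ((hB _ _).differentiableAt (by simp))]
  refine curv₃_shift C (J := comp₁ h J) (fun _ _ => rfl) (fun _ _ _ => rfl)
    (fun v => contDiffAt_rotate hu (contDiffAt_comp₁ hD.smooth_θ h1 v))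
    (fun v => contDiffAt_comp₁ hJ h1 v) (fun v w => C.contDiffAt_mdot_apply hu (hB v w)) ?_
  intro v w
  rw [curv_rotate hu (contDiffAt_comp₁ hD.smooth_θ h1 v) (contDiffAt_comp₁ hD.smooth_θ h1 w),
    hD.curv_eq h1, C.tdot_mdot]

variable [FiniteDimensional ℝ E]

theorem eventually_smoothAt_extChartAt_symm (p : M) :
    ∀ᶠ z in 𝓝 (extChartAt 𝓘(ℝ, E) p p), SmoothAt E E (extChartAt 𝓘(ℝ, E) p).symm z := by
  filter_upwards [(isOpen_extChartAt_target (I := 𝓘(ℝ, E)) p).mem_nhds (mem_extChartAt_target p)]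
    with z hz
  exact smoothAt_extChartAt_symm p hz

/-- The gauge transform of a connection doublet is a connection doublet. -/
theorem IsConnectionDoublet.gauge (hD : IsConnectionDoublet C θ Υ) (hg : Smooth E 𝔤 g)
    (hJ : J.IsSmooth) : IsConnectionDoublet C (gaugeθ C g J θ) (gaugeΥ C g J θ Υ) := by
  refine ⟨isSmooth_gaugeθ hD.smooth_θ hg hJ, isSmooth_gaugeΥ hD hg hJ, fun p => ?_⟩
  have hh := eventually_smoothAt_extChartAt_symm (E := E) p
  rw [sub_eq_zero]
  ext v
  have hv : v = ![v 0, v 1] := by ext i; fin_cases i <;> rfl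
  -- Along the inverse chart at `p`, whose differential at the centre is the identity, an identity
  -- of components is an identity of forms at `p`.
  have h1 := curv_gauge_eq hD hg hJ hh (v 0) (v 1)
  rw [curv_comp₁ (isSmooth_gaugeθ hD.smooth_θ hg hJ) hh.self_of_nhds, ← pull_two, ← pull_two,
    pull_extChartAt_symm, pull_extChartAt_symm] at h1
  rw [hv]
  exact h1

/-- The gauge transform of a flat connection doublet is flat. -/
theorem IsFlat.gauge (hF : IsFlat C θ Υ) (hD : IsConnectionDoublet C θ Υ) (hg : Smooth E 𝔤 g)
    (hJ : J.IsSmooth) : IsFlat C (gaugeθ C g J θ) (gaugeΥ C g J θ Υ) := by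
  intro p
  have hh := eventually_smoothAt_extChartAt_symm (E := E) p
  ext v
  have hv : v = ![v 0, v 1, v 2] := by ext i; fin_cases i <;> rfl
  have h1 := curv₃_gauge_eq hD hg hJ hh (v 0) (v 1) (v 2)
  rw [hF.curv₃_eq hD.smooth_Υ hh.self_of_nhds, map_zero,
    curv₃_comp C (isSmooth_gaugeΥ hD hg hJ) hh.self_of_nhds, pull_extChartAt_symm] at h1
  rw [hv]
  exact h1

end PulledDoublets

/-! ### Radial frames -/

section Rows

variable {S : Type} [NormedAddCommGroup S] [NormedSpace ℝ S]
  {F : Type*} [NormedAddCommGroup F] [NormedSpace ℝ F]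
  {𝔨 K : Type*} [NormedAddCommGroup 𝔨] [NormedSpace ℝ 𝔨] [FiniteDimensional ℝ 𝔨]
  [Group K] [TopologicalSpace K] [ChartedSpace 𝔨 K] [LieGroup 𝓘(ℝ, 𝔨) ∞ K]

variable (S) in
/-- The direction of the first coordinate. -/
abbrev dirX : ℝ × S := (1, 0)

/-- A direction of the parameters. -/
abbrev dirS (w : S) : ℝ × S := (0, w)

theorem hasDerivAt_row {f : ℝ × S → F} {x : ℝ} {s : S} (hf : DifferentiableAt ℝ f (x, s)) :
    HasDerivAt (fun x => f (x, s)) (fderiv ℝ f (x, s) (dirX S)) x := by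
  have h : HasFDerivAt (fun x => f (x, s)) _ x := hf.hasFDerivAt.comp x (hasFDerivAt_prodMk_left x s)
  have := h.hasDerivAt
  simpa using this

theorem tang_prodMk_left (x : ℝ) (s : S) : tang ℝ (ℝ × S) (fun x : ℝ => (x, s)) x 1 = dirX S := by
  rw [tang_eq_fderiv, (hasFDerivAt_prodMk_left x s).fderiv]; simp

theorem tang_prodMk_right (x : ℝ) (s w : S) :
    tang S (ℝ × S) (fun s : S => (x, s)) s w = dirS w := by
  rw [tang_eq_fderiv, (hasFDerivAt_prodMk_right x s).fderiv]; simp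

theorem mdAt_prodMk_left (x : ℝ) (s : S) : MDAt ℝ (ℝ × S) (fun x : ℝ => (x, s)) x :=
  (hasFDerivAt_prodMk_left x s).differentiableAt.mdifferentiableAt

theorem mdAt_prodMk_right (x : ℝ) (s : S) : MDAt S (ℝ × S) (fun s : S => (x, s)) s :=
  (hasFDerivAt_prodMk_right x s).differentiableAt.mdifferentiableAt

theorem mdAt_row {u : ℝ × S → K} {x : ℝ} {s : S} (hu : MDAt (ℝ × S) 𝔨 u (x, s)) :
    MDAt ℝ 𝔨 (fun x => u (x, s)) x :=
  MDAt.comp x hu (mdAt_prodMk_left x s)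

theorem rightLogDeriv_row {u : ℝ × S → K} {x : ℝ} {s : S} (hu : MDAt (ℝ × S) 𝔨 u (x, s)) :
    (rightLogDeriv (fun x => u (x, s)) x : 𝔨) = rlog (ℝ × S) 𝔨 u (x, s) (dirX S) := by
  rw [rightLogDeriv_eq, rlog_comp (h := fun x : ℝ => (x, s)) x hu (mdAt_prodMk_left x s),
    ContinuousLinearMap.comp_apply, tang_prodMk_left]

theorem mdAt_col {u : ℝ × S → K} {x : ℝ} {s : S} (hu : MDAt (ℝ × S) 𝔨 u (x, s)) :
    MDAt S 𝔨 (fun s => u (x, s)) s :=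
  MDAt.comp s hu (mdAt_prodMk_right x s)

theorem rlog_col {u : ℝ × S → K} {x : ℝ} {s : S} (hu : MDAt (ℝ × S) 𝔨 u (x, s)) (w : S) :
    rlog S 𝔨 (fun s => u (x, s)) s w = rlog (ℝ × S) 𝔨 u (x, s) (dirS w) := by
  rw [rlog_comp (h := fun s : S => (x, s)) s hu (mdAt_prodMk_right x s),
    ContinuousLinearMap.comp_apply, tang_prodMk_right]

theorem rlog_dirS_eq_zero {u : ℝ × S → K} {x : ℝ} {c : K} (h : ∀ s, u (x, s) = c) {s : S}
    (hu : MDAt (ℝ × S) 𝔨 u (x, s)) (w : S) : rlog (ℝ × S) 𝔨 u (x, s) (dirS w) = 0 := by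
  rw [← rlog_col hu]
  simp only [h, rlog_const]
  rfl

/-- A function which is constant in the first coordinate and vanishes on a hyperplane. -/
theorem eq_zero_of_fderiv_dirX {f : ℝ × S → F} (hf : Differentiable ℝ f) {x₁ : ℝ}
    (h1 : ∀ s, f (x₁, s) = 0) (h : ∀ z, fderiv ℝ f z (dirX S) = 0) (z : ℝ × S) : f z = 0 := by
  obtain ⟨x, s⟩ := z
  have hd : ∀ x, HasDerivAt (fun x => f (x, s)) 0 x := fun x => by
    have := hasDerivAt_row (hf (x, s))
    rwa [h] at this
  rw [← h1 s]
  exact is_const_of_deriv_eq_zero (fun x => (hd x).differentiableAt) (fun x => (hd x).deriv) x x₁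

/-- Uniqueness for the linear equation `∂ₓ e = [∂ₓΛ Λ⁻¹, e]`. -/
theorem eq_zero_of_fderiv_dirX_eq_ad {Λ : ℝ × S → K} (hΛ : Smooth (ℝ × S) 𝔨 Λ) {e : ℝ × S → 𝔨}
    (he : Differentiable ℝ e) {x₁ : ℝ} (h1 : ∀ s, e (x₁, s) = 0)
    (h : ∀ z, fderiv ℝ e z (dirX S) = ad K (rlog (ℝ × S) 𝔨 Λ z (dirX S)) (e z)) (z : ℝ × S) :
    e z = 0 := by
  have hd : ∀ z, MDAt (ℝ × S) 𝔨 Λ z := fun z => (hΛ z).mdifferentiableAt (by simp)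
  -- Conjugating by `Λ⁻¹` removes the bracket, so the result is constant in `x`.
  have h0 : ∀ z, Ad (Λ z)⁻¹ (e z) = 0 := by
    refine eq_zero_of_fderiv_dirX (x₁ := x₁)
      (fun z => differentiableAt_Ad_apply (u := fun z => (Λ z)⁻¹) (hd z).inv (he z))
      (fun s => by rw [h1, map_zero]) fun z => ?_
    rw [fderiv_Ad_apply (u := fun z => (Λ z)⁻¹) (hd z).inv (he z), rlog_inv (hd z), h, Ad_ad]
    simp
  rw [← Ad_apply_Ad_inv (Λ z) (e z), h0, map_zero]

end Rows

/-! ### Connection doublets in radial gauge -/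

section Frames

variable {S V : Type} [NormedAddCommGroup S] [NormedSpace ℝ S] [CompleteSpace S]
  [NormedAddCommGroup V] [NormedSpace ℝ V] {𝔤 𝔥 G H : Type*}
  [NormedAddCommGroup 𝔤] [NormedSpace ℝ 𝔤] [NormedAddCommGroup 𝔥] [NormedSpace ℝ 𝔥]
  [FiniteDimensional ℝ 𝔤] [FiniteDimensional ℝ 𝔥]
  [Group G] [TopologicalSpace G] [ChartedSpace 𝔤 G] [LieGroup 𝓘(ℝ, 𝔤) ∞ G]
  [Group H] [TopologicalSpace H] [ChartedSpace 𝔥 H] [LieGroup 𝓘(ℝ, 𝔥) ∞ H]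

/-- A connection doublet on a vector space, in components. -/
structure IsDoublet (C : LieCrossedModule 𝔤 𝔥 G H) (a : V → V → 𝔤) (B : V → V → V → 𝔥) : Prop where
  smooth₁ : ∀ v, ContDiff ℝ ∞ (fun z => a z v)
  smooth₂ : ∀ v w, ContDiff ℝ ∞ (fun z => B z v w)
  curv_eq : ∀ z v w, curv G a z v w = C.tdot (B z v w)

/-- The parallel transport `u` from `x = 1` along the first coordinate and the primitives `β` of the
parallel transported components `B_{x, w}`. -/
structure IsFrame (C : LieCrossedModule 𝔤 𝔥 G H) (a : ℝ × S → ℝ × S → 𝔤)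
    (B : ℝ × S → ℝ × S → ℝ × S → 𝔥) (u : ℝ × S → G) (β : ℝ × S → S → 𝔥) : Prop where
  smooth_u : Smooth (ℝ × S) 𝔤 u
  u_one : ∀ s, u (1, s) = 1
  rlog_u : ∀ z, rlog (ℝ × S) 𝔤 u z (dirX S) = -a z (dirX S)
  smooth_β : ∀ w, ContDiff ℝ ∞ (fun z => β z w)
  β_one : ∀ s w, β (1, s) w = 0
  fderiv_β : ∀ z w, fderiv ℝ (fun z => β z w) z (dirX S) =
    -C.mdot (u z)⁻¹ (B z (dirX S) (dirS w))

theorem contDiff_mdot_apply (C : LieCrossedModule 𝔤 𝔥 G H) {u : V → G} {f : V → 𝔥}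
    (hu : Smooth V 𝔤 u) (hf : ContDiff ℝ ∞ f) : ContDiff ℝ ∞ (fun z => C.mdot (u z) (f z)) :=
  contDiff_iff_contDiffAt.2 fun z => C.contDiffAt_mdot_apply (hu z) hf.contDiffAt

theorem Smooth.inv' {u : V → G} (hu : Smooth V 𝔤 u) : Smooth V 𝔤 (fun z => (u z)⁻¹) :=
  ContMDiff.inv hu

theorem Smooth.mdAt {u : V → G} (hu : Smooth V 𝔤 u) (z : V) : MDAt V 𝔤 u z :=
  (hu z).mdifferentiableAt (by simp)

variable {C : LieCrossedModule 𝔤 𝔥 G H} {a : ℝ × S → ℝ × S → 𝔤} {B : ℝ × S → ℝ × S → ℝ × S → 𝔥}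

theorem exists_frame (ha : ContDiff ℝ ∞ (fun z => a z (dirX S)))
    (hB : ∀ w, ContDiff ℝ ∞ (fun z => B z (dirX S) (dirS w))) :
    ∃ u β, IsFrame C a B u β := by
  have : CompleteSpace 𝔥 := FiniteDimensional.complete ℝ 𝔥
  obtain ⟨u, hu, hu1, hus⟩ := exists_smooth_solution (K := G) (fun z => -a z (dirX S)) ha.neg 1
  choose β hβ hβ1 hβd using fun w : S => exists_primitive
    (fun z => -C.mdot (u z)⁻¹ (B z (dirX S) (dirS w)))
    (contDiff_mdot_apply C hu.inv' (hB w)).neg 1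
  refine ⟨u, fun z w => β w z, hu, hu1, fun z => ?_, hβ, fun s w => hβ1 w s, fun z w => ?_⟩
  · rw [← rightLogDeriv_row (hu.mdAt z)]
    exact (hus z.2 z.1 (Set.mem_univ _)).2
  · exact (hasDerivAt_row ((hβ w).differentiable (by simp) (z.1, z.2))).unique (hβd w z.1 z.2)

namespace IsFrame

variable {u : ℝ × S → G} {β : ℝ × S → S → 𝔥}

theorem row (hf : IsFrame C a B u β) (s : S) :
    IsParallelSolution (fun x => a (x, s) (dirX S)) 1 (fun x => u (x, s)) :=
  ⟨ContMDiff.comp (g := u) hf.smooth_u (contDiff_prodMk_left s).contMDiff, hf.u_one s, fun x => by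
    rw [rightLogDeriv_row (hf.smooth_u.mdAt _), hf.rlog_u]⟩

theorem hasDerivAt_β (hf : IsFrame C a B u β) (x : ℝ) (s w : S) :
    HasDerivAt (fun x => β (x, s) w) (-C.mdot (u (x, s))⁻¹ (B (x, s) (dirX S) (dirS w))) x := by
  rw [← hf.fderiv_β (x, s) w]
  exact hasDerivAt_row (f := fun z => β z w) ((hf.smooth_β w).differentiable (by simp) _)

theorem rotate_dirX (hf : IsFrame C a B u β) (z : ℝ × S) :
    rotate (fun z => (u z)⁻¹) a z (dirX S) = 0 := by
  rw [rotate, rlog_inv (hf.smooth_u.mdAt z)]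
  simp [hf.rlog_u]

/-- In the gauge `u⁻¹` the component along `x` vanishes, so the curvature with one leg along `x` is
just `∂ₓ` of the component along `w`. By the curvature equation this is `ṫ(ṁ(u⁻¹) B_{xw}) = -∂ₓ
ṫ(β_w)`, and both sides of the claim vanish at `x = 1`. -/
theorem rotate_dirS (hf : IsFrame C a B u β) (hD : IsDoublet C a B)
    (h1 : ∀ s w, a (1, s) (dirS w) = 0) (z : ℝ × S) (w : S) :
    rotate (fun z => (u z)⁻¹) a z (dirS w) = -C.tdot (β z w) := by
  have hc : ∀ v z, ContDiffAt ℝ ∞ (fun z => rotate (fun z => (u z)⁻¹) a z v) z := fun v z =>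
    contDiffAt_rotate (hf.smooth_u.inv' z) (hD.smooth₁ v).contDiffAt
  have hβ : ∀ z, DifferentiableAt ℝ (fun z => β z w) z := (hf.smooth_β w).differentiable (by simp)
  have d1 : ∀ z, DifferentiableAt ℝ (fun z => rotate (fun z => (u z)⁻¹) a z (dirS w)) z := fun z =>
    (hc _ z).differentiableAt (by simp)
  have d2 : ∀ z, DifferentiableAt ℝ (fun z => C.tdot (β z w)) z := fun z =>
    C.tdot.differentiableAt.comp z (hβ z)
  rw [eq_neg_iff_add_eq_zero]
  refine eq_zero_of_fderiv_dirX (f := fun z => rotate (fun z => (u z)⁻¹) a z (dirS w) +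
    C.tdot (β z w)) (x₁ := 1) (fun z => (d1 z).add (d2 z)) (fun s => ?_) (fun z => ?_) z
  · rw [rotate, rlog_inv (hf.smooth_u.mdAt _)]
    simp [h1, hf.β_one, rlog_dirS_eq_zero hf.u_one (hf.smooth_u.mdAt _) w]
  · have h2 := curv_rotate (hf.smooth_u.inv' z) (hD.smooth₁ (dirX S)).contDiffAt
      (hD.smooth₁ (dirS w)).contDiffAt
    rw [hD.curv_eq, ← C.tdot_mdot, curv] at h2
    simp only [hf.rotate_dirX, map_zero, fderiv_fun_const] at h2
    rw [fderiv_fun_add (d1 z) (d2 z), add_apply, fderiv_clm_apply_comp _ (hβ z), hf.fderiv_β, map_neg,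
      ← h2]
    simp

/-- The primitives satisfy the zero curvature equation if the `2`-curvature vanishes. -/
theorem curl_β (hf : IsFrame C a B u β) (hD : IsDoublet C a B)
    (h1 : ∀ s w, a (1, s) (dirS w) = 0) (hB1 : ∀ s w w', B (1, s) (dirS w) (dirS w') = 0)
    (h3 : ∀ z w w', curv₃ C a B z (dirX S) (dirS w) (dirS w') = 0) (z : ℝ × S) (w w' : S) :
    fderiv ℝ (fun z => β z w') z (dirS w) - fderiv ℝ (fun z => β z w) z (dirS w') =
      ad H (β z w) (β z w') - C.mdot (u z)⁻¹ (B z (dirS w) (dirS w')) := by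
  have hB : ∀ v w z, ContDiffAt ℝ ∞ (fun z => C.mdot (u z)⁻¹ (B z v w)) z := fun v w z =>
    C.contDiffAt_mdot_apply (hf.smooth_u.inv' z) (hD.smooth₂ v w).contDiffAt
  have hβ : ∀ w z, ContDiffAt ℝ ∞ (fun z => β z w) z := fun w z => (hf.smooth_β w).contDiffAt
  have dβ : ∀ w z, DifferentiableAt ℝ (fun z => β z w) z := fun w z =>
    (hβ w z).differentiableAt (by simp)
  have dB := fun v w z => (hB v w z).differentiableAt (by simp)
  have d1 := fun v w z => (contDiffAt_fderiv_apply (hβ w z) v).differentiableAt (by simp)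
  have d2 := (fun z => (contDiffAt_bilin (ad H) (hβ w z) (hβ w' z)).differentiableAt (by simp))
  rw [← sub_eq_zero]
  refine eq_zero_of_fderiv_dirX (f := fun z => fderiv ℝ (fun z => β z w') z (dirS w) -
    fderiv ℝ (fun z => β z w) z (dirS w') -
      (ad H (β z w) (β z w') - C.mdot (u z)⁻¹ (B z (dirS w) (dirS w')))) (x₁ := 1)
    (fun z => ((d1 _ _ z).sub (d1 _ _ z)).sub ((d2 z).sub (dB _ _ z))) (fun s => ?_) (fun z => ?_) z
  · have e : ∀ w w', fderiv ℝ (fun z => β z w) (1, s) (dirS w') = 0 := fun w w' => by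
      have h : HasFDerivAt (fun s => β (1, s) w) _ s :=
        (dβ w (1, s)).hasFDerivAt.comp s (hasFDerivAt_prodMk_right 1 s)
      have h' := h.fderiv
      simp only [hf.β_one, fderiv_fun_const] at h'
      have := congrArg (fun A : S →L[ℝ] 𝔥 => A w') h'
      simpa using this.symm
    simp [e, hf.β_one, hB1]
  -- In radial gauge the vanishing `2`-curvature has no `m̂(a_x)` term, `B_{xw}` becomes `-∂ₓ β_w`,
  -- and `m̂(a_w)` becomes `-[β_w, ·]`. It then says that the difference of the two sides is
  -- constant in `x`.
  · have h4 := curv₃_rotate C (a := a) (B := B) (u := fun z => (u z)⁻¹) (z := z) (v₁ := dirX S)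
      (v₂ := dirS w) (v₃ := dirS w') (hf.smooth_u.inv' z)
      ((hD.smooth₂ _ _).differentiable (by simp) z) ((hD.smooth₂ _ _).differentiable (by simp) z)
      ((hD.smooth₂ _ _).differentiable (by simp) z)
    rw [h3, map_zero, curv₃, hf.rotate_dirX, hf.rotate_dirS hD h1, hf.rotate_dirS hD h1] at h4
    have e : ∀ w, (fun z => C.mdot (u z)⁻¹ (B z (dirX S) (dirS w))) =
        fun z => -fderiv ℝ (fun z => β z w) z (dirX S) := fun w => by
      ext z; rw [hf.fderiv_β, neg_neg]
    have e' : ∀ w, C.mdot (u z)⁻¹ (B z (dirX S) (dirS w)) =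
        -fderiv ℝ (fun z => β z w) z (dirX S) := fun w => congrFun (e w) z
    rw [e, e, e', e', fderiv_fun_neg, fderiv_fun_neg] at h4
    simp only [map_neg, map_zero, zero_apply, neg_apply, C.mhat_tdot,
      fderiv_fderiv_symm (hβ _ z) (dirX S)] at h4
    have h : HasFDerivAt (fun z => fderiv ℝ (fun z => β z w') z (dirS w) -
      fderiv ℝ (fun z => β z w) z (dirS w') -
      (ad H (β z w) (β z w') - C.mdot (u z)⁻¹ (B z (dirS w) (dirS w')))) _ z :=
      ((d1 (dirS w) w' z).hasFDerivAt.sub (d1 (dirS w') w z).hasFDerivAt).sub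
        ((d2 z).hasFDerivAt.sub (dB (dirS w) (dirS w') z).hasFDerivAt)
    rw [h.fderiv]
    simp only [sub_apply, fderiv_bilin (ad H) (dβ w z) (dβ w' z)]
    have h5 := ad_swap (G := H) (fderiv ℝ (fun z => β z w) z (dirX S)) (β z w')
    linear_combination (norm := module) h4 - h5

end IsFrame

end Frames

/-! ### Flat connections on the plane -/

section FlatPlane

variable {𝔨 K : Type*} [NormedAddCommGroup 𝔨] [NormedSpace ℝ 𝔨] [FiniteDimensional ℝ 𝔨]
  [Group K] [TopologicalSpace K] [ChartedSpace 𝔨 K] [LieGroup 𝓘(ℝ, 𝔨) ∞ K]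

/-- The holonomy of a flat connection along the first coordinate does not depend on the second one
if the connection is trivial on the two sides. -/
theorem flat_holonomy_eq {q r : ℝ × ℝ → 𝔨} (hq : ContDiff ℝ ∞ q) (hr : ContDiff ℝ ∞ r)
    (hF : ∀ z, fderiv ℝ r z (dirX ℝ) - fderiv ℝ q z (dirS 1) = ad K (q z) (r z))
    (h0 : ∀ t, r (0, t) = 0) (h1 : ∀ t, r (1, t) = 0) {w : ℝ → ℝ → K} (hw1 : ∀ t, w t 0 = 1)
    (hw : ∀ t, SolvesOn (fun y => q (y, t)) (w t) Set.univ) (t t' : ℝ) : w t 1 = w t' 1 := by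
  obtain ⟨W, hW, hW1, hWs⟩ := exists_smooth_solution (K := K) q hq 0
  have hWw : ∀ t, w t 1 = W (1, t) := fun t =>
    congrFun (SolvesOn.eq (hw t) (hWs t) (x := 0) (by rw [hw1, hW1])) 1
  have hd : ∀ z, MDAt (ℝ × ℝ) 𝔨 W z := fun z => (hW z).mdifferentiableAt (by simp)
  have hX : ∀ z, rlog (ℝ × ℝ) 𝔨 W z (dirX ℝ) = q z := fun z => by
    rw [← rightLogDeriv_row (x := z.1) (s := z.2) (hd z)]
    exact (hWs z.2 z.1 (Set.mem_univ _)).2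
  have d1 : ∀ z, DifferentiableAt ℝ (fun z => rlog (ℝ × ℝ) 𝔨 W z (dirS 1)) z := fun z =>
    ((contDiffAt_rlog (hW z)).clm_apply contDiffAt_const).differentiableAt (by simp)
  have d2 : Differentiable ℝ r := hr.differentiable (by simp)
  -- Subtracting flatness from the Maurer-Cartan equation of `W` gives `∂ₓ e = [q, e]` for this
  -- defect, which vanishes on the initial line. So `W` also solves the equation in the second
  -- direction, and there `r = 0` on the line `x = 1`.
  have key : ∀ z, rlog (ℝ × ℝ) 𝔨 W z (dirS 1) - r z = 0 := by
    refine eq_zero_of_fderiv_dirX_eq_ad (e := fun z => rlog (ℝ × ℝ) 𝔨 W z (dirS 1) - r z) hW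
      (x₁ := 0) (fun z => (d1 z).sub (d2 z)) (fun s => ?_) (fun z => ?_)
    · rw [h0, rlog_dirS_eq_zero hW1 (hd _), sub_zero]
    · have h2 := maurerCartan_eq (hW z) (dirX ℝ) (dirS 1)
      have h3 := hF z
      simp only [hX] at h2
      rw [fderiv_fun_sub (d1 z) (d2 z), hX, sub_apply, map_sub]
      linear_combination (norm := module) h2 - h3
  rw [hWw, hWw]
  refine eq_of_rlog_eq_zero (𝔨 := 𝔨) (u := fun t => W (1, t)) isOpen_univ isPreconnected_univ
    (fun t _ => ⟨mdAt_col (hd _), ?_⟩) (Set.mem_univ t) (Set.mem_univ t')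
  ext
  rw [rlog_col (hd _), sub_eq_zero.1 (key _), h1]
  rfl

end FlatPlane

/-! ### Gauge transformations in radial gauge -/

section GaugeFrames

variable {S V : Type} [NormedAddCommGroup S] [NormedSpace ℝ S] [CompleteSpace S]
  [NormedAddCommGroup V] [NormedSpace ℝ V] {𝔤 𝔥 G H : Type*}
  [NormedAddCommGroup 𝔤] [NormedSpace ℝ 𝔤] [NormedAddCommGroup 𝔥] [NormedSpace ℝ 𝔥]
  [FiniteDimensional ℝ 𝔤] [FiniteDimensional ℝ 𝔥]
  [Group G] [TopologicalSpace G] [ChartedSpace 𝔤 G] [LieGroup 𝓘(ℝ, 𝔤) ∞ G]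
  [Group H] [TopologicalSpace H] [ChartedSpace 𝔥 H] [LieGroup 𝓘(ℝ, 𝔥) ∞ H]
  {C : LieCrossedModule 𝔤 𝔥 G H}

/-- Gauge covariance of `dJ + ½[J,J] + m̂(a, J)`. -/
theorem shift_rotate {k : V → G} {a : V → V → 𝔤} {J : V → V → 𝔥} {z : V} (hk : MDAt V 𝔤 k z)
    (hJ : ∀ v, DifferentiableAt ℝ (fun z => J z v) z) (v w : V) :
    shift C (rotate k a) (fun z v => C.mdot (k z) (J z v)) z v w =
      C.mdot (k z) (shift C a J z v w) := by
  simp only [shift, curl, rotate]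
  rw [C.fderiv_mdot_apply hk (hJ v), C.fderiv_mdot_apply hk (hJ w)]
  simp only [map_add, map_sub, C.mdot_ad, C.mdot_mhat, sub_apply]
  module

namespace IsFrame

variable {a a' : ℝ × S → ℝ × S → 𝔤} {B B' : ℝ × S → ℝ × S → ℝ × S → 𝔥} {u u' : ℝ × S → G}
  {β β' : ℝ × S → S → 𝔥} {κ : ℝ × S → G} {J : ℝ × S → ℝ × S → 𝔥} {Λ : ℝ × S → H} {c : G}

/-- The gauge transformation of the parallel transport. -/
theorem gauge_u (hf : IsFrame C a B u β) (hf' : IsFrame C a' B' u' β')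
    (hκ : Smooth (ℝ × S) 𝔤 κ) (hκ1 : ∀ s, κ (1, s) = c)
    (ha' : ∀ z v, a' z v = rotate κ a z v - C.tdot (J z v))
    (hΛ : Smooth (ℝ × S) 𝔥 Λ) (hΛ1 : ∀ s, Λ (1, s) = 1)
    (hΛJ : ∀ z, rlog (ℝ × S) 𝔥 Λ z (dirX S) =
      -Ad (Λ z) (C.mdot ((u z)⁻¹ * (κ z)⁻¹) (J z (dirX S)))) (z : ℝ × S) :
    u' z = κ z * u z * (C.t (Λ z))⁻¹ * c⁻¹ := by
  have hΛd : ∀ z, MDAt (ℝ × S) 𝔥 Λ z := fun z => (hΛ z).mdifferentiableAt (by simp)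
  have ht : ∀ z, MDAt (ℝ × S) 𝔤 (fun z => (C.t (Λ z))⁻¹) z := fun z =>
    MDAt.inv (p := fun z => C.t (Λ z)) (MDAt.comp z (C.mdAt_t _) (hΛd z))
  have hm : ∀ z, MDAt (ℝ × S) 𝔤 (fun z => κ z * u z * (C.t (Λ z))⁻¹ * c⁻¹) z := fun z =>
    (((hκ.mdAt z).mul (hf.smooth_u.mdAt z)).mul (ht z)).mul (.const _ _)
  obtain ⟨x, s⟩ := z
  -- Both sides solve the parallel transport equation of `a'` along the row and are `1` at `x = 1`.
  refine congrFun (SolvesOn.eq (b := fun x => -a' (x, s) (dirX S)) (u := fun x => u' (x, s))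
    (w := fun x => κ (x, s) * u (x, s) * (C.t (Λ (x, s)))⁻¹ * c⁻¹) (x := 1) ?_ ?_ ?_) x
  · exact fun x _ => ⟨mdAt_row (hf'.smooth_u.mdAt _), (hf'.row s).2.2 x⟩
  · intro x _
    refine ⟨mdAt_row (hm (x, s)), ?_⟩
    change _ = -a' (x, s) (dirX S)
    rw [rightLogDeriv_row (hm (x, s)), rlog_mul_const,
      rlog_mul ((hκ.mdAt (x, s)).mul (hf.smooth_u.mdAt (x, s))) (ht _),
      rlog_mul (hκ.mdAt (x, s)) (hf.smooth_u.mdAt (x, s)),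
      rlog_inv (u := fun z => C.t (Λ z)) (MDAt.comp (x, s) (C.mdAt_t _) (hΛd (x, s))),
      C.rlog_t (hΛd _), ha', rotate]
    simp only [add_apply, neg_apply, ContinuousLinearMap.comp_apply, hf.rlog_u, hΛJ, map_neg, neg_neg,
      ← C.tdot_mdot, ← C.mdot_t, ← C.mdot_mul_apply]
    -- The factors accumulated in front of `J_x` cancel, leaving the term `ṫ(J_x)` of the gauge
    -- transformed connection.
    have e : κ (x, s) * u (x, s) * (C.t (Λ (x, s)))⁻¹ * C.t (Λ (x, s)) *
        ((u (x, s))⁻¹ * (κ (x, s))⁻¹) = 1 := by group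
    simp only [← mul_assoc] at e ⊢
    rw [e, C.mdot_one_apply]
    abel
  · simp [hκ1, hf.u_one, hf'.u_one, hΛ1]

/-- The gauge transformation of the primitives. -/
theorem gauge_β (hf : IsFrame C a B u β) (hf' : IsFrame C a' B' u' β') (hD' : IsDoublet C a' B')
    (hκ : Smooth (ℝ × S) 𝔤 κ) (hκ1 : ∀ s, κ (1, s) = c)
    (ha' : ∀ z v, a' z v = rotate κ a z v - C.tdot (J z v))
    (hB' : ∀ z v w, B' z v w = C.mdot (κ z) (B z v w) - shift C a' J z v w)
    (hJ : ∀ v, ContDiff ℝ ∞ (fun z => J z v))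
    (ha1 : ∀ s w, a' (1, s) (dirS w) = 0) (hJ1 : ∀ s w, J (1, s) (dirS w) = 0)
    (hΛ : Smooth (ℝ × S) 𝔥 Λ) (hΛ1 : ∀ s, Λ (1, s) = 1)
    (hΛJ : ∀ z, rlog (ℝ × S) 𝔥 Λ z (dirX S) =
      -Ad (Λ z) (C.mdot ((u z)⁻¹ * (κ z)⁻¹) (J z (dirX S)))) (z : ℝ × S) (w : S) :
    C.mdot c⁻¹ (β' z w) = Ad (Λ z) (β z w) +
      C.mdot (C.t (Λ z) * (u z)⁻¹ * (κ z)⁻¹) (J z (dirS w)) + rlog (ℝ × S) 𝔥 Λ z (dirS w) := by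
  have hΛd : ∀ z, MDAt (ℝ × S) 𝔥 Λ z := fun z => (hΛ z).mdifferentiableAt (by simp)
  -- `k` is the radial gauge of the primed doublet up to the constant `c⁻¹`; by `gauge_u` it also
  -- equals `t(Λ) u⁻¹ κ⁻¹`, which connects the two frames.
  set k : ℝ × S → G := fun z => c⁻¹ * (u' z)⁻¹ with hk
  have hks : Smooth (ℝ × S) 𝔤 k := ContMDiff.mul contMDiff_const hf'.smooth_u.inv'
  have hkeq : ∀ z, k z = C.t (Λ z) * (u z)⁻¹ * (κ z)⁻¹ := fun z => by
    rw [hk]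
    simp only
    rw [gauge_u hf hf' hκ hκ1 ha' hΛ hΛ1 hΛJ z]
    group
  have hrot : ∀ z v, rotate k a' z v = Ad c⁻¹ (rotate (fun z => (u' z)⁻¹) a' z v) := fun z v => by
    rw [rotate, rotate, hk, rlog_mul (.const _ _) (hf'.smooth_u.inv'.mdAt z), rlog_const, Ad_mul]
    simp
  have hrx : ∀ z, rotate k a' z (dirX S) = 0 := fun z => by
    rw [hrot, hf'.rotate_dirX, map_zero]
  have hrs : ∀ z w, rotate k a' z (dirS w) = -C.tdot (C.mdot c⁻¹ (β' z w)) := fun z w => by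
    rw [hrot, hf'.rotate_dirS hD' ha1, map_neg, C.tdot_mdot]
  set j : ℝ × S → ℝ × S → 𝔥 := fun z v => C.mdot (k z) (J z v) with hj
  have hjs : ∀ v z, ContDiffAt ℝ ∞ (fun z => j z v) z := fun v z =>
    C.contDiffAt_mdot_apply (hks z) (hJ v).contDiffAt
  have hjd : ∀ v z, DifferentiableAt ℝ (fun z => j z v) z := fun v z =>
    (hjs v z).differentiableAt (by simp)
  -- The equation of `Λ` says that the rotated `J` and `dΛ Λ⁻¹` cancel along `x`.
  have hjx : ∀ z, j z (dirX S) = -rlog (ℝ × S) 𝔥 Λ z (dirX S) := fun z => by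
    rw [hΛJ, neg_neg, ← C.mdot_t, ← C.mdot_mul_apply, hj]
    simp only [hkeq, mul_assoc]
  have dβ : ∀ z, DifferentiableAt ℝ (fun z => β z w) z := (hf.smooth_β w).differentiable (by simp)
  have dβ' : ∀ z, DifferentiableAt ℝ (fun z => β' z w) z := (hf'.smooth_β w).differentiable (by simp)
  have dr : ∀ v z, DifferentiableAt ℝ (fun z => rlog (ℝ × S) 𝔥 Λ z v) z := fun v z =>
    ((contDiffAt_rlog (hΛ z)).clm_apply contDiffAt_const).differentiableAt (by simp)
  have d1 : ∀ z, DifferentiableAt ℝ (fun z => C.mdot c⁻¹ (β' z w)) z := fun z =>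
    (C.mdot c⁻¹).differentiableAt.comp z (dβ' z)
  have d2 : ∀ z, DifferentiableAt ℝ (fun z => Ad (Λ z) (β z w)) z := fun z =>
    differentiableAt_Ad_apply (hΛd z) (dβ z)
  -- The defect satisfies `∂ₓ e = [∂ₓΛ Λ⁻¹, e]`: the derivative of `β'` involves the shift of `J`,
  -- evaluated in the gauge `k`, and the derivative of `dΛ Λ⁻¹` comes from the Maurer-Cartan
  -- equation.
  have key : ∀ z, C.mdot c⁻¹ (β' z w) -
      (Ad (Λ z) (β z w) + j z (dirS w) + rlog (ℝ × S) 𝔥 Λ z (dirS w)) = 0 := by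
    refine eq_zero_of_fderiv_dirX_eq_ad (e := fun z => C.mdot c⁻¹ (β' z w) -
      (Ad (Λ z) (β z w) + j z (dirS w) + rlog (ℝ × S) 𝔥 Λ z (dirS w))) hΛ
      (x₁ := 1) (fun z => (d1 z).sub (((d2 z).add (hjd _ z)).add (dr _ z))) (fun s => ?_) (fun z => ?_)
    · simp [hf'.β_one, hf.β_one, hj, hJ1, rlog_dirS_eq_zero hΛ1 (hΛd _)]
    · have h1 := shift_rotate (C := C) (a := a') (hks.mdAt z)
        (fun v => (hJ v).differentiable (by simp) z) (dirX S) (dirS w)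
      have h2 : C.mdot c⁻¹ (fderiv ℝ (fun z => β' z w) z (dirX S)) =
          Ad (Λ z) (fderiv ℝ (fun z => β z w) z (dirX S)) +
            C.mdot (k z) (shift C a' J z (dirX S) (dirS w)) := by
        have e1 : k z * κ z = C.t (Λ z) * (u z)⁻¹ := by rw [hkeq]; group
        rw [hf.fderiv_β, hf'.fderiv_β, hB', ← C.mdot_t]
        simp only [map_neg, map_sub, ← C.mdot_mul_apply, ← e1, hk, mul_assoc]
        abel
      have h3 := maurerCartan_eq (hΛ z) (dirX S) (dirS w)
      rw [← h1, shift, hrx, hrs] at h2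
      simp only [curl, map_zero, zero_apply, map_neg, neg_apply, C.mhat_tdot] at h2
      change _ = _ + (fderiv ℝ (fun z => j z (dirS w)) z (dirX S) -
        fderiv ℝ (fun z => j z (dirX S)) z (dirS w) + ad H (j z (dirX S)) (j z (dirS w)) +
          (0 - -ad H (C.mdot c⁻¹ (β' z w)) (j z (dirX S)))) at h2
      simp only [hjx, fderiv_fun_neg, neg_apply, map_neg] at h2
      have h : HasFDerivAt (fun z => C.mdot c⁻¹ (β' z w) -
        (Ad (Λ z) (β z w) + j z (dirS w) + rlog (ℝ × S) 𝔥 Λ z (dirS w))) _ z :=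
        (d1 z).hasFDerivAt.sub
          (((d2 z).hasFDerivAt.add (hjd _ z).hasFDerivAt).add (dr _ z).hasFDerivAt)
      rw [h.fderiv]
      simp only [sub_apply, add_apply, fderiv_clm_apply_comp (C.mdot c⁻¹) (dβ' z),
        fderiv_Ad_apply (hΛd z) (dβ z), map_sub, map_add]
      have h4 := ad_swap (G := H) (rlog (ℝ × S) 𝔥 Λ z (dirX S)) (C.mdot c⁻¹ (β' z w))
      linear_combination (norm := module) h2 - h3 - h4
  have := key z
  rw [sub_eq_zero] at this
  rw [this, hj]
  simp only [hkeq]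

end IsFrame

end GaugeFrames

/-! ### Well-posedness -/

section ParallelSolutions

variable {𝔨 K : Type*} [NormedAddCommGroup 𝔨] [NormedSpace ℝ 𝔨] [FiniteDimensional ℝ 𝔨]
  [Group K] [TopologicalSpace K] [ChartedSpace 𝔨 K] [LieGroup 𝓘(ℝ, 𝔨) ∞ K]
  {a : ℝ → 𝔨} {x₀ : ℝ} {u : ℝ → K}

theorem IsParallelSolution.solvesOn (hu : IsParallelSolution a x₀ u) :
    SolvesOn (fun x => -a x) u Set.univ := fun x _ =>
  ⟨(hu.1 x).mdifferentiableAt (by simp), hu.2.2 x⟩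

theorem parSol_eq (hu : IsParallelSolution a x₀ u) : parSol K a x₀ = u := by
  have h : IsParallelSolution a x₀ (parSol K a x₀) := Classical.epsilon_spec ⟨u, hu⟩
  exact SolvesOn.eq h.solvesOn hu.solvesOn (x := x₀) (by rw [h.2.1, hu.2.1])

theorem isParallelSolution_parSol (ha : ContDiff ℝ ∞ a) (x₀ : ℝ) :
    IsParallelSolution a x₀ (parSol K a x₀) :=
  Classical.epsilon_spec (existsUnique_parallelSolution a x₀ ha).exists

theorem IsParallelSolution.mul_const (hu : IsParallelSolution a x₀ u) (x₁ : ℝ) :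
    IsParallelSolution a x₁ (fun x => u x * (u x₁)⁻¹) :=
  ⟨ContMDiff.mul hu.1 contMDiff_const, by simp,
    fun x => (hu.solvesOn.mul_const _ x (Set.mem_univ x)).2⟩

/-- The transport along `[0, 1]` in terms of the solution based at the end point. -/
theorem parSol_zero_one (hu : IsParallelSolution a 1 u) : parSol K a 0 1 = (u 0)⁻¹ := by
  simp only [parSol_eq (hu.mul_const 0), hu.2.1, one_mul]

theorem leftLogDeriv_eq {Λ : ℝ → K} {x : ℝ} (hΛ : MDAt ℝ 𝔨 Λ x) :
    (leftLogDeriv Λ x : 𝔨) = -rightLogDeriv (fun x => (Λ x)⁻¹) x := by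
  have h1 : rlog ℝ 𝔨 (fun s => (Λ x)⁻¹ * Λ s) x = (Ad (Λ x)⁻¹).comp (rlog ℝ 𝔨 Λ x) := by
    rw [rlog_mul (.const _ _) hΛ, rlog_const, zero_add]
  have h2 : rlog ℝ 𝔨 (fun s => (Λ x)⁻¹ * Λ s) x = tang ℝ 𝔨 (fun s => (Λ x)⁻¹ * Λ s) x := by
    rw [rlog]
    congr 1
    ext s
    simp
  rw [leftLogDeriv, ← h2, h1, rightLogDeriv_eq, rlog_inv hΛ]
  simp

end ParallelSolutions

/-! ### Unique solvability of the surface and gauge equations -/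

section WellPosed

variable {E M 𝔤 𝔥 G H : Type*}
  [NormedAddCommGroup E] [NormedSpace ℝ E]
  [TopologicalSpace M] [ChartedSpace E M] [IsManifold 𝓘(ℝ, E) ∞ M]
  [NormedAddCommGroup 𝔤] [NormedSpace ℝ 𝔤] [NormedAddCommGroup 𝔥] [NormedSpace ℝ 𝔥]
  [FiniteDimensional ℝ 𝔤] [FiniteDimensional ℝ 𝔥]
  [Group G] [TopologicalSpace G] [ChartedSpace 𝔤 G] [LieGroup 𝓘(ℝ, 𝔤) ∞ G]
  [Group H] [TopologicalSpace H] [ChartedSpace 𝔥 H] [LieGroup 𝓘(ℝ, 𝔥) ∞ H]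
  {C : LieCrossedModule 𝔤 𝔥 G H} {θ : DForm E M 𝔤 1} {Υ : DForm E M 𝔥 2} {J : DForm E M 𝔥 1}
  {g : M → G} {p q : M}
  {F : Type*} [NormedAddCommGroup F] [NormedSpace ℝ F] [FiniteDimensional ℝ F]
  {V : Type*} [NormedAddCommGroup V] [NormedSpace ℝ V] [FiniteDimensional ℝ V]

theorem contDiff_comp₁ {α : DForm E M F 1} (hα : α.IsSmooth) {h : V → M} (hh : Smooth V E h) (v : V) :
    ContDiff ℝ ∞ (fun z => comp₁ h α z v) :=
  contDiff_iff_contDiffAt.2 fun z => contDiffAt_comp₁ hα (hh z) v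

theorem contDiff_comp₂ {α : DForm E M F 2} (hα : α.IsSmooth) {h : V → M} (hh : Smooth V E h)
    (v w : V) : ContDiff ℝ ∞ (fun z => comp₂ h α z v w) :=
  contDiff_iff_contDiffAt.2 fun z => contDiffAt_comp₂ hα (hh z) v w

theorem contDiff_curve_pull {α : DForm E M F 1} (hα : α.IsSmooth) (γ : Curve E p q) :
    ContDiff ℝ ∞ (γ.pull α) := contDiff_comp₁ hα γ.smooth 1

theorem IsConnectionDoublet.isDoublet {V : Type} [NormedAddCommGroup V] [NormedSpace ℝ V]
    [FiniteDimensional ℝ V] (hD : IsConnectionDoublet C θ Υ) {h : V → M} (hh : Smooth V E h) :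
    IsDoublet C (comp₁ h θ) (comp₂ h Υ) :=
  ⟨contDiff_comp₁ hD.smooth_θ hh, contDiff_comp₂ hD.smooth_Υ hh, fun z => hD.curv_eq (hh z)⟩

theorem IsConnectionDoublet.exists_frame {S : Type} [NormedAddCommGroup S] [NormedSpace ℝ S]
    [FiniteDimensional ℝ S] (hD : IsConnectionDoublet C θ Υ) {h : ℝ × S → M}
    (hh : Smooth (ℝ × S) E h) :
    ∃ u β, IsFrame C (comp₁ h θ) (comp₂ h Υ) u β :=
  have : CompleteSpace S := FiniteDimensional.complete ℝ S
  HigherTransport.exists_frame (contDiff_comp₁ hD.smooth_θ hh _)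
    (fun _ => contDiff_comp₂ hD.smooth_Υ hh _ _)

/-- The equation for the gauge transformation along curves in terms of the inverse. -/
theorem isGaugeSolution_iff {γ : Curve E p q} {x₀ : ℝ} {Λ : ℝ → H} :
    IsGaugeSolution C θ g J γ x₀ Λ ↔ Smooth ℝ 𝔥 (fun x => (Λ x)⁻¹) ∧ (Λ x₀)⁻¹ = 1 ∧
      SolvesOn (fun x => C.mdot ((parSol G (γ.pull θ) x₀ x)⁻¹ * (g (γ.toFun x))⁻¹) (γ.pull J x))
        (fun x => (Λ x)⁻¹) Set.univ := by
  constructor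
  · rintro ⟨h1, h2, h3⟩
    refine ⟨ContMDiff.inv h1, by simp [h2], fun x _ => ⟨MDAt.inv ((h1 x).mdifferentiableAt (by simp)), ?_⟩⟩
    rw [← neg_inj, ← leftLogDeriv_eq ((h1 x).mdifferentiableAt (by simp)), h3]
  · rintro ⟨h1, h2, h3⟩
    have h4 : Smooth ℝ 𝔥 Λ := by simpa using ContMDiff.inv h1
    refine ⟨h4, by simpa using h2, fun x => ?_⟩
    rw [leftLogDeriv_eq ((h4 x).mdifferentiableAt (by simp)), (h3 x (Set.mem_univ x)).2]

theorem existsUnique_gaugeSolution (C : LieCrossedModule 𝔤 𝔥 G H) (hθ : θ.IsSmooth)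
    (hg : Smooth E 𝔤 g) (hJ : J.IsSmooth) (γ : Curve E p q) (x₀ : ℝ) :
    ∃! Λ : ℝ → H, IsGaugeSolution C θ g J γ x₀ Λ := by
  have hs : ContDiff ℝ ∞
      (fun x => C.mdot ((parSol G (γ.pull θ) x₀ x)⁻¹ * (g (γ.toFun x))⁻¹) (γ.pull J x)) := by
    have h1 := (isParallelSolution_parSol (K := G) (contDiff_curve_pull hθ γ) x₀).1
    have h2 : Smooth ℝ 𝔤 (fun x => g (γ.toFun x)) := ContMDiff.comp hg γ.smooth
    exact contDiff_mdot_apply C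
      (u := fun x => (parSol G (γ.pull θ) x₀ x)⁻¹ * (g (γ.toFun x))⁻¹)
      (ContMDiff.mul h1.inv' h2.inv') (contDiff_curve_pull hJ γ)
  obtain ⟨μ, hμ1, hμ⟩ := exists_solution (K := H) _ hs x₀
  refine ⟨fun x => (μ x)⁻¹, ?_, fun Λ hΛ => ?_⟩
  · beta_reduce
    rw [isGaugeSolution_iff]
    simp only [inv_inv]
    exact ⟨smooth_of_solvesOn hs hμ, hμ1, hμ⟩
  · obtain ⟨-, h2, h3⟩ := isGaugeSolution_iff.1 hΛ
    have := SolvesOn.eq h3 hμ (x := x₀) (by rw [h2, hμ1])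
    ext x
    rw [← congrFun this x, inv_inv]

theorem gaugeHol_eq (hθ : θ.IsSmooth) (hg : Smooth E 𝔤 g) (hJ : J.IsSmooth) {γ : Curve E p q}
    {u : ℝ → G} (hu : IsParallelSolution (γ.pull θ) 1 u) {μ : ℝ → H} (hμ1 : μ 1 = 1)
    (hμ : SolvesOn (fun x => C.mdot ((u x)⁻¹ * (g (γ.toFun x))⁻¹) (γ.pull J x)) μ Set.univ) :
    gaugeHol C θ g J γ = (μ 0)⁻¹ := by
  have h : IsGaugeSolution C θ g J γ 1 (Classical.epsilon (IsGaugeSolution C θ g J γ 1)) :=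
    Classical.epsilon_spec (existsUnique_gaugeSolution C hθ hg hJ γ 1).exists
  obtain ⟨-, h2, h3⟩ := isGaugeSolution_iff.1 h
  rw [parSol_eq hu] at h3
  have := SolvesOn.eq h3 hμ (x := 1) (by rw [h2, hμ1])
  rw [gaugeHol, ← congrFun this 0, inv_inv]

theorem transport₁_eq {γ : Curve E p q} {u : ℝ → G} (hu : IsParallelSolution (γ.pull θ) 1 u) :
    transport₁ G θ γ = (u 0)⁻¹ := parSol_zero_one hu

section SurfaceSolutions

variable {γ₀ γ₁ : Curve E p q} (S : Surface γ₀ γ₁)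

variable {S}

/-- The second order equation is integrated once in `x`: both sides have the same `x`-derivative and
vanish at `x₀`, where `W = 1` for all `y`. -/
theorem IsSurfaceSolution.rightLogDeriv_eq {x₀ y₀ : ℝ} {W : ℝ × ℝ → H}
    (hW : IsSurfaceSolution C θ Υ S x₀ y₀ W) {P : ℝ → ℝ → 𝔥} (hP : ∀ y, P x₀ y = 0)
    (hP' : ∀ x y, HasDerivAt (fun x => P x y) (-C.mdot
      ((parSol G (fun η => S.pully θ x₀ η) y₀ y)⁻¹ *
        (parSol G (fun ξ => S.pullx θ ξ y) x₀ x)⁻¹) (S.pullxy Υ x y)) x) (x y : ℝ) :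
    (rightLogDeriv (fun η => W (x, η)) y : 𝔥) = P x y := by
  obtain ⟨h1, h2, h3, h4⟩ := hW
  have hd : ∀ z, MDAt (ℝ × ℝ) 𝔥 W z := fun z => (h1 z).mdifferentiableAt (by simp)
  have e : ∀ x, (rightLogDeriv (fun η => W (x, η)) y : 𝔥) = rlog (ℝ × ℝ) 𝔥 W (x, y) (dirS 1) :=
    fun x => by rw [HigherTransport.rightLogDeriv_eq, rlog_col (hd _)]
  have h5 : ∀ x, DifferentiableAt ℝ (fun x => (rightLogDeriv (fun η => W (x, η)) y : 𝔥)) x := by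
    intro x
    simp only [e]
    have h6 : DifferentiableAt ℝ (fun z => rlog (ℝ × ℝ) 𝔥 W z (dirS 1)) (x, y) :=
      ((contDiffAt_rlog (h1 _)).clm_apply contDiffAt_const).differentiableAt (by simp)
    exact (hasDerivAt_row h6).differentiableAt
  have h6 : ∀ x, HasDerivAt (fun x => (rightLogDeriv (fun η => W (x, η)) y : 𝔥) - P x y) 0 x := by
    intro x
    have := (h5 x).hasDerivAt.sub (hP' x y)
    rwa [h4, sub_self] at this
  have h7 := is_const_of_deriv_eq_zero (fun x => (h6 x).differentiableAt) (fun x => (h6 x).deriv) x x₀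
  rw [e x₀, rlog_dirS_eq_zero h2 (hd _), hP, sub_zero, sub_eq_zero] at h7
  exact h7

variable (S) in
-- The problem splits into a primitive `P` in `x` and then the group equation `∂_y W W⁻¹ = P` with
-- `x` as a parameter.
theorem existsUnique_surfaceSolution (hD : IsConnectionDoublet C θ Υ) (x₀ y₀ : ℝ) :
    ∃! W : ℝ × ℝ → H, IsSurfaceSolution C θ Υ S x₀ y₀ W := by
  have : CompleteSpace 𝔥 := FiniteDimensional.complete ℝ 𝔥
  obtain ⟨u, hu, hu1, hus⟩ := exists_smooth_solution (K := G)
    (fun z : ℝ × ℝ => -comp₁ S.toFun θ z (dirX ℝ)) (contDiff_comp₁ hD.smooth_θ S.smooth _).neg x₀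
  have hu' : ∀ y, parSol G (fun ξ => S.pullx θ ξ y) x₀ = fun x => u (x, y) := fun y =>
    parSol_eq ⟨ContMDiff.comp (g := u) hu (contDiff_prodMk_left y).contMDiff, hu1 y,
      fun x => (hus y x (Set.mem_univ x)).2⟩
  have hv : Smooth ℝ 𝔤 (parSol G (fun η => S.pully θ x₀ η) y₀) :=
    (isParallelSolution_parSol (K := G) ((contDiff_comp₁ hD.smooth_θ S.smooth (dirS 1)).comp
      (contDiff_prodMk_right x₀)) y₀).1
  set v := parSol G (fun η => S.pully θ x₀ η) y₀
  have hvs : Smooth (ℝ × ℝ) 𝔤 (fun z : ℝ × ℝ => (v z.2)⁻¹ * (u z)⁻¹) :=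
    ContMDiff.mul (ContMDiff.inv (ContMDiff.comp (g := v) hv contDiff_snd.contMDiff)) hu.inv'
  obtain ⟨P, hP, hP1, hPd⟩ := exists_primitive
    (fun z : ℝ × ℝ => -C.mdot ((v z.2)⁻¹ * (u z)⁻¹) (comp₂ S.toFun Υ z (dirX ℝ) (dirS 1)))
    (contDiff_mdot_apply C hvs (contDiff_comp₂ hD.smooth_Υ S.smooth _ _)).neg x₀
  have hPd' : ∀ x y, HasDerivAt (fun x => P (x, y)) (-C.mdot ((v y)⁻¹ *
        (parSol G (fun ξ => S.pullx θ ξ y) x₀ x)⁻¹) (S.pullxy Υ x y)) x := by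
    intro x y
    rw [hu']
    exact hPd x y
  -- The coordinates are exchanged because the solution theorem integrates along the first one.
  obtain ⟨W, hW, hW1, hWs⟩ := exists_smooth_solution (K := H) (fun z : ℝ × ℝ => P (z.2, z.1))
    (hP.comp (contDiff_snd.prodMk contDiff_fst)) y₀
  refine ⟨fun z => W (z.2, z.1), ⟨?_, ?_, fun x => hW1 x, fun x y => ?_⟩, fun W' hW' => ?_⟩
  · exact ContMDiff.comp (g := W) hW (contDiff_snd.prodMk contDiff_fst).contMDiff
  · intro y
    -- The condition on the line `x = x₀` is automatic, since `P` vanishes there.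
    refine congrFun (SolvesOn.eq (b := fun _ => (0 : 𝔥)) (u := fun y => W (y, x₀)) (w := fun _ => 1)
      (fun y _ => ?_) (fun y _ => ⟨.const _ _, ?_⟩) (x := y₀) (hW1 _)) y
    · have := hWs x₀ y (Set.mem_univ _)
      simpa only [hP1] using this
    · rw [HigherTransport.rightLogDeriv_eq, rlog_const]; rfl
  · simp only [(hWs _ y (Set.mem_univ y)).2]
    exact (hPd' x y).deriv
  · ext z
    refine congrFun (SolvesOn.eq (b := fun y => P (z.1, y)) (u := fun y => W' (z.1, y))
      (fun y _ => ⟨mdAt_col ((hW'.1 _).mdifferentiableAt (by simp)), ?_⟩) (hWs z.1) (x := y₀) ?_) z.2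
    · exact hW'.rightLogDeriv_eq (P := fun x y => P (x, y)) hP1 hPd' z.1 y
    · rw [hW1]; exact hW'.2.2.1 _

theorem tang_eq_zero_right {S : Type} [NormedAddCommGroup S] [NormedSpace ℝ S] {h : ℝ × S → M} {ε : ℝ}
    (hε : 0 < ε) (hh : ∀ x y, 1 - ε < x → h (x, y) = q) (s : S) : tang (ℝ × S) E h (1, s) = 0 := by
  have e : h =ᶠ[𝓝 (1, s)] fun _ => q := by
    filter_upwards [(isOpen_lt continuous_const continuous_fst).mem_nhds
      (show (1 - ε : ℝ) < ((1 : ℝ), s).1 by simpa using hε)] with z hz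
    exact hh z.1 z.2 hz
  rw [tang_congr e, tang_const]

theorem tang_eq_zero_left {S : Type} [NormedAddCommGroup S] [NormedSpace ℝ S] {h : ℝ × S → M} {ε : ℝ}
    (hε : 0 < ε) (hh : ∀ x y, x < ε → h (x, y) = p) (s : S) : tang (ℝ × S) E h (0, s) = 0 := by
  have e : h =ᶠ[𝓝 (0, s)] fun _ => p := by
    filter_upwards [(isOpen_lt continuous_fst continuous_const).mem_nhds
      (show ((0 : ℝ), s).1 < ε by simpa using hε)] with z hz
    exact hh z.1 z.2 hz
  rw [tang_congr e, tang_const]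

theorem comp₁_eq_zero {h : V → M} {z : V} (hz : tang V E h z = 0) (α : DForm E M F 1) (v : V) :
    comp₁ h α z v = 0 := by
  rw [comp₁, hz]
  exact (α (h z)).map_coord_zero 0 rfl

theorem comp₂_eq_zero {h : V → M} {z : V} (hz : tang V E h z = 0) (α : DForm E M F 2) (v w : V) :
    comp₂ h α z v w = 0 := by
  rw [comp₂, hz]
  exact (α (h z)).map_coord_zero 0 rfl

theorem Surface.tang_right (S : Surface γ₀ γ₁) (y : ℝ) : tang (ℝ × ℝ) E S.toFun (1, y) = 0 := by
  obtain ⟨ε, h0, h1, h2, h3, h4, h5⟩ := S.sitting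
  exact tang_eq_zero_right h0 h3 y

theorem Surface.tang_left (S : Surface γ₀ γ₁) (y : ℝ) : tang (ℝ × ℝ) E S.toFun (0, y) = 0 := by
  obtain ⟨ε, h0, h1, h2, h3, h4, h5⟩ := S.sitting
  exact tang_eq_zero_left h0 h2 y

/-- The surface transport is the holonomy of `β(0, ·)`. -/
theorem transport₂_eq (hD : IsConnectionDoublet C θ Υ) {u : ℝ × ℝ → G} {β : ℝ × ℝ → ℝ → 𝔥}
    (hf : IsFrame C (comp₁ S.toFun θ) (comp₂ S.toFun Υ) u β) {w : ℝ → H} (hw0 : w 0 = 1)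
    (hw : SolvesOn (fun y => β (0, y) 1) w Set.univ) : transport₂ C θ Υ S = w 1 := by
  have h : IsSurfaceSolution C θ Υ S 1 0 (Classical.epsilon (IsSurfaceSolution C θ Υ S 1 0)) :=
    Classical.epsilon_spec (existsUnique_surfaceSolution S hD 1 0).exists
  -- The surface is constant near `x = 1`, so the transport along that side is trivial.
  have hv : parSol G (fun η => S.pully θ 1 η) 0 = fun _ => 1 := by
    refine parSol_eq ⟨contMDiff_const, rfl, fun y => ?_⟩
    change _ = -comp₁ S.toFun θ (1, y) (dirS 1)
    rw [comp₁_eq_zero (S.tang_right y), HigherTransport.rightLogDeriv_eq, rlog_const]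
    simp
  have h1 := h.rightLogDeriv_eq (P := fun x y => β (x, y) 1) (fun y => hf.β_one y 1) (fun x y => by
    have hu : parSol G (fun ξ => S.pullx θ ξ y) 1 = fun x => u (x, y) := parSol_eq (hf.row y)
    rw [hv, hu]
    rw [inv_one, one_mul]
    exact hf.hasDerivAt_β x y 1)
  refine congrFun (SolvesOn.eq (b := fun y => β (0, y) 1) (x := 0) (fun y _ => ⟨?_, h1 0 y⟩) hw ?_) 1
  · exact mdAt_col ((h.1 _).mdifferentiableAt (by simp))
  · rw [hw0]; exact h.2.2.1 0

theorem exists_transport₂_eq (hD : IsConnectionDoublet C θ Υ) {u : ℝ × ℝ → G} {β : ℝ × ℝ → ℝ → 𝔥}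
    (hf : IsFrame C (comp₁ S.toFun θ) (comp₂ S.toFun Υ) u β) :
    ∃ w : ℝ → H, w 0 = 1 ∧ SolvesOn (fun y => β (0, y) 1) w Set.univ ∧ transport₂ C θ Υ S = w 1 := by
  obtain ⟨w, hw0, hw⟩ := exists_solution (K := H) (fun y => β (0, y) 1)
    ((hf.smooth_β 1).comp (contDiff_prodMk_right 0)) 0
  exact ⟨w, hw0, hw, transport₂_eq hD hf hw0 hw⟩

end SurfaceSolutions

end WellPosed

/-! ### Transport along curves -/

section Curves

variable {E M 𝔤 𝔥 G H : Type*}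
  [NormedAddCommGroup E] [NormedSpace ℝ E]
  [TopologicalSpace M] [ChartedSpace E M] [IsManifold 𝓘(ℝ, E) ∞ M]
  [NormedAddCommGroup 𝔤] [NormedSpace ℝ 𝔤] [NormedAddCommGroup 𝔥] [NormedSpace ℝ 𝔥]
  [FiniteDimensional ℝ 𝔤] [FiniteDimensional ℝ 𝔥]
  [Group G] [TopologicalSpace G] [ChartedSpace 𝔤 G] [LieGroup 𝓘(ℝ, 𝔤) ∞ G]
  [Group H] [TopologicalSpace H] [ChartedSpace 𝔥 H] [LieGroup 𝓘(ℝ, 𝔥) ∞ H]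
  {C : LieCrossedModule 𝔤 𝔥 G H} {θ : DForm E M 𝔤 1} {J : DForm E M 𝔥 1}
  {g : M → G} {p q r : M}
  {F : Type*} [NormedAddCommGroup F] [NormedSpace ℝ F] [FiniteDimensional ℝ F]

theorem hasDerivAt_two_mul (x : ℝ) : HasDerivAt (fun x : ℝ => 2 * x) 2 x := by
  simpa using (hasDerivAt_id x).const_mul 2

theorem hasDerivAt_two_mul_sub_one (x : ℝ) : HasDerivAt (fun x : ℝ => 2 * x - 1) 2 x :=
  (hasDerivAt_two_mul x).sub_const 1

theorem hasDerivAt_one_sub (x : ℝ) : HasDerivAt (fun x : ℝ => 1 - x) (-1) x :=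
  (hasDerivAt_id x).const_sub 1

theorem SolvesOn.comp {𝔨 K : Type*} [NormedAddCommGroup 𝔨] [NormedSpace ℝ 𝔨] [FiniteDimensional ℝ 𝔨]
    [Group K] [TopologicalSpace K] [ChartedSpace 𝔨 K] [LieGroup 𝓘(ℝ, 𝔨) ∞ K] {b : ℝ → 𝔨} {u : ℝ → K}
    (hu : SolvesOn b u Set.univ) {h : ℝ → ℝ} {h' : ℝ} (hh : ∀ x, HasDerivAt h h' x) :
    SolvesOn (fun x => h' • b (h x)) (fun x => u (h x)) Set.univ := fun x _ => by
  have := rightLogDeriv_comp (h := h) (hu (h x) (Set.mem_univ _)).1 (hh x)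
  rw [(hu (h x) (Set.mem_univ _)).2] at this
  exact this

theorem SolvesOn.map_m {b : ℝ → 𝔥} {w : ℝ → H} {s : Set ℝ} (hw : SolvesOn b w s) (C : LieCrossedModule 𝔤 𝔥 G H) (c : G) :
    SolvesOn (fun x => C.mdot c (b x)) (fun x => C.m c (w x)) s := fun x hx =>
  ⟨MDAt.comp (f := fun X => C.m c X) x (C.mdAt_m c _) (hw x hx).1, by
    rw [rightLogDeriv_eq, C.rlog_m c (hw x hx).1, ContinuousLinearMap.comp_apply, ← rightLogDeriv_eq,
      (hw x hx).2]⟩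

theorem SolvesOn.congr {𝔨 K : Type*} [NormedAddCommGroup 𝔨] [NormedSpace ℝ 𝔨]
    [Group K] [TopologicalSpace K] [ChartedSpace 𝔨 K] {b b' : ℝ → 𝔨} {u : ℝ → K} {s : Set ℝ}
    (hu : SolvesOn b u s) (h : ∀ x ∈ s, b x = b' x) : SolvesOn b' u s := fun x hx =>
  ⟨(hu x hx).1, by rw [(hu x hx).2, h x hx]⟩

theorem SolvesOn.mono {𝔨 K : Type*} [NormedAddCommGroup 𝔨] [NormedSpace ℝ 𝔨]
    [Group K] [TopologicalSpace K] [ChartedSpace 𝔨 K] {b : ℝ → 𝔨} {u : ℝ → K} {s t : Set ℝ}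
    (hu : SolvesOn b u t) (h : s ⊆ t) : SolvesOn b u s := fun x hx => hu x (h hx)

/-- The parallel transport of the row of a doublet, with the primitive of the parallel transported
coefficient. -/
structure IsRow (C : LieCrossedModule 𝔤 𝔥 G H) (a : ℝ → 𝔤) (b : ℝ → 𝔥) (u : ℝ → G) (β : ℝ → 𝔥) :
    Prop where
  parallel : IsParallelSolution a 1 u
  β_one : β 1 = 0
  hasDerivAt : ∀ x, HasDerivAt β (-C.mdot (u x)⁻¹ (b x)) x

theorem IsFrame.isRow {S : Type} [NormedAddCommGroup S] [NormedSpace ℝ S] [CompleteSpace S]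
    {a : ℝ × S → ℝ × S → 𝔤} {B : ℝ × S → ℝ × S → ℝ × S → 𝔥} {u : ℝ × S → G} {β : ℝ × S → S → 𝔥}
    (hf : IsFrame C a B u β) (s w : S) :
    IsRow C (fun x => a (x, s) (dirX S)) (fun x => B (x, s) (dirX S) (dirS w)) (fun x => u (x, s))
      (fun x => β (x, s) w) :=
  ⟨hf.row s, hf.β_one s w, fun x => hf.hasDerivAt_β x s w⟩

/-- Concatenation of parallel transports. -/
theorem parallel_concat {a a₁ a₂ : ℝ → 𝔤} {u u₁ u₂ : ℝ → G} {δ : ℝ} (hδ : 0 < δ)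
    (hu : IsParallelSolution a 1 u) (hu₁ : IsParallelSolution a₁ 1 u₁)
    (hu₂ : IsParallelSolution a₂ 1 u₂)
    (h₁ : ∀ x, x < 1 / 2 + δ → a x = (2 : ℝ) • a₁ (2 * x))
    (h₂ : ∀ x, 1 / 2 - δ < x → a x = (2 : ℝ) • a₂ (2 * x - 1)) :
    (∀ x, x < 1 / 2 + δ → u x = u₁ (2 * x) * u₂ 0) ∧
      ∀ x, 1 / 2 - δ < x → u x = u₂ (2 * x - 1) := by
  -- Solutions are based at `x = 1`, so the second half is compared first; its value `u₂(0)` at `1 /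
  -- 2` is the initial value for the first half.
  have k₂ : ∀ x, 1 / 2 - δ < x → u x = u₂ (2 * x - 1) := fun x hx => by
    refine SolvesOn.eqOn (b := fun x => -a x) (w := fun x => u₂ (2 * x - 1)) isOpen_Ioi
      isPreconnected_Ioi (hu.solvesOn.mono (Set.subset_univ _))
      (((hu₂.solvesOn.comp hasDerivAt_two_mul_sub_one).mono (Set.subset_univ _)).congr ?_)
      (x := 1) (show 1 / 2 - δ < 1 by linarith) hx ?_
    · intro y hy
      rw [h₂ y hy, smul_neg]
    · norm_num [hu.2.1, hu₂.2.1]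
  refine ⟨fun x hx => ?_, k₂⟩
  refine SolvesOn.eqOn (b := fun x => -a x) (w := fun x => u₁ (2 * x) * u₂ 0) isOpen_Iio
    isPreconnected_Iio (hu.solvesOn.mono (Set.subset_univ _))
    ((((hu₁.solvesOn.comp hasDerivAt_two_mul).mul_const _).mono (Set.subset_univ _)).congr ?_)
    (x := 1 / 2) (show 1 / 2 < 1 / 2 + δ by linarith) hx ?_
  · intro y hy
    rw [h₁ y hy, smul_neg]
  · rw [k₂ _ (by linarith)]
    norm_num [hu₁.2.1]

omit [FiniteDimensional ℝ 𝔤] [FiniteDimensional ℝ 𝔥] in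
theorem eq_of_hasDerivAt_zero {f : ℝ → 𝔥} {s : Set ℝ} (hs : IsOpen s) (hs' : IsPreconnected s)
    (hf : ∀ x ∈ s, HasDerivAt f 0 x) {x y : ℝ} (hx : x ∈ s) (hy : y ∈ s) : f x = f y :=
  hs.is_const_of_deriv_eq_zero hs' (fun x hx => (hf x hx).differentiableAt.differentiableWithinAt)
    (fun x hx => (hf x hx).deriv) hx hy

/-- Concatenation of rows. -/
theorem IsRow.concat {a a₁ a₂ : ℝ → 𝔤} {b b₁ b₂ : ℝ → 𝔥} {u u₁ u₂ : ℝ → G} {β β₁ β₂ : ℝ → 𝔥} {δ : ℝ}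
    (hδ : 0 < δ) (hu : IsRow C a b u β) (hu₁ : IsRow C a₁ b₁ u₁ β₁) (hu₂ : IsRow C a₂ b₂ u₂ β₂)
    (h₁ : ∀ x, x < 1 / 2 + δ → a x = (2 : ℝ) • a₁ (2 * x))
    (h₂ : ∀ x, 1 / 2 - δ < x → a x = (2 : ℝ) • a₂ (2 * x - 1))
    (k₁ : ∀ x, x < 1 / 2 + δ → b x = (2 : ℝ) • b₁ (2 * x))
    (k₂ : ∀ x, 1 / 2 - δ < x → b x = (2 : ℝ) • b₂ (2 * x - 1)) :
    β 0 = β₂ 0 + C.mdot (u₂ 0)⁻¹ (β₁ 0) := by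
  obtain ⟨l₁, l₂⟩ := parallel_concat hδ hu.parallel hu₁.parallel hu₂.parallel h₁ h₂
  have e₂ := eq_of_hasDerivAt_zero (f := fun x => β x - β₂ (2 * x - 1)) (s := Set.Ioi (1 / 2 - δ))
    isOpen_Ioi isPreconnected_Ioi (fun x hx => by
      have := (hu.hasDerivAt x).sub
        ((hu₂.hasDerivAt (2 * x - 1)).scomp x (hasDerivAt_two_mul_sub_one x))
      rw [l₂ x hx, k₂ x hx, map_smul, smul_neg, sub_self] at this
      exact this) (x := 1) (y := 1 / 2) (show 1 / 2 - δ < 1 by linarith)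
      (show 1 / 2 - δ < 1 / 2 by linarith)
  -- On the first half `u = u₁(2x) u₂(0)`, which twists the integrand by `ṁ(u₂(0)⁻¹)`.
  have e₁ := eq_of_hasDerivAt_zero (f := fun x => β x - C.mdot (u₂ 0)⁻¹ (β₁ (2 * x)))
    (s := Set.Iio (1 / 2 + δ)) isOpen_Iio isPreconnected_Iio (fun x hx => by
      have h3 := (C.mdot (u₂ 0)⁻¹).hasFDerivAt.comp_hasDerivAt x
        ((hu₁.hasDerivAt (2 * x)).scomp x (hasDerivAt_two_mul x))
      have := (hu.hasDerivAt x).sub h3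
      rw [l₁ x hx, k₁ x hx, map_smul, map_smul, map_neg, mul_inv_rev, C.mdot_mul_apply, smul_neg,
        sub_self] at this
      exact this) (x := 0) (y := 1 / 2) (show 0 < 1 / 2 + δ by linarith)
      (show 1 / 2 < 1 / 2 + δ by linarith)
  norm_num [hu.β_one, hu₁.β_one, hu₂.β_one] at e₁ e₂
  rw [sub_eq_iff_eq_add] at e₁
  rw [e₁, eq_of_sub_eq_zero e₂.symm]

omit [IsManifold 𝓘(ℝ, E) ∞ M] in
-- By the sitting instants each formula extends a little beyond `1 / 2`, so derivatives and
-- uniqueness can be used on open sets containing the junction.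
theorem Curve.comp_eq (γ₂ : Curve E q r) (γ₁ : Curve E p q) :
    ∃ δ > 0, (∀ x, x < 1 / 2 + δ → (γ₂.comp γ₁).toFun x = γ₁.toFun (2 * x)) ∧
      ∀ x, 1 / 2 - δ < x → (γ₂.comp γ₁).toFun x = γ₂.toFun (2 * x - 1) := by
  obtain ⟨ε, h0, h1, h2, h3⟩ := γ₁.sitting
  obtain ⟨ε', h0', h1', h2', h3'⟩ := γ₂.sitting
  have a1 := min_le_left ε ε'
  have a2 := min_le_right ε ε'
  have a3 : 0 < min ε ε' := lt_min h0 h0'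
  refine ⟨min ε ε' / 2, by positivity, fun x hx => ?_, fun x hx => ?_⟩
  · simp only [Curve.comp, glue]
    split_ifs with h
    · rfl
    · rw [h2' _ (by linarith), h3 _ (by linarith)]
  · simp only [Curve.comp, glue]
    split_ifs with h
    · rw [h2' _ (by linarith), h3 _ (by linarith)]
    · rfl

theorem comp₁_smul {V : Type*} [NormedAddCommGroup V] [NormedSpace ℝ V] (h : V → M) (α : DForm E M F 1)
    (z : V) (c : ℝ) (v : V) : comp₁ h α z (c • v) = c • comp₁ h α z v := by
  have e : ∀ x : E, ![x] = Function.update (![0] : Fin 1 → E) 0 x := fun x => by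
    ext i; fin_cases i; rfl
  rw [comp₁, comp₁, map_smul, e, (α (h z)).map_update_smul, ← e]

theorem comp₂_smul_right {V : Type*} [NormedAddCommGroup V] [NormedSpace ℝ V] (h : V → M)
    (α : DForm E M F 2) (z : V) (c : ℝ) (v w : V) : comp₂ h α z v (c • w) = c • comp₂ h α z v w := by
  have e : ∀ x y : E, ![x, y] = Function.update (![x, 0] : Fin 2 → E) 1 y := fun x y => by
    ext i; fin_cases i <;> rfl
  rw [comp₂, comp₂, map_smul, e, (α (h z)).map_update_smul, ← e]

theorem comp₂_smul_left {V : Type*} [NormedAddCommGroup V] [NormedSpace ℝ V] (h : V → M)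
    (α : DForm E M F 2) (z : V) (c : ℝ) (v w : V) : comp₂ h α z (c • v) w = c • comp₂ h α z v w := by
  have e : ∀ x y : E, ![x, y] = Function.update (![0, y] : Fin 2 → E) 0 x := fun x y => by
    ext i; fin_cases i <;> rfl
  rw [comp₂, comp₂, map_smul, e, (α (h z)).map_update_smul, ← e]

theorem comp₁_comp {U V : Type*} [NormedAddCommGroup U] [NormedSpace ℝ U] [NormedAddCommGroup V]
    [NormedSpace ℝ V] {h : V → M} (hh : Smooth V E h) {f : U → M} {A : U → V} {A' : U →L[ℝ] V} {z : U}
    (hf : f =ᶠ[𝓝 z] fun z => h (A z)) (hA : HasFDerivAt A A' z) (α : DForm E M F 1) (v : U) :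
    comp₁ f α z v = comp₁ h α (A z) (A' v) := by
  have h1 : tang U E f z = (tang V E h (A z)).comp A' := by
    rw [tang_congr hf, tang_comp (g := A) z ((hh _).mdifferentiableAt (by simp))
      hA.differentiableAt.mdifferentiableAt, tang_eq_fderiv, hA.fderiv]
  rw [comp₁, comp₁, h1, hf.self_of_nhds]; rfl

theorem comp₂_comp {U V : Type*} [NormedAddCommGroup U] [NormedSpace ℝ U] [NormedAddCommGroup V]
    [NormedSpace ℝ V] {h : V → M} (hh : Smooth V E h) {f : U → M} {A : U → V} {A' : U →L[ℝ] V} {z : U}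
    (hf : f =ᶠ[𝓝 z] fun z => h (A z)) (hA : HasFDerivAt A A' z) (α : DForm E M F 2) (v w : U) :
    comp₂ f α z v w = comp₂ h α (A z) (A' v) (A' w) := by
  have h1 : tang U E f z = (tang V E h (A z)).comp A' := by
    rw [tang_congr hf, tang_comp (g := A) z ((hh _).mdifferentiableAt (by simp))
      hA.differentiableAt.mdifferentiableAt, tang_eq_fderiv, hA.fderiv]
  rw [comp₂, comp₂, h1, hf.self_of_nhds]; rfl

theorem Curve.pull_comp_eq {p' q' : M} {γ : Curve E p q} {γ' : Curve E p' q'} {s : Set ℝ}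
    (hs : IsOpen s) {h : ℝ → ℝ} {h' : ℝ} (he : ∀ x ∈ s, γ.toFun x = γ'.toFun (h x))
    (hh : ∀ x, HasDerivAt h h' x) (α : DForm E M F 1) {x : ℝ} (hx : x ∈ s) :
    γ.pull α x = h' • γ'.pull α (h x) := by
  have := comp₁_comp γ'.smooth (f := γ.toFun) (Filter.eventuallyEq_of_mem (hs.mem_nhds hx) he)
    (hh x).hasFDerivAt α 1
  change γ.pull α x = comp₁ γ'.toFun α (h x) _ at this
  rw [this, ContinuousLinearMap.toSpanSingleton_apply, one_smul, ← mul_one h', ← smul_eq_mul, comp₁_smul]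
  simp [comp₁, Curve.pull]

theorem Curve.pull_unit (p : M) (α : DForm E M F 1) (x : ℝ) : (Curve.unit E p).pull α x = 0 :=
  comp₁_eq_zero (h := fun _ : ℝ => p) (tang_const _ _) α 1

variable (C) in
theorem exists_gaugeHol_eq (hθ : θ.IsSmooth) (hg : Smooth E 𝔤 g) (hJ : J.IsSmooth) {γ : Curve E p q}
    {u : ℝ → G} (hu : IsParallelSolution (γ.pull θ) 1 u) :
    ∃ μ : ℝ → H, μ 1 = 1 ∧
      SolvesOn (fun x => C.mdot ((u x)⁻¹ * (g (γ.toFun x))⁻¹) (γ.pull J x)) μ Set.univ ∧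
        gaugeHol C θ g J γ = (μ 0)⁻¹ := by
  have h2 : Smooth ℝ 𝔤 (fun x => g (γ.toFun x)) := ContMDiff.comp hg γ.smooth
  obtain ⟨μ, hμ1, hμ⟩ := exists_solution (K := H)
    (fun x => C.mdot ((u x)⁻¹ * (g (γ.toFun x))⁻¹) (γ.pull J x))
    (contDiff_mdot_apply C (u := fun x => (u x)⁻¹ * (g (γ.toFun x))⁻¹)
      (ContMDiff.mul hu.1.inv' h2.inv') (contDiff_curve_pull hJ γ)) 1
  exact ⟨μ, hμ1, hμ, gaugeHol_eq hθ hg hJ hu hμ1 hμ⟩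

theorem isParallelSolution_unit (θ : DForm E M 𝔤 1) (p : M) :
    IsParallelSolution ((Curve.unit E p).pull θ) 1 (fun _ => (1 : G)) :=
  ⟨contMDiff_const, rfl, fun x => by
    rw [Curve.pull_unit, HigherTransport.rightLogDeriv_eq, rlog_const]; simp⟩

theorem transport₁_unit (θ : DForm E M 𝔤 1) (p : M) : transport₁ G θ (Curve.unit E p) = 1 := by
  rw [transport₁_eq (isParallelSolution_unit θ p), inv_one]

theorem gaugeHol_unit (hθ : θ.IsSmooth) (hg : Smooth E 𝔤 g) (hJ : J.IsSmooth) (p : M) :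
    gaugeHol C θ g J (Curve.unit E p) = 1 := by
  rw [gaugeHol_eq hθ hg hJ (isParallelSolution_unit θ p) (μ := fun _ => 1) rfl, inv_one]
  intro x _
  refine ⟨.const _ _, ?_⟩
  beta_reduce
  rw [Curve.pull_unit, HigherTransport.rightLogDeriv_eq, rlog_const, map_zero]; rfl

/-- Reversing and right translating to restore the base point `1` gives the parallel transport
`u(1-x) u(0)⁻¹`. The constant `u(0)⁻¹` acts through `m`, so the inverse gauge solution becomes
`m(u(0))(μ(1-x) μ(0)⁻¹)`. -/
theorem gaugeHol_inv (hθ : θ.IsSmooth) (hg : Smooth E 𝔤 g) (hJ : J.IsSmooth) (γ : Curve E p q) :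
    gaugeHol C θ g J γ.inv = C.m (transport₁ G θ γ)⁻¹ (gaugeHol C θ g J γ)⁻¹ := by
  have hu := isParallelSolution_parSol (K := G) (contDiff_curve_pull hθ γ) 1
  set u := parSol G (γ.pull θ) 1
  obtain ⟨μ, hμ1, hμ, e⟩ := exists_gaugeHol_eq C hθ hg hJ hu
  have hu' : IsParallelSolution (γ.inv.pull θ) 1 (fun x => u (1 - x) * (u 0)⁻¹) := by
    refine ⟨ContMDiff.mul (ContMDiff.comp (g := u) hu.1
      (contDiff_const.sub contDiff_id).contMDiff) contMDiff_const, by simp, fun x => ?_⟩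
    rw [(((hu.solvesOn.comp hasDerivAt_one_sub).mul_const _) x (Set.mem_univ x)).2,
      Curve.pull_comp_eq (γ := γ.inv) (γ' := γ) isOpen_univ (fun _ _ => rfl) hasDerivAt_one_sub θ
        (Set.mem_univ x), smul_neg]
  rw [gaugeHol_eq hθ hg hJ hu' (μ := fun x => C.m (u 0) (μ (1 - x) * (μ 0)⁻¹)) (by simp), e,
    transport₁_eq hu]
  · simp [hμ1]
  · refine (((hμ.comp hasDerivAt_one_sub).mul_const (μ 0)⁻¹).map_m C (u 0)).congr fun x _ => ?_
    rw [Curve.pull_comp_eq (γ := γ.inv) (γ' := γ) isOpen_univ (fun _ _ => rfl) hasDerivAt_one_sub J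
        (Set.mem_univ x), map_smul, map_smul, ← C.mdot_mul_apply]
    congr 2
    simp [Curve.inv, mul_assoc]

theorem transport₁_comp (hθ : θ.IsSmooth) (γ₂ : Curve E q r) (γ₁ : Curve E p q) :
    transport₁ G θ (γ₂.comp γ₁) = transport₁ G θ γ₂ * transport₁ G θ γ₁ := by
  have hu := isParallelSolution_parSol (K := G) (contDiff_curve_pull hθ (γ₂.comp γ₁)) 1
  have hu₁ := isParallelSolution_parSol (K := G) (contDiff_curve_pull hθ γ₁) 1
  have hu₂ := isParallelSolution_parSol (K := G) (contDiff_curve_pull hθ γ₂) 1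
  obtain ⟨δ, hδ, h₁, h₂⟩ := Curve.comp_eq γ₂ γ₁
  obtain ⟨l, -⟩ := parallel_concat hδ hu hu₁ hu₂
    (fun x hx => Curve.pull_comp_eq isOpen_Iio h₁ hasDerivAt_two_mul θ hx)
    (fun x hx => Curve.pull_comp_eq isOpen_Ioi h₂ hasDerivAt_two_mul_sub_one θ hx)
  rw [transport₁_eq hu, transport₁_eq hu₁, transport₁_eq hu₂, l 0 (by linarith), mul_zero, mul_inv_rev]

/-- For the inverse `μ = Λ⁻¹`, the second half is `μ₂(2x-1)` and the first half is
`m(u₂(0)⁻¹)(μ₁(2x)) μ₂(0)`; inverting the value at `0` gives the formula. -/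
theorem gaugeHol_comp (hθ : θ.IsSmooth) (hg : Smooth E 𝔤 g) (hJ : J.IsSmooth) (γ₂ : Curve E q r)
    (γ₁ : Curve E p q) : gaugeHol C θ g J (γ₂.comp γ₁) =
      gaugeHol C θ g J γ₂ * C.m (transport₁ G θ γ₂) (gaugeHol C θ g J γ₁) := by
  have hu := isParallelSolution_parSol (K := G) (contDiff_curve_pull hθ (γ₂.comp γ₁)) 1
  have hu₁ := isParallelSolution_parSol (K := G) (contDiff_curve_pull hθ γ₁) 1
  have hu₂ := isParallelSolution_parSol (K := G) (contDiff_curve_pull hθ γ₂) 1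
  obtain ⟨δ, hδ, h₁, h₂⟩ := Curve.comp_eq γ₂ γ₁
  obtain ⟨l₁, l₂⟩ := parallel_concat hδ hu hu₁ hu₂
    (fun x hx => Curve.pull_comp_eq isOpen_Iio h₁ hasDerivAt_two_mul θ hx)
    (fun x hx => Curve.pull_comp_eq isOpen_Ioi h₂ hasDerivAt_two_mul_sub_one θ hx)
  obtain ⟨μ, hμ1, hμ, e⟩ := exists_gaugeHol_eq C hθ hg hJ hu
  obtain ⟨μ₁, hμ₁1, hμ₁, e₁⟩ := exists_gaugeHol_eq C hθ hg hJ hu₁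
  obtain ⟨μ₂, hμ₂1, hμ₂, e₂⟩ := exists_gaugeHol_eq C hθ hg hJ hu₂
  have k₂ : μ (1 / 2) = μ₂ 0 := by
    have := SolvesOn.eqOn (w := fun x => μ₂ (2 * x - 1)) isOpen_Ioi isPreconnected_Ioi
      (hμ.mono (Set.subset_univ _))
      (((hμ₂.comp hasDerivAt_two_mul_sub_one).mono (Set.subset_univ (Set.Ioi (1 / 2 - δ)))).congr ?_)
      (x := 1) (y := 1 / 2) (show 1 / 2 - δ < 1 by linarith) (show 1 / 2 - δ < 1 / 2 by linarith) ?_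
    · norm_num at this ⊢
      exact this
    · intro x hx
      rw [l₂ x hx, h₂ x hx, Curve.pull_comp_eq isOpen_Ioi h₂ hasDerivAt_two_mul_sub_one J hx, map_smul]
    · norm_num [hμ1, hμ₂1]
  have k₁ : μ 0 = C.m (parSol G (γ₂.pull θ) 1 0)⁻¹ (μ₁ 0) * μ₂ 0 := by
    have := SolvesOn.eqOn (w := fun x => C.m (parSol G (γ₂.pull θ) 1 0)⁻¹ (μ₁ (2 * x)) * μ₂ 0)
      isOpen_Iio isPreconnected_Iio
      (hμ.mono (Set.subset_univ _))
      (((((hμ₁.comp hasDerivAt_two_mul).map_m C (parSol G (γ₂.pull θ) 1 0)⁻¹).mul_const _).mono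
        (Set.subset_univ (Set.Iio (1 / 2 + δ)))).congr ?_)
      (x := 1 / 2) (y := 0) (show 1 / 2 < 1 / 2 + δ by linarith) (show 0 < 1 / 2 + δ by linarith) ?_
    · simpa using this
    · intro x hx
      rw [l₁ x hx, h₁ x hx, Curve.pull_comp_eq isOpen_Iio h₁ hasDerivAt_two_mul J hx, map_smul, map_smul,
        ← C.mdot_mul_apply, mul_inv_rev, mul_assoc]
    · rw [k₂]; norm_num [hμ₁1]
  rw [e, e₁, e₂, k₁, transport₁_eq hu₂, mul_inv_rev, map_inv, map_inv]

end Curves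

/-! ### Transport along surfaces -/

section SolvesOnMul

variable {𝔨 K : Type*} [NormedAddCommGroup 𝔨] [NormedSpace ℝ 𝔨] [FiniteDimensional ℝ 𝔨]
  [Group K] [TopologicalSpace K] [ChartedSpace 𝔨 K] [LieGroup 𝓘(ℝ, 𝔨) ∞ K]

theorem SolvesOn.mul {b b' : ℝ → 𝔨} {u u' : ℝ → K} {s : Set ℝ} (hu : SolvesOn b u s)
    (hu' : SolvesOn b' u' s) :
    SolvesOn (fun x => b x + Ad (u x) (b' x)) (fun x => u x * u' x) s := fun x hx =>
  ⟨(hu x hx).1.mul (hu' x hx).1, by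
    rw [rightLogDeriv_eq, rlog_mul (hu x hx).1 (hu' x hx).1, add_apply,
      ContinuousLinearMap.comp_apply, ← rightLogDeriv_eq, ← rightLogDeriv_eq, (hu x hx).2,
      (hu' x hx).2]⟩

theorem solvesOn_const (c : K) (s : Set ℝ) : SolvesOn (fun _ => (0 : 𝔨)) (fun _ => c) s := fun x _ =>
  ⟨.const _ _, by rw [rightLogDeriv_eq, rlog_const]; rfl⟩

end SolvesOnMul

section Surfaces

variable {E M 𝔤 𝔥 G H : Type*}
  [NormedAddCommGroup E] [NormedSpace ℝ E]
  [TopologicalSpace M] [ChartedSpace E M] [IsManifold 𝓘(ℝ, E) ∞ M]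
  [NormedAddCommGroup 𝔤] [NormedSpace ℝ 𝔤] [NormedAddCommGroup 𝔥] [NormedSpace ℝ 𝔥]
  [FiniteDimensional ℝ 𝔤] [FiniteDimensional ℝ 𝔥]
  [Group G] [TopologicalSpace G] [ChartedSpace 𝔤 G] [LieGroup 𝓘(ℝ, 𝔤) ∞ G]
  [Group H] [TopologicalSpace H] [ChartedSpace 𝔥 H] [LieGroup 𝓘(ℝ, 𝔥) ∞ H]
  {C : LieCrossedModule 𝔤 𝔥 G H} {θ : DForm E M 𝔤 1} {Υ : DForm E M 𝔥 2} {J : DForm E M 𝔥 1}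
  {g : M → G} {p q r : M} {γ₀ γ₁ γ₂ : Curve E p q} {δ₀ δ₁ : Curve E q r}
  {F : Type*} [NormedAddCommGroup F] [NormedSpace ℝ F] [FiniteDimensional ℝ F]

theorem SolvesOn.map_t {b : ℝ → 𝔥} {w : ℝ → H} {s : Set ℝ} (hw : SolvesOn b w s)
    (C : LieCrossedModule 𝔤 𝔥 G H) :
    SolvesOn (fun x => C.tdot (b x)) (fun x => C.t (w x)) s := fun x hx =>
  ⟨MDAt.comp (f := fun X => C.t X) x (C.mdAt_t _) (hw x hx).1, by
    rw [HigherTransport.rightLogDeriv_eq, C.rlog_t (hw x hx).1, ContinuousLinearMap.comp_apply,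
      ← HigherTransport.rightLogDeriv_eq, (hw x hx).2]⟩

/-- The image under `t` of the holonomy of `β(0, ·)`. -/
theorem IsFrame.t_holonomy {a : ℝ × ℝ → ℝ × ℝ → 𝔤} {B : ℝ × ℝ → ℝ × ℝ → ℝ × ℝ → 𝔥} {u : ℝ × ℝ → G}
    {β : ℝ × ℝ → ℝ → 𝔥} (hf : IsFrame C a B u β) (hD : IsDoublet C a B)
    (h1 : ∀ s w, a (1, s) (dirS w) = 0) (h0 : ∀ s w, a (0, s) (dirS w) = 0) {w : ℝ → H}
    (hw0 : w 0 = 1) (hw : SolvesOn (fun y => β (0, y) 1) w Set.univ) (y : ℝ) :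
    C.t (w y) = (u (0, y))⁻¹ * u (0, 0) := by
  refine congrFun (SolvesOn.eq (hw.map_t C) (w := fun y => (u (0, y))⁻¹ * u (0, 0)) (fun y _ => ?_)
    (x := 0) (by simp [hw0])) y
  have hu : MDAt (ℝ × ℝ) 𝔤 (fun z => (u z)⁻¹) (0, y) :=
    (hf.smooth_u.inv' (0, y)).mdifferentiableAt (by simp)
  refine ⟨MDAt.mul (mdAt_col hu) (.const _ _), ?_⟩
  -- On the side `x = 0` the connection vanishes along `y`, so the radial component of `a` is only
  -- `-d(u⁻¹) u`, and its comparison with `-ṫ(β)` is the equation sought.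
  have := hf.rotate_dirS hD h1 (0, y) 1
  rw [rotate, h0, map_zero, zero_sub, neg_inj] at this
  rw [HigherTransport.rightLogDeriv_eq, rlog_mul_const, rlog_col hu, this]

theorem Surface.pull_source (S : Surface γ₀ γ₁) (α : DForm E M F 1) (x : ℝ) :
    γ₀.pull α x = comp₁ S.toFun α (x, 0) (dirX ℝ) := by
  obtain ⟨ε, h0, h1, h2, h3, h4, h5⟩ := S.sitting
  have := comp₁_comp S.smooth (f := γ₀.toFun) (A := fun x => (x, 0)) (z := x)
    (Filter.Eventually.of_forall fun x => (h4 x 0 h0).symm) (hasFDerivAt_prodMk_left x (0 : ℝ)) α 1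
  simpa using! this

theorem Surface.pull_target (S : Surface γ₀ γ₁) (α : DForm E M F 1) (x : ℝ) :
    γ₁.pull α x = comp₁ S.toFun α (x, 1) (dirX ℝ) := by
  obtain ⟨ε, h0, h1, h2, h3, h4, h5⟩ := S.sitting
  have := comp₁_comp S.smooth (f := γ₁.toFun) (A := fun x => (x, 1)) (z := x)
    (Filter.Eventually.of_forall fun x => (h5 x 1 (by linarith)).symm)
    (hasFDerivAt_prodMk_left x (1 : ℝ)) α 1
  simpa using! this

theorem IsParallelSolution.congr {a a' : ℝ → 𝔤} {x₀ : ℝ} {u : ℝ → G} (hu : IsParallelSolution a x₀ u)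
    (h : ∀ x, a' x = a x) : IsParallelSolution a' x₀ u :=
  ⟨hu.1, hu.2.1, fun x => by rw [h, hu.2.2]⟩

theorem IsFrame.transport₁_source {S : Surface γ₀ γ₁} {u : ℝ × ℝ → G} {β : ℝ × ℝ → ℝ → 𝔥}
    (hf : IsFrame C (comp₁ S.toFun θ) (comp₂ S.toFun Υ) u β) : transport₁ G θ γ₀ = (u (0, 0))⁻¹ :=
  transport₁_eq ((hf.row 0).congr (S.pull_source θ))

theorem IsFrame.transport₁_target {S : Surface γ₀ γ₁} {u : ℝ × ℝ → G} {β : ℝ × ℝ → ℝ → 𝔥}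
    (hf : IsFrame C (comp₁ S.toFun θ) (comp₂ S.toFun Υ) u β) : transport₁ G θ γ₁ = (u (0, 1))⁻¹ :=
  transport₁_eq ((hf.row 1).congr (S.pull_target θ))

/-- The surface transport is a `2`-cell. -/
theorem transport₁_surface (hD : IsConnectionDoublet C θ Υ) (S : Surface γ₀ γ₁) :
    transport₁ G θ γ₁ = C.t (transport₂ C θ Υ S) * transport₁ G θ γ₀ := by
  obtain ⟨u, β, hf⟩ := hD.exists_frame S.smooth
  obtain ⟨w, hw0, hw, e⟩ := exists_transport₂_eq hD hf
  rw [e, hf.t_holonomy (hD.isDoublet S.smooth) (fun y _ => comp₁_eq_zero (S.tang_right y) θ _)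
    (fun y _ => comp₁_eq_zero (S.tang_left y) θ _) hw0 hw, hf.transport₁_source,
    hf.transport₁_target]
  group

/-- More vectors than the rank of `L` have linearly dependent images, on which an alternating map
vanishes. -/
theorem map_eq_zero_of_finrank_range_lt {V : Type*} [NormedAddCommGroup V] [NormedSpace ℝ V]
    [FiniteDimensional ℝ V] {n : ℕ} (α : E [⋀^Fin n]→L[ℝ] F) (L : V →L[ℝ] E)
    (hL : Module.finrank ℝ (LinearMap.range L.toLinearMap) < n) (v : Fin n → V) :
    α (fun i => L (v i)) = 0 := by
  refine α.toAlternatingMap.map_linearDependent _ fun h => ?_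
  have h' : LinearIndependent ℝ (fun i => L.toLinearMap.rangeRestrict (v i)) :=
    LinearIndependent.of_comp (LinearMap.range L.toLinearMap).subtype h
  have := h'.fintype_card_le_finrank
  rw [Fintype.card_fin] at this
  omega

theorem comp₂_eq_zero_of_rk_le_one {V : Type*} [NormedAddCommGroup V] [NormedSpace ℝ V]
    [FiniteDimensional ℝ V] {h : V → M} {z : V} (hr : rk V E h z ≤ 1) (α : DForm E M F 2) (v w : V) :
    comp₂ h α z v w = 0 := by
  rw [comp₂, ← map_eq_zero_of_finrank_range_lt (α (h z)) (tang V E h z) (Nat.lt_succ_of_le hr) ![v, w]]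
  congr 1
  ext i; fin_cases i <;> rfl

/-- The pulled back `2`-form vanishes, hence so does `β`, and the holonomy of zero is `1`. -/
theorem transport₂_of_rk_le_one (hD : IsConnectionDoublet C θ Υ) {S : Surface γ₀ γ₁}
    (hr : ∀ z, rk (ℝ × ℝ) E S.toFun z ≤ 1) : transport₂ C θ Υ S = 1 := by
  obtain ⟨u, β, hf⟩ := hD.exists_frame S.smooth
  refine transport₂_eq hD hf (w := fun _ => 1) rfl ((solvesOn_const _ _).congr fun y _ => ?_)
  refine (eq_zero_of_fderiv_dirX (f := fun z => β z 1) ((hf.smooth_β 1).differentiable (by simp))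
    (x₁ := 1) (fun s => hf.β_one s 1) (fun z => ?_) (0, y)).symm
  rw [hf.fderiv_β, comp₂_eq_zero_of_rk_le_one (hr z), map_zero, neg_zero]

theorem rk_unit_le_one [FiniteDimensional ℝ E] (γ : Curve E p q) (z : ℝ × ℝ) :
    rk (ℝ × ℝ) E (Surface.unit γ).toFun z ≤ 1 :=
  (rk_comp_le γ.smooth contDiff_fst z).trans ((rk_le_finrank _ _).trans (by simp))

theorem transport₂_unit [FiniteDimensional ℝ E] (hD : IsConnectionDoublet C θ Υ) (γ : Curve E p q) :
    transport₂ C θ Υ (Surface.unit γ) = 1 :=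
  transport₂_of_rk_le_one hD (rk_unit_le_one γ)

/-- Thin homotopies of curves as surfaces. -/
theorem Curve.ThinHomotopic.exists_surface (h : γ₀.ThinHomotopic γ₁) :
    ∃ S : Surface γ₀ γ₁, ∀ z, rk (ℝ × ℝ) E S.toFun z ≤ 1 := by
  obtain ⟨h, hs, he, hr⟩ := h
  exact ⟨⟨h, hs, he⟩, hr⟩

/-- A thin homotopy of curves is a surface with trivial transport, so its source and target have the
same transport by the `2`-cell condition. -/
theorem Curve.ThinHomotopic.transport₁_eq (h : γ₀.ThinHomotopic γ₁) (hD : IsConnectionDoublet C θ Υ) :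
    transport₁ G θ γ₀ = transport₁ G θ γ₁ := by
  obtain ⟨S, hS⟩ := h.exists_surface
  rw [transport₁_surface hD S, transport₂_of_rk_le_one hD hS, map_one, one_mul]

/-! #### Compositions -/

theorem IsRow.eq_smul {a a₁ : ℝ → 𝔤} {b b₁ : ℝ → 𝔥} {u u₁ : ℝ → G} {β β₁ : ℝ → 𝔥} {c : ℝ}
    (h : IsRow C a b u β) (h₁ : IsRow C a₁ b₁ u₁ β₁) (ha : ∀ x, a x = a₁ x)
    (hb : ∀ x, b x = c • b₁ x) (x : ℝ) : β x = c • β₁ x := by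
  have hu : u = u₁ := SolvesOn.eq h.parallel.solvesOn
    (h₁.parallel.solvesOn.congr fun x _ => by rw [ha]) (x := 1)
    (by rw [h.parallel.2.1, h₁.parallel.2.1])
  subst hu
  have := eq_of_hasDerivAt_zero (f := fun x => β x - c • β₁ x) isOpen_univ isPreconnected_univ
    (fun x _ => by
      have := (h.hasDerivAt x).sub ((h₁.hasDerivAt x).const_smul c)
      rw [hb, map_smul, smul_neg, sub_self] at this
      exact this) (Set.mem_univ x) (Set.mem_univ 1)
  simpa [h.β_one, h₁.β_one, sub_eq_zero] using this

theorem Surface.vcomp_eq (S₂ : Surface γ₁ γ₂) (S₁ : Surface γ₀ γ₁) :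
    ∃ δ > 0, (∀ x y, y < 1 / 2 + δ → (S₂.vcomp S₁).toFun (x, y) = S₁.toFun (x, 2 * y)) ∧
      ∀ x y, 1 / 2 - δ < y → (S₂.vcomp S₁).toFun (x, y) = S₂.toFun (x, 2 * y - 1) := by
  obtain ⟨ε, h0, -, -, -, -, h5⟩ := S₁.sitting
  obtain ⟨ε', h0', -, -, -, h4', -⟩ := S₂.sitting
  have a1 := min_le_left ε ε'
  have a2 := min_le_right ε ε'
  have a3 : 0 < min ε ε' := lt_min h0 h0'
  refine ⟨min ε ε' / 2, by positivity, fun x y hy => ?_, fun x y hy => ?_⟩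
  · simp only [Surface.vcomp, glue]
    split_ifs with h
    · rfl
    · rw [h4' _ _ (by linarith), h5 _ _ (by linarith)]
  · simp only [Surface.vcomp, glue]
    split_ifs with h
    · rw [h4' _ _ (by linarith), h5 _ _ (by linarith)]
    · rfl

theorem Surface.hcomp_eq (T : Surface δ₀ δ₁) (S : Surface γ₀ γ₁) :
    ∃ δ > 0, (∀ x y, x < 1 / 2 + δ → (T.hcomp S).toFun (x, y) = S.toFun (2 * x, y)) ∧
      ∀ x y, 1 / 2 - δ < x → (T.hcomp S).toFun (x, y) = T.toFun (2 * x - 1, y) := by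
  obtain ⟨ε, h0, -, -, h3, -, -⟩ := S.sitting
  obtain ⟨ε', h0', -, h2', -, -, -⟩ := T.sitting
  have a1 := min_le_left ε ε'
  have a2 := min_le_right ε ε'
  have a3 : 0 < min ε ε' := lt_min h0 h0'
  refine ⟨min ε ε' / 2, by positivity, fun x y hy => ?_, fun x y hy => ?_⟩
  · simp only [Surface.hcomp, glue]
    split_ifs with h
    · rfl
    · rw [h2' _ _ (by linarith), h3 _ _ (by linarith)]
  · simp only [Surface.hcomp, glue]
    split_ifs with h
    · rw [h2' _ _ (by linarith), h3 _ _ (by linarith)]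
    · rfl

/-- Reparametrization of the second coordinate. -/
theorem comp_reparam_snd {h k : ℝ × ℝ → M} (hh : Smooth (ℝ × ℝ) E h) {f : ℝ → ℝ} {c : ℝ}
    (hf : ∀ y, HasDerivAt f c y) {s : Set ℝ} (hs : IsOpen s)
    (hk : ∀ x, ∀ y ∈ s, k (x, y) = h (x, f y)) (x : ℝ) {y : ℝ} (hy : y ∈ s) :
    (∀ α : DForm E M 𝔤 1, comp₁ k α (x, y) (dirX ℝ) = comp₁ h α (x, f y) (dirX ℝ)) ∧
      ∀ α : DForm E M 𝔥 2, comp₂ k α (x, y) (dirX ℝ) (dirS 1) =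
        c • comp₂ h α (x, f y) (dirX ℝ) (dirS 1) := by
  have e : k =ᶠ[𝓝 (x, y)] fun z => h (z.1, f z.2) :=
    Filter.eventuallyEq_of_mem ((hs.preimage continuous_snd).mem_nhds hy) fun z hz => hk z.1 z.2 hz
  have d : HasFDerivAt (fun z : ℝ × ℝ => (z.1, f z.2)) _ (x, y) :=
    hasFDerivAt_fst.prodMk ((hf y).hasFDerivAt.comp (x, y) hasFDerivAt_snd)
  refine ⟨fun α => ?_, fun α => ?_⟩
  · rw [comp₁_comp hh e d]
    simp
  · rw [comp₂_comp hh e d, ← comp₂_smul_right]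
    simp

/-- Reparametrization of the first coordinate. -/
theorem comp_reparam_fst {h k : ℝ × ℝ → M} (hh : Smooth (ℝ × ℝ) E h) {f : ℝ → ℝ} {c : ℝ}
    (hf : ∀ x, HasDerivAt f c x) {s : Set ℝ} (hs : IsOpen s)
    (hk : ∀ x ∈ s, ∀ y, k (x, y) = h (f x, y)) {x : ℝ} (hx : x ∈ s) (y : ℝ) :
    (∀ α : DForm E M 𝔤 1, comp₁ k α (x, y) (dirX ℝ) = c • comp₁ h α (f x, y) (dirX ℝ)) ∧
      ∀ α : DForm E M 𝔥 2, comp₂ k α (x, y) (dirX ℝ) (dirS 1) =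
        c • comp₂ h α (f x, y) (dirX ℝ) (dirS 1) := by
  have e : k =ᶠ[𝓝 (x, y)] fun z => h (f z.1, z.2) :=
    Filter.eventuallyEq_of_mem ((hs.preimage continuous_fst).mem_nhds hx) fun z hz => hk z.1 hz z.2
  have d : HasFDerivAt (fun z : ℝ × ℝ => (f z.1, z.2)) _ (x, y) :=
    ((hf x).hasFDerivAt.comp (x, y) hasFDerivAt_fst).prodMk hasFDerivAt_snd
  refine ⟨fun α => ?_, fun α => ?_⟩
  · rw [comp₁_comp hh e d, ← comp₁_smul]
    simp
  · rw [comp₂_comp hh e d, ← comp₂_smul_left]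
    simp

/-- A row of the composite is a row of one of the pieces with `B` doubled by the change of speed in
`y`, so `β(0, ·)` is a concatenation and the holonomies multiply. -/
theorem transport₂_vcomp (hD : IsConnectionDoublet C θ Υ) (S₂ : Surface γ₁ γ₂) (S₁ : Surface γ₀ γ₁) :
    transport₂ C θ Υ (S₂.vcomp S₁) = transport₂ C θ Υ S₂ * transport₂ C θ Υ S₁ := by
  obtain ⟨δ, hδ, h₁, h₂⟩ := Surface.vcomp_eq S₂ S₁
  obtain ⟨u, β, hf⟩ := hD.exists_frame (S₂.vcomp S₁).smooth
  obtain ⟨u₁, β₁, hf₁⟩ := hD.exists_frame S₁.smooth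
  obtain ⟨u₂, β₂, hf₂⟩ := hD.exists_frame S₂.smooth
  obtain ⟨w, hw0, hw, e⟩ := exists_transport₂_eq hD hf
  obtain ⟨w₁, hw0₁, hw₁, e₁⟩ := exists_transport₂_eq hD hf₁
  obtain ⟨w₂, hw0₂, hw₂, e₂⟩ := exists_transport₂_eq hD hf₂
  have b₁ : ∀ y, y < 1 / 2 + δ → β (0, y) 1 = (2 : ℝ) • β₁ (0, 2 * y) 1 := fun y hy => by
    have := fun x => comp_reparam_snd (𝔤 := 𝔤) (𝔥 := 𝔥) S₁.smooth hasDerivAt_two_mul isOpen_Iio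
      (fun x y hy => h₁ x y hy) x hy
    exact (hf.isRow y 1).eq_smul (hf₁.isRow (2 * y) 1) (fun x => (this x).1 θ)
      (fun x => (this x).2 Υ) 0
  have b₂ : ∀ y, 1 / 2 - δ < y → β (0, y) 1 = (2 : ℝ) • β₂ (0, 2 * y - 1) 1 := fun y hy => by
    have := fun x => comp_reparam_snd (𝔤 := 𝔤) (𝔥 := 𝔥) S₂.smooth hasDerivAt_two_mul_sub_one isOpen_Ioi
      (fun x y hy => h₂ x y hy) x hy
    exact (hf.isRow y 1).eq_smul (hf₂.isRow (2 * y - 1) 1) (fun x => (this x).1 θ)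
      (fun x => (this x).2 Υ) 0
  have k₁ : w (1 / 2) = w₁ 1 := by
    have := SolvesOn.eqOn (w := fun x => w₁ (2 * x)) isOpen_Iio isPreconnected_Iio
      (hw.mono (Set.subset_univ _))
      (((hw₁.comp hasDerivAt_two_mul).mono (Set.subset_univ (Set.Iio (1 / 2 + δ)))).congr
        fun y hy => (b₁ y hy).symm)
      (x := 0) (y := 1 / 2) (show 0 < 1 / 2 + δ by linarith) (show 1 / 2 < 1 / 2 + δ by linarith)
      (by simp [hw0, hw0₁])
    simpa using this
  have k₂ : w 1 = w₂ 1 * w₁ 1 := by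
    have := SolvesOn.eqOn (w := fun x => w₂ (2 * x - 1) * w₁ 1) isOpen_Ioi isPreconnected_Ioi
      (hw.mono (Set.subset_univ _))
      ((((hw₂.comp hasDerivAt_two_mul_sub_one).mul_const _).mono
        (Set.subset_univ (Set.Ioi (1 / 2 - δ)))).congr fun y hy => (b₂ y hy).symm)
      (x := 1 / 2) (y := 1) (show 1 / 2 - δ < 1 / 2 by linarith) (show 1 / 2 - δ < 1 by linarith)
      (by norm_num [k₁, hw0₂])
    norm_num at this
    exact this
  rw [e, e₁, e₂, k₂]

/-- Concatenation of rows gives `β = β₂ + ṁ(u₂(0,y)⁻¹) β₁` at `x = 0`. The product `w₂ ·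
m(u₂(0,0)⁻¹)(w₁)` has this logarithmic derivative, because `Ad(w₂) = ṁ(t(w₂))` and `t(w₂) =
u₂(0,y)⁻¹ u₂(0,0)`. -/
theorem transport₂_hcomp (hD : IsConnectionDoublet C θ Υ) (T : Surface δ₀ δ₁) (S : Surface γ₀ γ₁) :
    transport₂ C θ Υ (T.hcomp S) =
      transport₂ C θ Υ T * C.m (transport₁ G θ δ₀) (transport₂ C θ Υ S) := by
  obtain ⟨δ, hδ, h₁, h₂⟩ := Surface.hcomp_eq T S
  obtain ⟨u, β, hf⟩ := hD.exists_frame (T.hcomp S).smooth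
  obtain ⟨u₁, β₁, hf₁⟩ := hD.exists_frame S.smooth
  obtain ⟨u₂, β₂, hf₂⟩ := hD.exists_frame T.smooth
  obtain ⟨w₁, hw0₁, hw₁, e₁⟩ := exists_transport₂_eq hD hf₁
  obtain ⟨w₂, hw0₂, hw₂, e₂⟩ := exists_transport₂_eq hD hf₂
  have ht := hf₂.t_holonomy (hD.isDoublet T.smooth) (fun y _ => comp₁_eq_zero (T.tang_right y) θ _)
    (fun y _ => comp₁_eq_zero (T.tang_left y) θ _) hw0₂ hw₂
  rw [e₁, e₂, hf₂.transport₁_source]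
  refine transport₂_eq hD hf (w := fun y => w₂ y * C.m (u₂ (0, 0))⁻¹ (w₁ y)) (by simp [hw0₁, hw0₂])
    ((hw₂.mul (hw₁.map_m C (u₂ (0, 0))⁻¹)).congr fun y _ => ?_)
  have r₁ := fun x hx => comp_reparam_fst (𝔤 := 𝔤) (𝔥 := 𝔥) (x := x) S.smooth hasDerivAt_two_mul
    isOpen_Iio (fun x hx y => h₁ x y hx) hx y
  have r₂ := fun x hx => comp_reparam_fst (𝔤 := 𝔤) (𝔥 := 𝔥) (x := x) T.smooth
    hasDerivAt_two_mul_sub_one isOpen_Ioi (fun x hx y => h₂ x y hx) hx y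
  rw [(hf.isRow y 1).concat hδ (hf₁.isRow y 1) (hf₂.isRow y 1) (fun x hx => (r₁ x hx).1 θ)
    (fun x hx => (r₂ x hx).1 θ) (fun x hx => (r₁ x hx).2 Υ) (fun x hx => (r₂ x hx).2 Υ), ← C.mdot_t,
    ht, ← C.mdot_mul_apply]
  simp

end Surfaces

/-! ### Gauge transformations and homotopy invariance of the transport -/

section Transports

variable {E M 𝔤 𝔥 G H : Type*}
  [NormedAddCommGroup E] [NormedSpace ℝ E] [FiniteDimensional ℝ E]
  [TopologicalSpace M] [ChartedSpace E M] [IsManifold 𝓘(ℝ, E) ∞ M]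
  [NormedAddCommGroup 𝔤] [NormedSpace ℝ 𝔤] [NormedAddCommGroup 𝔥] [NormedSpace ℝ 𝔥]
  [FiniteDimensional ℝ 𝔤] [FiniteDimensional ℝ 𝔥]
  [Group G] [TopologicalSpace G] [ChartedSpace 𝔤 G] [LieGroup 𝓘(ℝ, 𝔤) ∞ G]
  [Group H] [TopologicalSpace H] [ChartedSpace 𝔥 H] [LieGroup 𝓘(ℝ, 𝔥) ∞ H]
  {C : LieCrossedModule 𝔤 𝔥 G H} {θ : DForm E M 𝔤 1} {Υ : DForm E M 𝔥 2} {J : DForm E M 𝔥 1}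
  {g : M → G} {p q : M} {γ₀ γ₁ γ₂ γ₃ : Curve E p q}

theorem Surface.source_eq (S : Surface γ₀ γ₁) (x : ℝ) : S.toFun (x, 0) = γ₀.toFun x := by
  obtain ⟨ε, h0, h1, h2, h3, h4, h5⟩ := S.sitting
  exact h4 x 0 h0

theorem Surface.target_eq (S : Surface γ₀ γ₁) (x : ℝ) : S.toFun (x, 1) = γ₁.toFun x := by
  obtain ⟨ε, h0, h1, h2, h3, h4, h5⟩ := S.sitting
  exact h5 x 1 (by linarith)

theorem Surface.left_eq (S : Surface γ₀ γ₁) (y : ℝ) : S.toFun (0, y) = p := by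
  obtain ⟨ε, h0, h1, h2, h3, h4, h5⟩ := S.sitting
  exact h2 0 y h0

theorem Surface.right_eq (S : Surface γ₀ γ₁) (y : ℝ) : S.toFun (1, y) = q := by
  obtain ⟨ε, h0, h1, h2, h3, h4, h5⟩ := S.sitting
  exact h3 1 y (by linarith)

/-- The gauge transformation along the rows of a surface. -/
theorem IsFrame.exists_gauge {S : Surface γ₀ γ₁} {u : ℝ × ℝ → G} {β : ℝ × ℝ → ℝ → 𝔥}
    (hf : IsFrame C (comp₁ S.toFun θ) (comp₂ S.toFun Υ) u β) (hθ : θ.IsSmooth)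
    (hg : Smooth E 𝔤 g) (hJ : J.IsSmooth) :
    ∃ Λ : ℝ × ℝ → H, Smooth (ℝ × ℝ) 𝔥 Λ ∧ (∀ s, Λ (1, s) = 1) ∧
      (∀ z, rlog (ℝ × ℝ) 𝔥 Λ z (dirX ℝ) =
        -Ad (Λ z) (C.mdot ((u z)⁻¹ * (g (S.toFun z))⁻¹) (comp₁ S.toFun J z (dirX ℝ)))) ∧
      gaugeHol C θ g J γ₀ = Λ (0, 0) ∧ gaugeHol C θ g J γ₁ = Λ (0, 1) := by
  have hκ : Smooth (ℝ × ℝ) 𝔤 (fun z => g (S.toFun z)) := ContMDiff.comp hg S.smooth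
  obtain ⟨μ, hμ, hμ1, hμs⟩ := exists_smooth_solution (K := H)
    (fun z => C.mdot ((u z)⁻¹ * (g (S.toFun z))⁻¹) (comp₁ S.toFun J z (dirX ℝ)))
    (contDiff_mdot_apply C (u := fun z => (u z)⁻¹ * (g (S.toFun z))⁻¹)
      (ContMDiff.mul hf.smooth_u.inv' hκ.inv') (contDiff_comp₁ hJ S.smooth _)) 1
  refine ⟨fun z => (μ z)⁻¹, hμ.inv', fun s => by simp [hμ1], fun z => ?_, ?_, ?_⟩
  · rw [rlog_inv (hμ.mdAt z), neg_apply, ContinuousLinearMap.comp_apply,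
      ← rightLogDeriv_row (x := z.1) (s := z.2) (hμ.mdAt z), (hμs z.2 z.1 (Set.mem_univ _)).2]
  · exact gaugeHol_eq hθ hg hJ ((hf.row 0).congr (S.pull_source θ)) (hμ1 0)
      ((hμs 0).congr fun x _ => by rw [S.source_eq, S.pull_source])
  · exact gaugeHol_eq hθ hg hJ ((hf.row 1).congr (S.pull_target θ)) (hμ1 1)
      ((hμs 1).congr fun x _ => by rw [S.target_eq, S.pull_target])

/-- The gauge transformation along a curve is a `2`-cell. -/
theorem transport₁_gauge (hD : IsConnectionDoublet C θ Υ) (hg : Smooth E 𝔤 g) (hJ : J.IsSmooth)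
    (γ : Curve E p q) :
    transport₁ G (gaugeθ C g J θ) γ * g p =
      C.t (C.m (g q) (gaugeHol C θ g J γ)) * (g q * transport₁ G θ γ) := by
  -- The curve is regarded as a constant family of rows, so that the statement on frames applies at
  -- the row `y = 0`.
  set S := Surface.unit γ
  obtain ⟨u, β, hf⟩ := hD.exists_frame S.smooth
  obtain ⟨u', β', hf'⟩ := (hD.gauge hg hJ).exists_frame S.smooth
  obtain ⟨Λ, hΛ, hΛ1, hΛJ, e, -⟩ := hf.exists_gauge hD.smooth_θ hg hJ
  have := hf.gauge_u hf' (κ := fun z => g (S.toFun z)) (c := g q) (ContMDiff.comp hg S.smooth)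
    (fun y => by rw [S.right_eq])
    (fun z v => comp₁_gaugeθ hg ((S.smooth z).mdifferentiableAt (by simp)) v) hΛ hΛ1 hΛJ (0, 0)
  rw [hf.transport₁_source, hf'.transport₁_source, this, e, C.equivariant, S.left_eq]
  group

/-- At `x = 0` the term in `J` of `gauge_β` drops out, leaving `ṁ(c⁻¹) β' = Ad(Λ) β + dΛ Λ⁻¹` with
`c = g(q)`. This is the logarithmic derivative of `Λ w`; the factor `Λ(0,0)⁻¹` restores the initial
value, and `m(c)` removes `ṁ(c⁻¹)`. -/
theorem transport₂_gauge (hD : IsConnectionDoublet C θ Υ) (hg : Smooth E 𝔤 g) (hJ : J.IsSmooth)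
    (S : Surface γ₀ γ₁) :
    transport₂ C (gaugeθ C g J θ) (gaugeΥ C g J θ Υ) S * C.m (g q) (gaugeHol C θ g J γ₀) =
      C.m (g q) (gaugeHol C θ g J γ₁ * transport₂ C θ Υ S) := by
  obtain ⟨u, β, hf⟩ := hD.exists_frame S.smooth
  obtain ⟨u', β', hf'⟩ := (hD.gauge hg hJ).exists_frame S.smooth
  obtain ⟨Λ, hΛ, hΛ1, hΛJ, e₀, e₁⟩ := hf.exists_gauge hD.smooth_θ hg hJ
  obtain ⟨w, hw0, hw, e⟩ := exists_transport₂_eq hD hf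
  have key := fun z v => hf.gauge_β hf' ((hD.gauge hg hJ).isDoublet S.smooth)
    (κ := fun z => g (S.toFun z)) (c := g q) (ContMDiff.comp hg S.smooth)
    (fun y => by rw [S.right_eq])
    (fun z v => comp₁_gaugeθ hg ((S.smooth z).mdifferentiableAt (by simp)) v)
    (fun z v w => comp₂_gaugeΥ hJ (S.smooth z) v w) (contDiff_comp₁ hJ S.smooth)
    (fun s w => comp₁_eq_zero (S.tang_right s) _ _) (fun s w => comp₁_eq_zero (S.tang_right s) _ _)
    hΛ hΛ1 hΛJ z v
  have hΛs : SolvesOn (fun y => rlog (ℝ × ℝ) 𝔥 Λ (0, y) (dirS 1)) (fun y => Λ (0, y)) Set.univ :=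
    fun y _ => ⟨mdAt_col (hΛ.mdAt _), by
      rw [HigherTransport.rightLogDeriv_eq, rlog_col (hΛ.mdAt _)]⟩
  have := transport₂_eq (hD.gauge hg hJ) hf' (w := fun y => C.m (g q) (Λ (0, y) * w y * (Λ (0, 0))⁻¹))
    (by simp [hw0]) ((((hΛs.mul hw).mul_const _).map_m C (g q)).congr fun y _ => by
      have h := key (0, y) 1
      rw [comp₁_eq_zero (S.tang_left y), map_zero, add_zero] at h
      rw [add_comm, ← h, C.mdot_apply_mdot_inv])
  rw [this, e, e₀, e₁, ← map_mul, inv_mul_cancel_right]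

/-- Naturality is applied to the thin homotopy itself: both surface transports are `1`, and
`m(g(q))` is injective. -/
theorem Curve.ThinHomotopic.gaugeHol_eq (h : γ₀.ThinHomotopic γ₁) (hD : IsConnectionDoublet C θ Υ)
    (hg : Smooth E 𝔤 g) (hJ : J.IsSmooth) : gaugeHol C θ g J γ₀ = gaugeHol C θ g J γ₁ := by
  obtain ⟨S, hS⟩ := h.exists_surface
  have := transport₂_gauge hD hg hJ S
  rw [transport₂_of_rk_le_one hD hS, transport₂_of_rk_le_one (hD.gauge hg hJ) hS, one_mul, mul_one] at this
  exact (C.m (g q)).injective this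

/-! #### Homotopies -/

/-- The transport along a slice of a homotopy of surfaces. -/
theorem transport₂_slice (hD : IsConnectionDoublet C θ Υ) {h : ℝ × ℝ × ℝ → M}
    (hs : Smooth (ℝ × ℝ × ℝ) E h) {u : ℝ × ℝ × ℝ → G} {β : ℝ × ℝ × ℝ → ℝ × ℝ → 𝔥}
    (hf : IsFrame C (comp₁ h θ) (comp₂ h Υ) u β) {S : Surface γ₀ γ₁} {z : ℝ}
    (hS : ∀ x y, h (x, y, z) = S.toFun (x, y)) {w : ℝ → H} (hw0 : w 0 = 1)
    (hw : SolvesOn (fun y => β (0, y, z) (1, 0)) w Set.univ) : transport₂ C θ Υ S = w 1 := by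
  obtain ⟨u', β', hf'⟩ := hD.exists_frame S.smooth
  have d : ∀ x y, HasFDerivAt (fun v : ℝ × ℝ => (v.1, v.2, z))
      ((ContinuousLinearMap.fst ℝ ℝ ℝ).prod ((ContinuousLinearMap.snd ℝ ℝ ℝ).prod 0)) (x, y) := fun x y =>
    hasFDerivAt_fst.prodMk (hasFDerivAt_snd.prodMk (hasFDerivAt_const z _))
  have hS' : ∀ x y, S.toFun =ᶠ[𝓝 (x, y)] fun v => h (v.1, v.2, z) := fun x y =>
    Filter.Eventually.of_forall fun v => (hS v.1 v.2).symm
  refine transport₂_eq hD hf' hw0 (hw.congr fun y _ => ?_)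
  have := (hf.isRow (y, z) (1, 0)).eq_smul (hf'.isRow y 1) (c := 1) (fun x => ?_) (fun x => ?_) 0
  · rwa [one_smul] at this
  · rw [comp₁_comp hs (hS' x y) (d x y)]
    rfl
  · rw [comp₂_comp hs (hS' x y) (d x y), one_smul]
    rfl

theorem curv₃_eq_zero_of_rk_le_two {V : Type*} [NormedAddCommGroup V] [NormedSpace ℝ V]
    [FiniteDimensional ℝ V] (hΥ : Υ.IsSmooth) {h : V → M} {z : V} (hh : SmoothAt V E h z)
    (hr : rk V E h z ≤ 2) (v₁ v₂ v₃ : V) : curv₃ C (comp₁ h θ) (comp₂ h Υ) z v₁ v₂ v₃ = 0 := by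
  rw [curv₃_comp C hΥ hh, pull_apply]
  exact map_eq_zero_of_finrank_range_lt _ (tang V E h z) (Nat.lt_succ_of_le hr) _

/-- A side of a homotopy moving by a thin homotopy. -/
theorem IsFrame.β_side_eq_zero {h : ℝ × ℝ × ℝ → M} (hs : Smooth (ℝ × ℝ × ℝ) E h)
    {u : ℝ × ℝ × ℝ → G} {β : ℝ × ℝ × ℝ → ℝ × ℝ → 𝔥}
    (hf : IsFrame C (comp₁ h θ) (comp₂ h Υ) u β) {y : ℝ}
    (hr : ∀ w, rk (ℝ × ℝ) E (fun v : ℝ × ℝ => h (v.1, y, v.2)) w ≤ 1) (z : ℝ) :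
    β (0, y, z) (0, 1) = 0 := by
  have d : ∀ x, HasFDerivAt (fun v : ℝ × ℝ => (v.1, y, v.2))
      ((ContinuousLinearMap.fst ℝ ℝ ℝ).prod
        ((0 : ℝ × ℝ →L[ℝ] ℝ).prod (ContinuousLinearMap.snd ℝ ℝ ℝ))) (x, z) := fun x =>
    hasFDerivAt_fst.prodMk ((hasFDerivAt_const y _).prodMk hasFDerivAt_snd)
  rw [← hf.β_one (y, z) (0, 1)]
  refine eq_of_hasDerivAt_zero (f := fun x => β (x, y, z) (0, 1)) isOpen_univ isPreconnected_univ
    (fun x _ => ?_) (Set.mem_univ 0) (Set.mem_univ 1)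
  have h1 := hf.hasDerivAt_β x (y, z) (0, 1)
  have h2 := comp₂_comp hs (Filter.EventuallyEq.refl _ _) (d x) Υ (dirX ℝ) (dirS 1)
  rw [comp₂_eq_zero_of_rk_le_one (hr (x, z))] at h2
  have h3 : comp₂ h Υ (x, y, z) (dirX (ℝ × ℝ)) (dirS ((0, 1) : ℝ × ℝ)) = 0 := h2.symm
  rwa [h3, map_zero, neg_zero] at h1

/-- The `2`-curvature of the homotopy vanishes, by rank or by flatness, so the primitives `β`
restricted to `x = 0` form a flat connection in `(y, z)`; there `B` itself vanishes, the homotopy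
being constant. Thinness of the moving source and target curves makes the component along `z` vanish
at `y = 0` and `y = 1`. -/
theorem Surface.Homotopic.transport₂_eq {k : Kind} {S₀ : Surface γ₀ γ₁} {S₁ : Surface γ₂ γ₃}
    (hS : S₀.Homotopic k S₁) (hD : IsConnectionDoublet C θ Υ)
    (hk : k = Kind.fundamental → IsFlat C θ Υ) : transport₂ C θ Υ S₀ = transport₂ C θ Υ S₁ := by
  obtain ⟨h, hs, ⟨ε, h0, h1, h2, -, -, h5, h6⟩, hr0, hr1, hr⟩ := hS
  obtain ⟨u, β, hf⟩ := hD.exists_frame hs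
  have t1 := tang_eq_zero_right (E := E) (h := h) h0 fun x s => h2 x s.1 s.2
  have t0 := tang_eq_zero_left (E := E) (h := h) h0 fun x s => h1 x s.1 s.2
  have h3 : ∀ z v₁ v₂ v₃, curv₃ C (comp₁ h θ) (comp₂ h Υ) z v₁ v₂ v₃ = 0 := by
    cases k with
    | path => exact fun z => curv₃_eq_zero_of_rk_le_two hD.smooth_Υ (hs z) (hr rfl z)
    | fundamental => exact fun z => (hk rfl).curv₃_eq hD.smooth_Υ (hs z)
  have key := hf.curl_β (hD.isDoublet hs) (fun s w => comp₁_eq_zero (t1 s) _ _)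
    (fun s w w' => comp₂_eq_zero (t1 s) _ _ _) (fun z w w' => h3 z _ _ _)
  have hβ : ∀ w, ContDiff ℝ ∞ (fun s => β (0, s) w) := fun w =>
    (hf.smooth_β w).comp (contDiff_prodMk_right 0)
  choose w hw0 hw using fun z : ℝ => exists_solution (K := H) (fun y => β (0, y, z) (1, 0))
    ((hβ (1, 0)).comp (contDiff_prodMk_left z)) 0
  have hβd : ∀ w s v, fderiv ℝ (fun s => β (0, s) w) s v = fderiv ℝ (fun z => β z w) (0, s) (dirS v) := by
    intro w s v
    have h : HasFDerivAt (fun s => β (0, s) w) _ s :=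
      ((hf.smooth_β w).differentiable (by simp) (0, s)).hasFDerivAt.comp s
        (hasFDerivAt_prodMk_right 0 s)
    rw [h.fderiv]
    simp
  rw [transport₂_slice hD hs hf (fun x y => h5 x y 0 h0) (hw0 0) (hw 0),
    transport₂_slice hD hs hf (fun x y => h6 x y 1 (by linarith)) (hw0 1) (hw 1)]
  refine flat_holonomy_eq (q := fun s => β (0, s) (1, 0)) (r := fun s => β (0, s) (0, 1))
    (hβ _) (hβ _) (fun s => ?_) (hf.β_side_eq_zero hs hr0) (hf.β_side_eq_zero hs hr1) hw0 hw 0 1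
  rw [hβd, hβd, key, comp₂_eq_zero (t0 s), map_zero, sub_zero]

end Transports

/-! ### The parallel transport `2`-functor -/

section Functors

variable {E M 𝔤 𝔥 G H : Type*}
  [NormedAddCommGroup E] [NormedSpace ℝ E] [FiniteDimensional ℝ E]
  [TopologicalSpace M] [ChartedSpace E M] [IsManifold 𝓘(ℝ, E) ∞ M]
  [NormedAddCommGroup 𝔤] [NormedSpace ℝ 𝔤] [NormedAddCommGroup 𝔥] [NormedSpace ℝ 𝔥]
  [FiniteDimensional ℝ 𝔤] [FiniteDimensional ℝ 𝔥]
  [Group G] [TopologicalSpace G] [ChartedSpace 𝔤 G] [LieGroup 𝓘(ℝ, 𝔤) ∞ G]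
  [Group H] [TopologicalSpace H] [ChartedSpace 𝔥 H] [LieGroup 𝓘(ℝ, 𝔥) ∞ H]
  {C : LieCrossedModule 𝔤 𝔥 G H} {θ : DForm E M 𝔤 1} {Υ : DForm E M 𝔥 2} {J : DForm E M 𝔥 1}
  {g : M → G} {k : Kind} {p q : M}

/-- Parallel transport of thin homotopy classes of curves. -/
def P1.transport (hD : IsConnectionDoublet C θ Υ) (a : P1 E p q) : G :=
  Quot.lift (fun γ : Curve E p q => transport₁ G θ γ) (fun _ _ h => h.transport₁_eq hD) a

/-- Parallel transport of homotopy classes of surfaces. -/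
def P2.transport (hD : IsConnectionDoublet C θ Υ) (hk : k = Kind.fundamental → IsFlat C θ Υ)
    (S : P2 E k p q) : H :=
  Quot.lift (fun S : (Σ γ : Curve E p q × Curve E p q, Surface γ.1 γ.2) => transport₂ C θ Υ S.2)
    (fun _ _ h => h.transport₂_eq hD hk) S

/-- The gauge transformation along thin homotopy classes of curves. -/
def P1.gaugeHol (hD : IsConnectionDoublet C θ Υ) (hg : Smooth E 𝔤 g) (hJ : J.IsSmooth)
    (a : P1 E p q) : H :=
  Quot.lift (fun γ : Curve E p q => HigherTransport.gaugeHol C θ g J γ)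
    (fun _ _ h => h.gaugeHol_eq hD hg hJ) a

/-- The parallel transport `2`-functor of a connection doublet. -/
def transportFunctor (hD : IsConnectionDoublet C θ Υ) (hk : k = Kind.fundamental → IsFlat C θ Υ) :
    TwoFunctor E M k C where
  map₁ a := a.transport hD
  map₂ S := ⟨S.transport hD hk, by
    obtain ⟨S⟩ := S
    exact transport₁_surface hD S.2⟩
  map₁_id p := transport₁_unit θ p
  map₁_comp b a := by
    obtain ⟨γ₂⟩ := b
    obtain ⟨γ₁⟩ := a
    exact transport₁_comp hD.smooth_θ γ₂ γ₁
  map₂_unit a := by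
    obtain ⟨γ⟩ := a
    exact transport₂_unit hD γ
  map₂_vcomp S₂ S₁ := Subtype.ext (transport₂_vcomp hD S₂ S₁)
  map₂_hcomp T S := by
    obtain ⟨T⟩ := T
    obtain ⟨S⟩ := S
    exact transport₂_hcomp hD T.2 S.2

theorem transportFunctor_isParallelTransport (hD : IsConnectionDoublet C θ Υ)
    (hk : k = Kind.fundamental → IsFlat C θ Υ) :
    (transportFunctor hD hk).IsParallelTransport θ Υ :=
  ⟨fun _ _ _ => rfl, fun _ _ _ _ _ => rfl⟩

/-- The pseudonatural transformation of a `1`-gauge transformation. -/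
def gaugeTransformation (hD : IsConnectionDoublet C θ Υ) (hg : Smooth E 𝔤 g) (hJ : J.IsSmooth)
    (hk : k = Kind.fundamental → IsFlat C θ Υ) :
    PseudoNat (transportFunctor hD hk)
      (transportFunctor (hD.gauge hg hJ) fun h => (hk h).gauge hD hg hJ) where
  app := g
  cell {p q} a := ⟨C.m (g q) (a.gaugeHol hD hg hJ), by
    obtain ⟨γ⟩ := a
    exact transport₁_gauge hD hg hJ γ⟩
  naturality_id p := by
    change C.m (g p) (gaugeHol C θ g J (Curve.unit E p)) = 1
    rw [gaugeHol_unit hD.smooth_θ hg hJ, map_one]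
  naturality_comp {p q r} b a := by
    obtain ⟨γ₂⟩ := b
    obtain ⟨γ₁⟩ := a
    change C.m (g r) (gaugeHol C θ g J (γ₂.comp γ₁)) =
      1 * C.m (transport₁ G (gaugeθ C g J θ) γ₂) (C.m (g q) (gaugeHol C θ g J γ₁)) *
        (C.m (g r) (gaugeHol C θ g J γ₂) * C.m _ 1)
    -- With `Y = m(g(r))(G(γ₂))`, the `2`-cell condition replaces `F'(γ₂) g(q)` by `t(Y) g(r)
    -- F(γ₂)`. The Peiffer identity turns the action of `t(Y)` into conjugation, whose factor `Y⁻¹`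
    -- cancels the second factor of the pasting.
    rw [gaugeHol_comp hD.smooth_θ hg hJ, map_one, mul_one, one_mul, ← MulAut.mul_apply, ← map_mul,
      transport₁_gauge hD hg hJ, map_mul C.m, MulAut.mul_apply, C.peiffer, map_mul C.m,
      MulAut.mul_apply, inv_mul_cancel_right, map_mul]
  naturality₂ {p q} S := by
    obtain ⟨⟨⟨γ₀, γ₁⟩, S⟩⟩ := S
    refine Subtype.ext ?_
    change transport₂ C (gaugeθ C g J θ) (gaugeΥ C g J θ Υ) S * C.m _ 1 *
        C.m (g q) (gaugeHol C θ g J γ₀) =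
      C.m (g q) (gaugeHol C θ g J γ₁) * (1 * C.m (g q) (transport₂ C θ Υ S))
    rw [map_one, mul_one, one_mul, transport₂_gauge hD hg hJ, map_mul]

end Functors

end HigherTransport
end

open HigherTransport
theorem mainTheorem7
    {E : Type*} [NormedAddCommGroup E] [NormedSpace ℝ E] [FiniteDimensional ℝ E]
    {M : Type*} [TopologicalSpace M] [ChartedSpace E M] [IsManifold 𝓘(ℝ, E) ∞ M]
    {𝔤 : Type*} [NormedAddCommGroup 𝔤] [NormedSpace ℝ 𝔤] [FiniteDimensional ℝ 𝔤]
    {𝔥 : Type*} [NormedAddCommGroup 𝔥] [NormedSpace ℝ 𝔥] [FiniteDimensional ℝ 𝔥]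
    {G : Type*} [Group G] [TopologicalSpace G] [ChartedSpace 𝔤 G] [LieGroup 𝓘(ℝ, 𝔤) ∞ G]
    {H : Type*} [Group H] [TopologicalSpace H] [ChartedSpace 𝔥 H] [LieGroup 𝓘(ℝ, 𝔥) ∞ H]
    (C : LieCrossedModule 𝔤 𝔥 G H)
    (θ : DForm E M 𝔤 1) (Υ : DForm E M 𝔥 2) (hD : IsConnectionDoublet C θ Υ)
    (g : M → G) (J : DForm E M 𝔥 1) (hg : Smooth E 𝔤 g) (hJ : J.IsSmooth) :
    -- the differential equations defining the transports are well posed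
    (∀ (a : ℝ → 𝔤) (x₀ : ℝ), ContDiff ℝ ∞ a → ∃! u : ℝ → G, IsParallelSolution a x₀ u) ∧
    (∀ (p q : M) (γ₀ γ₁ : Curve E p q) (S : Surface γ₀ γ₁) (x₀ y₀ : ℝ),
      ∃! W : ℝ × ℝ → H, IsSurfaceSolution C θ Υ S x₀ y₀ W) ∧
    (∀ (p q : M) (γ : Curve E p q) (x₀ : ℝ),
      ∃! Λ : ℝ → H, IsGaugeSolution C θ g J γ x₀ Λ) ∧
    -- the gauge transformed doublet
    IsConnectionDoublet C (gaugeθ C g J θ) (gaugeΥ C g J θ Υ) ∧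
    (IsFlat C θ Υ → IsFlat C (gaugeθ C g J θ) (gaugeΥ C g J θ Υ)) ∧
    -- functoriality and thin homotopy invariance of the gauge transformation along curves
    (∀ p : M, gaugeHol C θ g J (Curve.unit E p) = 1) ∧
    (∀ (p q : M) (γ : Curve E p q),
      gaugeHol C θ g J γ.inv = C.m (transport₁ G θ γ)⁻¹ (gaugeHol C θ g J γ)⁻¹) ∧
    (∀ (p q r : M) (γ₂ : Curve E q r) (γ₁ : Curve E p q),
      gaugeHol C θ g J (γ₂.comp γ₁) =
        gaugeHol C θ g J γ₂ * C.m (transport₁ G θ γ₂) (gaugeHol C θ g J γ₁)) ∧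
    (∀ (p q : M) (γ₀ γ₁ : Curve E p q), γ₀.ThinHomotopic γ₁ →
      gaugeHol C θ g J γ₀ = gaugeHol C θ g J γ₁) ∧
    -- the pseudonatural transformation, for the path `2`-groupoid and, if the doublet is flat,
    -- for the fundamental `2`-groupoid
    (∀ k : Kind, (k = Kind.fundamental → IsFlat C θ Υ) →
      ∃ F F' : TwoFunctor E M k C,
        F.IsParallelTransport θ Υ ∧
        F'.IsParallelTransport (gaugeθ C g J θ) (gaugeΥ C g J θ Υ) ∧
        ∃ η : PseudoNat F F', (∀ p : M, η.app p = g p) ∧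
          ∀ (p q : M) (γ : Curve E p q),
            (η.cell (P1.mk γ)).1 = C.m (g q) (gaugeHol C θ g J γ)) :=
  ⟨fun a x₀ ha => existsUnique_parallelSolution a x₀ ha,
    fun _ _ _ _ S x₀ y₀ => existsUnique_surfaceSolution S hD x₀ y₀,
    fun _ _ γ x₀ => existsUnique_gaugeSolution C hD.smooth_θ hg hJ γ x₀,
    hD.gauge hg hJ, fun hF => hF.gauge hD hg hJ,
    fun p => gaugeHol_unit hD.smooth_θ hg hJ p,
    fun _ _ γ => gaugeHol_inv hD.smooth_θ hg hJ γ,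
    fun _ _ _ γ₂ γ₁ => gaugeHol_comp hD.smooth_θ hg hJ γ₂ γ₁,
    fun _ _ _ _ h => h.gaugeHol_eq hD hg hJ,
    fun _ hk => ⟨transportFunctor hD hk,
      transportFunctor (hD.gauge hg hJ) fun h => (hk h).gauge hD hg hJ,
      transportFunctor_isParallelTransport hD hk, transportFunctor_isParallelTransport _ _,
      gaugeTransformation hD hg hJ hk, fun _ => rfl, fun _ _ _ => rfl⟩⟩
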